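/- Let $T=(V,E)$ be a tree with $|V|=n\ge 1$, a root (start vertex) $v_s\in V$, and non-negative real vertex weights $w_v$ and edge weights $w_e$. A (single-group, no-return) deployment strategy for $k$ agents ($k$ real) is a walk in $T$ that starts at $v_s$, may end at any vertex, visits every vertex, and can be followed by a group of initially $k$ agents under the following rules: at the first visit of a vertex $v$ (for $v_s$, at the very beginning) the group must still contain at least $w_v$ agents, and $w_v$ of them leave the group and are settled at $v$ for good; an edge $e$ can be crossed only if the group then contains at least $w_e$ agents. The minimum number of agents of $T$ is the least $k$ for which a strategy exists. A leaf is a vertex of degree one different from $v_s$; an optimal visiting order of the leaves is the order in which some strategy with the minimum number of agents visits the leaves for the first time. Theorem. There is an algorithm which, given $T$ as a list of its edges (in any order and orientation) together with all weights and the root $v_s$, computes the minimum number of agents of $T$ and an optimal visiting order of the leaves in total time $O(n\log n)$. More precisely, there are a single program for a real random access machine and a constant $C$ such that on every such input the program halts with both results after at most $C\,n\,(\lfloor\log_2 n\rfloor+1)$ steps. Here the machine has integer and real variables and integer-indexed integer and real arrays; constants, memory accesses, additions, subtractions (truncated at $0$ on the integers, which are non-negative), and comparisons of two integers or of two reals cost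 one unit of time each, and there is no multiplication, no rounding and no conversion between integers and reals. -/

import Mathlib

/-! ### The deployment problem on trees -/

/-- A tree on the vertex set `{0, …, n - 1}` with a root (the start vertex), non-negative real
vertex weights, and non-negative real weights on its edges. The value of `edgeWeight` on a pair
that is not an edge is irrelevant. -/
structure WeightedTree (n : ℕ) where
  graph : SimpleGraph (Fin n)
  isTree : graph.IsTree
  root : Fin n
  vertexWeight : Fin n → ℝ
  edgeWeight : Sym2 (Fin n) → ℝ
  vertexWeight_nonneg : ∀ v, 0 ≤ vertexWeight v
  edgeWeight_nonneg : ∀ e ∈ graph.edgeSet, 0 ≤ edgeWeight e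

namespace WeightedTree

variable {n : ℕ}

/-- `T.CanFollow visited curr p`: a single group of `curr` non-settled agents standing at the
beginning of the walk `p` can follow `p` to its end when exactly the vertices in `visited` have
been visited before. To cross an edge, at least as many non-settled agents as the weight of the
edge are needed. At the first visit of a vertex, as many agents as its weight must be available,
and they are left there for good. -/
def CanFollow (T : WeightedTree n) (visited : Finset (Fin n)) (curr : ℝ) {u v : Fin n} :
    T.graph.Walk u v → Prop
  | .nil => True
  | .cons (u := a) (v := b) _ p =>
      T.edgeWeight s(a, b) ≤ curr ∧
        if b ∈ visited then T.CanFollow visited curr p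
        else T.vertexWeight b ≤ curr ∧
          T.CanFollow (insert b visited) (curr - T.vertexWeight b) p

/-- `T.IsStrategy k p`: the walk `p` from the root is a deployment strategy for `k` agents moving
in a single group (no-return variant: `p` may end anywhere). The root is covered first, then the
group follows `p`, and all vertices are visited. -/
def IsStrategy (T : WeightedTree n) (k : ℝ) {v : Fin n} (p : T.graph.Walk T.root v) : Prop :=
  T.vertexWeight T.root ≤ k ∧
    T.CanFollow {T.root} (k - T.vertexWeight T.root) p ∧
    ∀ x, x ∈ p.support

/-- `k` is the minimum number of agents with which a deployment strategy exists. -/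
def IsMinAgents (T : WeightedTree n) (k : ℝ) : Prop :=
  IsLeast {k' : ℝ | ∃ (v : Fin n) (p : T.graph.Walk T.root v), T.IsStrategy k' p} k

/-- The leaves of the rooted tree: the vertices of degree one other than the root. -/
def IsLeaf (T : WeightedTree n) (v : Fin n) : Prop :=
  v ≠ T.root ∧ ∃! u, T.graph.Adj v u

/-- `L` lists the leaves in the order in which the walk `p` visits them for the first time
(`idxOf` is the position of the first occurrence). -/
def IsLeafOrder (T : WeightedTree n) (L : List (Fin n)) {u v : Fin n}
    (p : T.graph.Walk u v) : Prop :=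
  (∀ x, x ∈ L ↔ T.IsLeaf x) ∧
    L.Pairwise fun x y => p.support.idxOf x < p.support.idxOf y

/-- `L` is an optimal visiting order of the leaves: some strategy with the minimum number of
agents visits the leaves in the order `L`. -/
def IsOptimalLeafOrder (T : WeightedTree n) (L : List (Fin n)) : Prop :=
  ∃ (k : ℝ) (v : Fin n) (p : T.graph.Walk T.root v),
    T.IsMinAgents k ∧ T.IsStrategy k p ∧ T.IsLeafOrder L p

/-- `ends` lists the edges of the tree, in any order and with any orientation. A tree on `n`
vertices has exactly `n - 1` edges, so that each edge is listed once. -/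
def IsEdgeList (T : WeightedTree n) (ends : Fin (n - 1) → Fin n × Fin n) : Prop :=
  Set.range (fun i => s((ends i).1, (ends i).2)) = T.graph.edgeSet

end WeightedTree

/-! ### The machine model: a real random access machine

Programs are structured programs over integer and real variables and integer and real arrays.
Arrays are indexed by integers only. Integers and reals can be added, subtracted and compared;
there is no multiplication, no rounding and no conversion between the two types.
Every operation, every memory access and every test costs one unit of time. -/

namespace RealRAM

/-- The memory: variables and arrays, each named by a number. A program mentions finitely many
of them. -/
structure Store where
  natVar : ℕ → ℕ
  realVar : ℕ → ℝ
  natArr : ℕ → ℕ → ℕ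
  realArr : ℕ → ℕ → ℝ

/-- Integer expressions; `get a i` reads the entry of the array `a` at index `i`, and `sub` is
truncated subtraction. -/
inductive NatExpr where
  | lit (k : ℕ)
  | var (x : ℕ)
  | get (a : ℕ) (i : NatExpr)
  | add (e f : NatExpr)
  | sub (e f : NatExpr)

/-- Real expressions; `get a i` reads the entry of the array `a` at index `i`. -/
inductive RealExpr where
  | lit (k : ℕ)
  | var (x : ℕ)
  | get (a : ℕ) (i : NatExpr)
  | add (e f : RealExpr)
  | sub (e f : RealExpr)

/-- Tests. -/
inductive Test where
  | natLt (e f : NatExpr)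
  | natEq (e f : NatExpr)
  | realLt (e f : RealExpr)
  | not (b : Test)
  | and (b c : Test)

/-- Programs. -/
inductive Program where
  | skip
  | setNat (x : ℕ) (e : NatExpr)
  | setReal (x : ℕ) (e : RealExpr)
  | putNat (a : ℕ) (i e : NatExpr)
  | putReal (a : ℕ) (i : NatExpr) (e : RealExpr)
  | seq (P Q : Program)
  | ite (b : Test) (P Q : Program)
  | loop (b : Test) (P : Program)

def NatExpr.eval (s : Store) : NatExpr → ℕ
  | .lit k => k
  | .var x => s.natVar x
  | .get a i => s.natArr a (i.eval s)
  | .add e f => e.eval s + f.eval s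
  | .sub e f => e.eval s - f.eval s

def NatExpr.cost : NatExpr → ℕ
  | .lit _ => 1
  | .var _ => 1
  | .get _ i => i.cost + 1
  | .add e f => e.cost + f.cost + 1
  | .sub e f => e.cost + f.cost + 1

noncomputable def RealExpr.eval (s : Store) : RealExpr → ℝ
  | .lit k => k
  | .var x => s.realVar x
  | .get a i => s.realArr a (i.eval s)
  | .add e f => e.eval s + f.eval s
  | .sub e f => e.eval s - f.eval s

def RealExpr.cost : RealExpr → ℕ
  | .lit _ => 1
  | .var _ => 1
  | .get _ i => i.cost + 1
  | .add e f => e.cost + f.cost + 1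
  | .sub e f => e.cost + f.cost + 1

def Test.Holds (s : Store) : Test → Prop
  | .natLt e f => e.eval s < f.eval s
  | .natEq e f => e.eval s = f.eval s
  | .realLt e f => e.eval s < f.eval s
  | .not b => ¬ b.Holds s
  | .and b c => b.Holds s ∧ c.Holds s

def Test.cost : Test → ℕ
  | .natLt e f => e.cost + f.cost + 1
  | .natEq e f => e.cost + f.cost + 1
  | .realLt e f => e.cost + f.cost + 1
  | .not b => b.cost + 1
  | .and b c => b.cost + c.cost + 1

namespace Store

/-- Change one integer variable. -/
def setNat (s : Store) (x k : ℕ) : Store :=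
  { s with natVar := Function.update s.natVar x k }

/-- Change one real variable. -/
def setReal (s : Store) (x : ℕ) (r : ℝ) : Store :=
  { s with realVar := Function.update s.realVar x r }

/-- Change the entry of the integer array `a` at index `i`. -/
def putNat (s : Store) (a i k : ℕ) : Store :=
  { s with natArr := Function.update s.natArr a (Function.update (s.natArr a) i k) }

/-- Change the entry of the real array `a` at index `i`. -/
def putReal (s : Store) (a i : ℕ) (r : ℝ) : Store :=
  { s with realArr := Function.update s.realArr a (Function.update (s.realArr a) i r) }

end Store

/-- `Exec P s s' t`: started in the store `s`, the program `P` halts after exactly `t` units of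
time in the store `s'`. -/
inductive Exec : Program → Store → Store → ℕ → Prop
  | skip (s : Store) : Exec .skip s s 1
  | setNat (s : Store) (x : ℕ) (e : NatExpr) :
      Exec (.setNat x e) s (s.setNat x (e.eval s)) (e.cost + 1)
  | setReal (s : Store) (x : ℕ) (e : RealExpr) :
      Exec (.setReal x e) s (s.setReal x (e.eval s)) (e.cost + 1)
  | putNat (s : Store) (a : ℕ) (i e : NatExpr) :
      Exec (.putNat a i e) s (s.putNat a (i.eval s) (e.eval s)) (i.cost + e.cost + 1)
  | putReal (s : Store) (a : ℕ) (i : NatExpr) (e : RealExpr) :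
      Exec (.putReal a i e) s (s.putReal a (i.eval s) (e.eval s)) (i.cost + e.cost + 1)
  | seq {P Q : Program} {s s₁ s₂ : Store} {t₁ t₂ : ℕ} :
      Exec P s s₁ t₁ → Exec Q s₁ s₂ t₂ → Exec (.seq P Q) s s₂ (t₁ + t₂)
  | iteTrue {b : Test} {P Q : Program} {s s' : Store} {t : ℕ} :
      b.Holds s → Exec P s s' t → Exec (.ite b P Q) s s' (b.cost + t + 1)
  | iteFalse {b : Test} {P Q : Program} {s s' : Store} {t : ℕ} :
      ¬ b.Holds s → Exec Q s s' t → Exec (.ite b P Q) s s' (b.cost + t + 1)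
  | loopDone {b : Test} {P : Program} {s : Store} :
      ¬ b.Holds s → Exec (.loop b P) s s (b.cost + 1)
  | loopStep {b : Test} {P : Program} {s s₁ s₂ : Store} {t₁ t₂ : ℕ} :
      b.Holds s → Exec P s s₁ t₁ → Exec (.loop b P) s₁ s₂ t₂ →
      Exec (.loop b P) s s₂ (b.cost + t₁ + t₂ + 1)

/-- The input store of a weighted tree given by a list of its edges: integer variable `0` holds
the number of vertices, integer variable `1` the root, the integer arrays `0` and `1` hold the two
end vertices of the edges, real array `0` the vertex weights and real array `1` the weights of the
edges in the order of the list. The rest of the memory is zero. -/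
noncomputable def input {n : ℕ} (T : WeightedTree n) (ends : Fin (n - 1) → Fin n × Fin n) :
    Store where
  natVar x := if x = 0 then n else if x = 1 then (T.root : ℕ) else 0
  realVar _ := 0
  natArr a i :=
    if h : i < n - 1 then
      if a = 0 then ((ends ⟨i, h⟩).1 : ℕ)
      else if a = 1 then ((ends ⟨i, h⟩).2 : ℕ)
      else 0
    else 0
  realArr a i :=
    if a = 0 then
      if h : i < n then T.vertexWeight ⟨i, h⟩ else 0
    else if a = 1 then
      if h : i < n - 1 then T.edgeWeight s((ends ⟨i, h⟩).1, (ends ⟨i, h⟩).2) else 0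
    else 0

/-- The list held by integer array `0`, its length being the value of integer variable `0`. -/
def Store.outputList (s : Store) : List ℕ :=
  (List.range (s.natVar 0)).map (s.natArr 0)

/-- The number held by real variable `0`. -/
def Store.outputReal (s : Store) : ℝ :=
  s.realVar 0

end RealRAM

/-! Number the edges in order of weight, and call the component of a vertex in the forest of edges
of rank less than `t` its level-`t` component. Fix the vertex `f` where a walk ends. If the
level-`t` component of `f` is not the whole tree, the walk crosses an edge of rank at least `t` for
a last time and stays in that component afterwards. Before this crossing it has visited everything
outside the component. Since the walk starts at the root, visited sets are closed under parents, so
every vertex with an edge of rank at least `t` below it has been visited too. These are the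
`Blocked` vertices, and the crossing needs `c t` agents besides those settled on them. This gives
the lower bound `Describes.demand_le`, next to the total weight (`Describes.weight_univ_le`).

Together these bounds are sharp. Call `x` far from `f` if the two share a component only at a late
level. If the vertices are visited in turn, farther ones first, then whenever an edge of rank `t` is
crossed, all vertices visited so far are blocked at level `t`, so the demand at level `t` pays for
the crossing (`exists_feasible_walk`, `exists_feasible_tour`, `exists_isStrategy`). On the way to
`x` only old vertices and vertices above `x` are met, so the leaves are first visited in the order
of the list.

It remains to minimise over `f`, and Kruskal's algorithm does this. For each component it keeps the
least possible maximum of the demands that its internal structure causes, an end vertex attaining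
it, and a suitable visiting order. When the edge of rank `t` joins two components, ending in one of
them costs the maximum of its old cost and of its demand at level `t`, which is the same for all its
vertices. The cheaper side is chosen, and its list is appended to the other list
(`isComponent_merge`). Levels at which the component of the end vertex already has its present form
are dominated by the present level (`demand_mono`). The demand is `c t` plus the total weight minus
the weight of the ready vertices, and the latter is easy to update because all vertices with ready
time `t + 1` lie in the component just formed (`top_eq_of_readyTime_eq`).

For the running time, edges are sorted with a tournament tree, with a table in place of division by
two. Ready times are found by stripping leaves; the degree, the sum of the neighbours and the sum of
the edge ranks identify the last neighbour of a vertex, so no adjacency lists are needed. Components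
are kept in a union-find structure with union by size. -/

/-! ### Reasoning about programs -/

namespace RealRAM

/-- Sequential composition. -/
infixr:65 " ;; " => Program.seq

/-- Started in `s`, the program `P` halts after at most `B` units of time, in a store
satisfying `Q`. -/
def HaltsWithin (P : Program) (s : Store) (B : ℕ) (Q : Store → Prop) : Prop :=
  ∃ s' t, Exec P s s' t ∧ t ≤ B ∧ Q s'

theorem HaltsWithin.mono {P : Program} {s : Store} {B B' : ℕ} {Q Q' : Store → Prop}
    (h : HaltsWithin P s B Q) (hB : B ≤ B') (hQ : ∀ s', Q s' → Q' s') :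
    HaltsWithin P s B' Q' := by
  obtain ⟨s', t, he, ht, hq⟩ := h
  exact ⟨s', t, he, ht.trans hB, hQ _ hq⟩

theorem HaltsWithin.seq {P P' : Program} {s : Store} {B₁ B₂ : ℕ} {Q R : Store → Prop}
    (h : HaltsWithin P s B₁ Q) (h' : ∀ s', Q s' → HaltsWithin P' s' B₂ R) :
    HaltsWithin (P ;; P') s (B₁ + B₂) R := by
  obtain ⟨s₁, t₁, he₁, ht₁, hq⟩ := h
  obtain ⟨s₂, t₂, he₂, ht₂, hr⟩ := h' _ hq
  exact ⟨s₂, t₁ + t₂, .seq he₁ he₂, by omega, hr⟩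

/-! #### Programs without loops -/

/-- The program contains no loop. -/
def Program.LoopFree : Program → Prop
  | .seq P Q => P.LoopFree ∧ Q.LoopFree
  | .ite _ P Q => P.LoopFree ∧ Q.LoopFree
  | .loop _ _ => False
  | _ => True

/-- An upper bound on the running time of a program without loops. -/
def Program.bound : Program → ℕ
  | .skip => 1
  | .setNat _ e => e.cost + 1
  | .setReal _ e => e.cost + 1
  | .putNat _ i e => i.cost + e.cost + 1
  | .putReal _ i e => i.cost + e.cost + 1
  | .seq P Q => P.bound + Q.bound
  | .ite b P Q => b.cost + (P.bound + Q.bound) + 1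
  | .loop _ _ => 0

open Classical in
/-- The final store of a program without loops. -/
noncomputable def Program.run : Program → Store → Store
  | .skip, s => s
  | .setNat x e, s => s.setNat x (e.eval s)
  | .setReal x e, s => s.setReal x (e.eval s)
  | .putNat a i e, s => s.putNat a (i.eval s) (e.eval s)
  | .putReal a i e, s => s.putReal a (i.eval s) (e.eval s)
  | .seq P Q, s => Q.run (P.run s)
  | .ite b P Q, s => if b.Holds s then P.run s else Q.run s
  | .loop _ _, s => s

/-- Reduces straight-line code to computing `run`. `bound` charges both branches of a conditional,
which is harmless for an upper bound. -/
theorem haltsWithin_run (P : Program) (hP : P.LoopFree) (s : Store) :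
    HaltsWithin P s P.bound (· = P.run s) := by
  induction P generalizing s with
  | skip => exact ⟨_, _, .skip s, le_rfl, rfl⟩
  | setNat x e => exact ⟨_, _, .setNat s x e, le_rfl, rfl⟩
  | setReal x e => exact ⟨_, _, .setReal s x e, le_rfl, rfl⟩
  | putNat a i e => exact ⟨_, _, .putNat s a i e, le_rfl, rfl⟩
  | putReal a i e => exact ⟨_, _, .putReal s a i e, le_rfl, rfl⟩
  | seq P Q ihP ihQ =>
    refine (ihP hP.1 s).seq fun s' hs' => (ihQ hP.2 s').mono le_rfl ?_
    rintro s'' rfl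
    rw [hs']
    rfl
  | ite b P Q ihP ihQ =>
    by_cases hb : b.Holds s
    · obtain ⟨s', t, he, ht, rfl⟩ := ihP hP.1 s
      exact ⟨_, _, .iteTrue hb he, by simp only [Program.bound]; omega,
        by simp [Program.run, hb]⟩
    · obtain ⟨s', t, he, ht, rfl⟩ := ihQ hP.2 s
      exact ⟨_, _, .iteFalse hb he, by simp only [Program.bound]; omega,
        by simp [Program.run, hb]⟩
  | loop b P _ => exact hP.elim

theorem HaltsWithin.of_run {P : Program} {s : Store} {B : ℕ} {Q : Store → Prop}
    (hP : P.LoopFree) (hB : P.bound ≤ B) (hQ : Q (P.run s)) : HaltsWithin P s B Q :=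
  (haltsWithin_run P hP s).mono hB fun _ h => h ▸ hQ

/-! #### Memory that a program leaves alone -/

/-- The program may change the integer variable `x`. -/
def Program.writesNatVar (x : ℕ) : Program → Bool
  | .setNat y _ => x == y
  | .seq P Q => P.writesNatVar x || Q.writesNatVar x
  | .ite _ P Q => P.writesNatVar x || Q.writesNatVar x
  | .loop _ P => P.writesNatVar x
  | _ => false

/-- The program may change the real variable `x`. -/
def Program.writesRealVar (x : ℕ) : Program → Bool
  | .setReal y _ => x == y
  | .seq P Q => P.writesRealVar x || Q.writesRealVar x
  | .ite _ P Q => P.writesRealVar x || Q.writesRealVar x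
  | .loop _ P => P.writesRealVar x
  | _ => false

/-- The program may change the integer array `a`. -/
def Program.writesNatArr (a : ℕ) : Program → Bool
  | .putNat c _ _ => a == c
  | .seq P Q => P.writesNatArr a || Q.writesNatArr a
  | .ite _ P Q => P.writesNatArr a || Q.writesNatArr a
  | .loop _ P => P.writesNatArr a
  | _ => false

/-- The program may change the real array `a`. -/
def Program.writesRealArr (a : ℕ) : Program → Bool
  | .putReal c _ _ => a == c
  | .seq P Q => P.writesRealArr a || Q.writesRealArr a
  | .ite _ P Q => P.writesRealArr a || Q.writesRealArr a
  | .loop _ P => P.writesRealArr a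
  | _ => false

/-- The stores `s` and `s'` agree wherever the program `P` does not write. -/
structure Frame (P : Program) (s s' : Store) : Prop where
  natVar : ∀ x, P.writesNatVar x = false → s'.natVar x = s.natVar x
  realVar : ∀ x, P.writesRealVar x = false → s'.realVar x = s.realVar x
  natArr : ∀ a, P.writesNatArr a = false → s'.natArr a = s.natArr a
  realArr : ∀ a, P.writesRealArr a = false → s'.realArr a = s.realArr a

theorem Frame.refl (P : Program) (s : Store) : Frame P s s :=
  ⟨fun _ _ => rfl, fun _ _ => rfl, fun _ _ => rfl, fun _ _ => rfl⟩

theorem Frame.trans {P : Program} {s s' s'' : Store} (h : Frame P s s') (h' : Frame P s' s'') :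
    Frame P s s'' :=
  ⟨fun x hx => (h'.natVar x hx).trans (h.natVar x hx),
    fun x hx => (h'.realVar x hx).trans (h.realVar x hx),
    fun x hx => (h'.natArr x hx).trans (h.natArr x hx),
    fun x hx => (h'.realArr x hx).trans (h.realArr x hx)⟩

theorem Frame.weaken {P P' : Program} {s s' : Store} (h : Frame P s s')
    (h₁ : ∀ x, P'.writesNatVar x = false → P.writesNatVar x = false)
    (h₂ : ∀ x, P'.writesRealVar x = false → P.writesRealVar x = false)
    (h₃ : ∀ x, P'.writesNatArr x = false → P.writesNatArr x = false)
    (h₄ : ∀ x, P'.writesRealArr x = false → P.writesRealArr x = false) : Frame P' s s' :=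
  ⟨fun x hx => h.natVar x (h₁ x hx), fun x hx => h.realVar x (h₂ x hx),
    fun x hx => h.natArr x (h₃ x hx), fun x hx => h.realArr x (h₄ x hx)⟩

/-- The write sets are computable Booleans, so for a concrete program and cell the side condition is
closed by `rfl`. Specifications then need to mention only memory that changes. -/
theorem Exec.frame {P : Program} {s s' : Store} {t : ℕ} (h : Exec P s s' t) : Frame P s s' := by
  induction h with
  | skip s => exact .refl _ _
  | setNat s x e =>
    refine ⟨fun y hy => ?_, fun _ _ => rfl, fun _ _ => rfl, fun _ _ => rfl⟩
    simp only [Program.writesNatVar, beq_eq_false_iff_ne] at hy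
    simp [Store.setNat, hy]
  | setReal s x e =>
    refine ⟨fun _ _ => rfl, fun y hy => ?_, fun _ _ => rfl, fun _ _ => rfl⟩
    simp only [Program.writesRealVar, beq_eq_false_iff_ne] at hy
    simp [Store.setReal, hy]
  | putNat s a i e =>
    refine ⟨fun _ _ => rfl, fun _ _ => rfl, fun y hy => ?_, fun _ _ => rfl⟩
    simp only [Program.writesNatArr, beq_eq_false_iff_ne] at hy
    simp [Store.putNat, hy]
  | putReal s a i e =>
    refine ⟨fun _ _ => rfl, fun _ _ => rfl, fun _ _ => rfl, fun y hy => ?_⟩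
    simp only [Program.writesRealArr, beq_eq_false_iff_ne] at hy
    simp [Store.putReal, hy]
  | seq _ _ ih₁ ih₂ =>
    refine Frame.trans (ih₁.weaken ?_ ?_ ?_ ?_) (ih₂.weaken ?_ ?_ ?_ ?_) <;> intro x hx <;>
      simp_all [Program.writesNatVar, Program.writesRealVar, Program.writesNatArr,
        Program.writesRealArr]
  | iteTrue _ _ ih =>
    refine ih.weaken ?_ ?_ ?_ ?_ <;> intro x hx <;>
      simp_all [Program.writesNatVar, Program.writesRealVar, Program.writesNatArr,
        Program.writesRealArr]
  | iteFalse _ _ ih =>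
    refine ih.weaken ?_ ?_ ?_ ?_ <;> intro x hx <;>
      simp_all [Program.writesNatVar, Program.writesRealVar, Program.writesNatArr,
        Program.writesRealArr]
  | loopDone _ => exact .refl _ _
  | loopStep _ _ _ ih₁ ih₂ =>
    refine Frame.trans (ih₁.weaken ?_ ?_ ?_ ?_) ih₂ <;> intro x hx <;>
      simpa [Program.writesNatVar, Program.writesRealVar, Program.writesNatArr,
        Program.writesRealArr] using hx

theorem HaltsWithin.frame {P : Program} {s : Store} {B : ℕ} {Q : Store → Prop}
    (h : HaltsWithin P s B Q) : HaltsWithin P s B fun s' => Q s' ∧ Frame P s s' := by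
  obtain ⟨s', t, he, ht, hq⟩ := h
  exact ⟨s', t, he, ht, hq, he.frame⟩

/-! #### Loops -/

/-- Total correctness of loops: each round takes time at most `B` and decreases the index of the
invariant. -/
theorem HaltsWithin.loop {b : Test} {P : Program} {B : ℕ} (I : ℕ → Store → Prop) {i : ℕ}
    {s₀ : Store} (h₀ : I i s₀)
    (hstep : ∀ i s, Frame (.loop b P) s₀ s → I i s → b.Holds s →
      ∃ j < i, HaltsWithin P s B (I j)) :
    HaltsWithin (.loop b P) s₀ (i * (B + b.cost + 1) + b.cost + 1)
      fun s => (¬ b.Holds s ∧ ∃ j, I j s) ∧ Frame (.loop b P) s₀ s := by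
  refine HaltsWithin.frame ?_
  suffices H : ∀ i s, Frame (.loop b P) s₀ s → I i s →
      HaltsWithin (.loop b P) s (i * (B + b.cost + 1) + b.cost + 1)
        fun s => ¬ b.Holds s ∧ ∃ j, I j s from H i s₀ (.refl _ _) h₀
  intro i
  induction i using Nat.strong_induction_on with
  | _ i ih =>
    intro s hF hI
    by_cases hb : b.Holds s
    · obtain ⟨j, hj, s₁, t₁, he₁, ht₁, hI₁⟩ := hstep i s hF hI hb
      have hF₁ : Frame (.loop b P) s₀ s₁ :=
        hF.trans (he₁.frame.weaken (fun _ h => h) (fun _ h => h) (fun _ h => h) fun _ h => h)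
      obtain ⟨s₂, t₂, he₂, ht₂, hq⟩ := ih j hj s₁ hF₁ hI₁
      refine ⟨s₂, _, .loopStep hb he₁ he₂, ?_, hq⟩
      -- The index drops by at least one, so the allowance for `i` covers this round together with
      -- the allowance for `j`.
      have : (j + 1) * (B + b.cost + 1) ≤ i * (B + b.cost + 1) := Nat.mul_le_mul_right _ hj
      rw [Nat.add_mul, Nat.one_mul] at this
      omega
    · exact ⟨s, _, .loopDone hb, by omega, hb, i, hI⟩

end RealRAM

/-! ### Rooted trees with ranked edges -/

/-- A rooted tree on `{0, …, n - 1}` whose edges are `{A t, B t}` for `t < n - 1`. The edge from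
`x` to its parent `par x` is the edge number `rk x`, and `dep` decreases towards the root. -/
structure RankedTree (n root : ℕ) (par rk dep A B : ℕ → ℕ) : Prop where
  root_lt : root < n
  par_lt : ∀ x < n, x ≠ root → par x < n
  dep_par : ∀ x < n, x ≠ root → dep (par x) < dep x
  rk_lt : ∀ x < n, x ≠ root → rk x < n - 1
  edge : ∀ x < n, x ≠ root → A (rk x) = x ∧ B (rk x) = par x ∨ A (rk x) = par x ∧ B (rk x) = x
  exists_rk_eq : ∀ t < n - 1, ∃ x < n, x ≠ root ∧ rk x = t

/-- One step towards the root along an edge of rank less than `t`. -/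
def climb (root : ℕ) (par rk : ℕ → ℕ) (t x : ℕ) : ℕ :=
  if x = root ∨ t ≤ rk x then x else par x

/-- The top vertex of the component of `x` in the forest of edges of rank less than `t`. -/
def top (root : ℕ) (par rk dep : ℕ → ℕ) (t x : ℕ) : ℕ :=
  (climb root par rk t)^[dep x] x

/-- `Tm v` is the least `t` such that all edges below `v` have rank less than `t`. -/
structure IsReadyTime (n root : ℕ) (par rk Tm : ℕ → ℕ) : Prop where
  le_par : ∀ x < n, x ≠ root → Tm x ≤ Tm (par x)
  rk_lt : ∀ x < n, x ≠ root → rk x < Tm (par x)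
  attained : ∀ v < n, Tm v = 0 ∨ ∃ x < n, x ≠ root ∧ par x = v ∧ (Tm v = Tm x ∨ Tm v = rk x + 1)

namespace RankedTree

variable {n root : ℕ} {par rk dep A B : ℕ → ℕ}

/-- Two different vertices with the same edge to the parent would be each other's parents, which
`dep` forbids. -/
theorem rk_inj (H : RankedTree n root par rk dep A B) {x y : ℕ} (hx : x < n) (hy : y < n)
    (hxr : x ≠ root) (hyr : y ≠ root) (h : rk x = rk y) : x = y := by
  have h₁ := H.edge x hx hxr
  have h₂ := H.edge y hy hyr
  have h₃ := H.dep_par x hx hxr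
  have h₄ := H.dep_par y hy hyr
  rw [h] at h₁
  by_contra hne
  have : par x = y ∧ par y = x := by omega
  rw [this.1] at h₃
  rw [this.2] at h₄
  omega

theorem climb_lt (H : RankedTree n root par rk dep A B) {t x : ℕ} (hx : x < n) :
    climb root par rk t x < n := by
  unfold climb
  split_ifs with h
  · exact hx
  · exact H.par_lt x hx (by tauto)

/-- Every step that moves lowers `dep`, so `dep x` steps are enough to get stuck. This justifies the
fixed number of iterations in `top`. -/
theorem climb_iterate (H : RankedTree n root par rk dep A B) {t : ℕ} (k : ℕ) :
    ∀ x < n, dep x ≤ k → climb root par rk t ((climb root par rk t)^[k] x) =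
      (climb root par rk t)^[k] x := by
  induction k with
  | zero =>
    intro x hx hd
    have : x = root := by
      by_contra hne
      have := H.dep_par x hx hne
      omega
    simp [climb, this]
  | succ k ih =>
    intro x hx hd
    rw [Function.iterate_succ_apply]
    by_cases h : climb root par rk t x = x
    · rw [h, Function.iterate_fixed h, h]
    · refine ih _ (H.climb_lt hx) ?_
      unfold climb at h ⊢
      split_ifs at h ⊢ with h'
      · exact absurd rfl h
      · have := H.dep_par x hx (by tauto)
        omega

theorem iterate_eq_top (H : RankedTree n root par rk dep A B) {t x k : ℕ} (hx : x < n)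
    (hk : dep x ≤ k) : (climb root par rk t)^[k] x = top root par rk dep t x := by
  obtain ⟨i, rfl⟩ := Nat.exists_eq_add_of_le' hk
  rw [Function.iterate_add_apply]
  exact Function.iterate_fixed (H.climb_iterate _ x hx le_rfl) i

theorem top_of_le (_H : RankedTree n root par rk dep A B) {t x : ℕ} (h : x = root ∨ t ≤ rk x) :
    top root par rk dep t x = x :=
  Function.iterate_fixed (by simp [climb, h]) _

theorem top_of_lt (H : RankedTree n root par rk dep A B) {t x : ℕ} (hx : x < n) (hxr : x ≠ root)
    (h : rk x < t) : top root par rk dep t x = top root par rk dep t (par x) := by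
  rw [← H.iterate_eq_top hx (Nat.le_succ _), Function.iterate_succ_apply]
  have : climb root par rk t x = par x := by
    unfold climb
    rw [if_neg (by omega)]
  rw [this]
  exact H.iterate_eq_top (H.par_lt x hx hxr) (H.dep_par x hx hxr).le

/-- Induction from the root to the leaves. -/
theorem induction (H : RankedTree n root par rk dep A B) {p : ℕ → Prop} (h₀ : p root)
    (h : ∀ x < n, x ≠ root → p (par x) → p x) : ∀ x < n, p x := by
  intro x
  induction hd : dep x using Nat.strong_induction_on generalizing x with
  | _ d ih =>
    intro hx
    by_cases hxr : x = root
    · rwa [hxr]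
    · exact h x hx hxr (ih _ (hd ▸ H.dep_par x hx hxr) (par x) rfl (H.par_lt x hx hxr))

theorem dep_top_le (H : RankedTree n root par rk dep A B) {t x : ℕ} (hx : x < n) :
    dep (top root par rk dep t x) ≤ dep x := by
  refine H.induction (p := fun x => dep (top root par rk dep t x) ≤ dep x) ?_ ?_ x hx
  · rw [H.top_of_le (.inl rfl)]
  · intro x hx hxr ih
    by_cases h : rk x < t
    · rw [H.top_of_lt hx hxr h]
      exact ih.trans (H.dep_par x hx hxr).le
    · rw [H.top_of_le (.inr (by omega))]

theorem top_par_ne (H : RankedTree n root par rk dep A B) {t x : ℕ} (hx : x < n)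
    (hxr : x ≠ root) : top root par rk dep t (par x) ≠ x := by
  intro h
  have h₁ := H.dep_top_le (t := t) (H.par_lt x hx hxr)
  have h₂ := H.dep_par x hx hxr
  rw [h] at h₁
  omega

/-- If the edge above `x` is missing, `x` is the top of its own component, whereas the top of `par
x` has smaller depth than `x`. -/
theorem top_par_eq_iff (H : RankedTree n root par rk dep A B) {t x : ℕ} (hx : x < n)
    (hxr : x ≠ root) :
    top root par rk dep t x = top root par rk dep t (par x) ↔ rk x < t := by
  refine ⟨fun h => ?_, H.top_of_lt hx hxr⟩
  by_contra hlt
  rw [H.top_of_le (.inr (by omega))] at h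
  exact H.top_par_ne hx hxr h.symm

/-- Before the edge above `z` is added, `z` is the top of its component. The new edge hangs exactly
this component below that of `par z`. -/
theorem top_succ (H : RankedTree n root par rk dep A B) {t z : ℕ} (hz : z < n) (hzr : z ≠ root)
    (hzt : rk z = t) : ∀ x < n, top root par rk dep (t + 1) x =
      if top root par rk dep t x = z then top root par rk dep t (par z)
      else top root par rk dep t x := by
  refine H.induction ?_ fun x hx hxr ih => ?_
  · rw [H.top_of_le (.inl rfl), H.top_of_le (.inl rfl), if_neg (Ne.symm hzr)]
  · rcases lt_trichotomy (rk x) t with h | h | h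
    · rw [H.top_of_lt hx hxr h, H.top_of_lt hx hxr (by omega), ih]
    · obtain rfl := H.rk_inj hx hz hxr hzr (h.trans hzt.symm)
      rw [H.top_of_lt hx hxr (by omega), ih, if_neg (H.top_par_ne hx hxr),
        H.top_of_le (.inr h.ge), if_pos rfl]
    · rw [H.top_of_le (.inr (by omega)), H.top_of_le (.inr (by omega)),
        if_neg (by rintro rfl; omega)]

theorem top_last (H : RankedTree n root par rk dep A B) {t : ℕ} (ht : n - 1 ≤ t) :
    ∀ x < n, top root par rk dep t x = root :=
  H.induction (H.top_of_le (.inl rfl)) fun x hx hxr ih => by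
    rw [H.top_of_lt hx hxr ((H.rk_lt x hx hxr).trans_le ht), ih]

/-- Components only grow: by `top_succ` the new top is a function of the old one. -/
theorem top_mono (H : RankedTree n root par rk dep A B) {t t' x y : ℕ} (hx : x < n) (hy : y < n)
    (h : top root par rk dep t x = top root par rk dep t y) (htt : t ≤ t') :
    top root par rk dep t' x = top root par rk dep t' y := by
  induction t', htt using Nat.le_induction with
  | base => exact h
  | succ k hk ih =>
    by_cases hkn : k < n - 1
    · obtain ⟨z, hz, hzr, hzt⟩ := H.exists_rk_eq k hkn
      rw [H.top_succ hz hzr hzt x hx, H.top_succ hz hzr hzt y hy, ih]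
    · rw [H.top_last (by omega) x hx, H.top_last (by omega) y hy]

theorem top_zero (H : RankedTree n root par rk dep A B) (x : ℕ) :
    top root par rk dep 0 x = x :=
  H.top_of_le (.inr (Nat.zero_le _))

/-- The effect on components of adding the edge of rank `t`. -/
theorem top_succ_eq_iff (H : RankedTree n root par rk dep A B) {t a b : ℕ} (ht : t < n - 1)
    (ha : top root par rk dep t a = top root par rk dep t (A t))
    (hb : top root par rk dep t b = top root par rk dep t (B t)) {x y : ℕ} (hx : x < n)
    (hy : y < n) :
    top root par rk dep (t + 1) x = top root par rk dep (t + 1) y ↔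
      top root par rk dep t x = top root par rk dep t y ∨
      top root par rk dep t x = top root par rk dep t a ∧
        top root par rk dep t y = top root par rk dep t b ∨
      top root par rk dep t x = top root par rk dep t b ∧
        top root par rk dep t y = top root par rk dep t a := by
  obtain ⟨z, hz, hzr, hzt⟩ := H.exists_rk_eq t ht
  have hzz : top root par rk dep t z = z := H.top_of_le (.inr hzt.ge)
  have hne := H.top_par_ne (t := t) hz hzr
  rw [H.top_succ hz hzr hzt x hx, H.top_succ hz hzr hzt y hy, ha, hb]
  rcases hzt ▸ H.edge z hz hzr with ⟨h₁, h₂⟩ | ⟨h₁, h₂⟩ <;> rw [h₁, h₂, hzz] <;> split_ifs <;>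
    grind

theorem top_ends_ne (H : RankedTree n root par rk dep A B) {t : ℕ} (ht : t < n - 1) :
    top root par rk dep t (A t) ≠ top root par rk dep t (B t) := by
  obtain ⟨z, hz, hzr, hzt⟩ := H.exists_rk_eq t ht
  have hne := H.top_par_ne (t := t) hz hzr
  have hzz : top root par rk dep t z = z := H.top_of_le (.inr hzt.ge)
  rcases hzt ▸ H.edge z hz hzr with ⟨h₁, h₂⟩ | ⟨h₁, h₂⟩ <;> rw [h₁, h₂, hzz]
  · exact hne.symm
  · exact hne

theorem ends_lt (H : RankedTree n root par rk dep A B) {t : ℕ} (ht : t < n - 1) :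
    A t < n ∧ B t < n := by
  obtain ⟨z, hz, hzr, hzt⟩ := H.exists_rk_eq t ht
  have := H.par_lt z hz hzr
  rcases hzt ▸ H.edge z hz hzr with ⟨h₁, h₂⟩ | ⟨h₁, h₂⟩ <;> rw [h₁, h₂] <;> simp [*]

variable {Tm : ℕ → ℕ}

/-- Induction from the leaves to the root. -/
theorem induction_up (H : RankedTree n root par rk dep A B) {p : ℕ → Prop}
    (h : ∀ v < n, (∀ x < n, x ≠ root → par x = v → p x) → p v) : ∀ v < n, p v := by
  intro v
  -- The sum serves as an upper bound for all depths, so that the measure decreases on passing to a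
  -- child.
  induction hd : (∑ x ∈ Finset.range n, dep x) - dep v using Nat.strong_induction_on
    generalizing v with
  | _ d ih =>
    intro hv
    refine h v hv fun x hx hxr hxv => ih _ ?_ x rfl hx
    have h₁ := H.dep_par x hx hxr
    have h₂ : dep x ≤ ∑ x ∈ Finset.range n, dep x :=
      Finset.single_le_sum (fun _ _ => Nat.zero_le _) (Finset.mem_range.2 hx)
    rw [hxv] at h₁
    omega

/-- If below `v` there is an edge of rank at least `t`, then a property that each such edge has at
one of its ends, and that is inherited by parents, holds at `v`. -/
theorem of_lt_readyTime (H : RankedTree n root par rk dep A B)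
    (hT : IsReadyTime n root par rk Tm) {t : ℕ} {C : ℕ → Prop}
    (hC : ∀ x < n, x ≠ root → C x → C (par x))
    (hE : ∀ x < n, x ≠ root → t ≤ rk x → C x ∨ C (par x)) :
    ∀ v < n, t < Tm v → C v := by
  refine H.induction_up fun v hv ih hlt => ?_
  rcases hT.attained v hv with h | ⟨x, hx, hxr, rfl, h⟩
  · omega
  -- If the edge to the child that attains `Tm v` has rank below `t`, the ready time must come from
  -- the child itself, and induction applies. Otherwise this edge is itself of rank at least `t`.
  · rcases lt_or_ge (rk x) t with hlt' | hge
    · exact hC x hx hxr (ih x hx hxr rfl (by omega))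
    · exact (hE x hx hxr hge).elim (hC x hx hxr) id

/-- All vertices that become ready by the edge of rank `t` lie in the component of that edge. -/
theorem top_eq_of_readyTime_eq (H : RankedTree n root par rk dep A B)
    (hT : IsReadyTime n root par rk Tm) {t : ℕ} (ht : t < n - 1) :
    ∀ v < n, Tm v = t + 1 →
      top root par rk dep (t + 1) v = top root par rk dep (t + 1) (A t) := by
  obtain ⟨z, hz, hzr, hzt⟩ := H.exists_rk_eq t ht
  have hzA : top root par rk dep (t + 1) (A t) = top root par rk dep (t + 1) (par z) := by
    have := H.top_of_lt (t := t + 1) hz hzr (by omega)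
    rcases hzt ▸ H.edge z hz hzr with ⟨h₁, h₂⟩ | ⟨h₁, h₂⟩ <;> rw [h₁]
    exact this
  rw [hzA]
  refine H.induction_up fun v hv ih h => ?_
  rcases hT.attained v hv with h' | ⟨x, hx, hxr, rfl, h'⟩
  · omega
  · have hrk := hT.rk_lt x hx hxr
    by_cases hx' : Tm x = t + 1
    · rw [← H.top_of_lt hx hxr (by omega)]
      exact ih x hx hxr rfl hx'
    · obtain rfl := H.rk_inj hx hz hxr hzr (by omega)
      rfl

end RankedTree

/-! ### Lower and upper bounds for deployment strategies -/

/-- `v` has to be visited before the last crossing of an edge of rank at least `t` by a walk that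
ends in `f`: some vertex below `v` is separated from `f` by such an edge. -/
def Blocked (root : ℕ) (par rk dep Tm : ℕ → ℕ) (t f v : ℕ) : Prop :=
  ¬ (top root par rk dep t v = top root par rk dep t f ∧ Tm v ≤ t)

open Classical in
/-- The number of agents needed at the last crossing of an edge of rank at least `t` by a walk that
ends in `f`. -/
noncomputable def demand (n root : ℕ) (par rk dep Tm : ℕ → ℕ) (c w : ℕ → ℝ) (t f : ℕ) : ℝ :=
  c t + ∑ v ∈ Finset.range n with Blocked root par rk dep Tm t f v, w v

/-- The weighted tree `T` is described by a ranked tree whose edge of rank `t` has weight `c t`,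
where `c` is monotone. -/
structure Describes {n : ℕ} (T : WeightedTree n) (par rk dep A B Tm : ℕ → ℕ) (c w : ℕ → ℝ) :
    Prop where
  ranked : RankedTree n T.root par rk dep A B
  ready : IsReadyTime n T.root par rk Tm
  adj : ∀ x y : Fin n, T.graph.Adj x y ↔ x ≠ T.root ∧ par x = y ∨ y ≠ T.root ∧ par y = x
  edgeWeight : ∀ x y : Fin n, x ≠ T.root → par x = y → T.edgeWeight s(x, y) = c (rk x)
  mono : ∀ t t', t ≤ t' → t' < n - 1 → c t ≤ c t'
  vertexWeight : ∀ x : Fin n, T.vertexWeight x = w x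

/-! ### Feasibility in terms of the total number of agents. -/

namespace WeightedTree

variable {n : ℕ} (T : WeightedTree n)

/-- The total weight of a set of vertices. -/
def weight (V : Finset (Fin n)) : ℝ := ∑ x ∈ V, T.vertexWeight x

variable {T}

theorem weight_mono {V V' : Finset (Fin n)} (h : V ⊆ V') : T.weight V ≤ T.weight V' :=
  Finset.sum_le_sum_of_subset_of_nonneg h fun x _ _ => T.vertexWeight_nonneg x

theorem weight_insert {V : Finset (Fin n)} {x : Fin n} (h : x ∉ V) :
    T.weight (insert x V) = T.weight V + T.vertexWeight x := by
  rw [weight, Finset.sum_insert h, add_comm, weight]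

/-- With `k` agents in total, the group can follow a walk when the vertices in `V` have been
visited before. -/
def Feasible (T : WeightedTree n) (k : ℝ) (V : Finset (Fin n)) {u v : Fin n}
    (p : T.graph.Walk u v) : Prop :=
  T.CanFollow V (k - T.weight V) p

/-- With the total `k` in place of the current group size, first visits and revisits take one form:
the visited set always becomes `insert b V`, and agents already settled appear only through its
weight. -/
theorem feasible_cons {k : ℝ} {V : Finset (Fin n)} {a b v : Fin n} (h : T.graph.Adj a b)
    (p : T.graph.Walk b v) :
    T.Feasible k V (.cons h p) ↔ T.edgeWeight s(a, b) + T.weight V ≤ k ∧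
      (b ∉ V → T.weight (insert b V) ≤ k) ∧ T.Feasible k (insert b V) p := by
  unfold Feasible
  rw [CanFollow]
  by_cases hb : b ∈ V
  · simp only [hb, if_true, Finset.insert_eq_of_mem, not_true, false_imp_iff, true_and]
    rw [le_sub_iff_add_le]
  · rw [if_neg hb, weight_insert hb, sub_add_eq_sub_sub, le_sub_iff_add_le]
    simp only [hb, not_false_eq_true, true_imp_iff]
    rw [le_sub_iff_add_le, add_comm (T.vertexWeight b)]

theorem feasible_append {k : ℝ} {V : Finset (Fin n)} {u v x : Fin n} (p : T.graph.Walk u v)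
    (q : T.graph.Walk v x) (hu : u ∈ V) (hp : T.Feasible k V p)
    (hq : T.Feasible k (V ∪ p.support.toFinset) q) : T.Feasible k V (p.append q) := by
  induction p generalizing V with
  | nil =>
    rw [SimpleGraph.Walk.nil_append]
    convert hq using 1
    simpa using (Finset.insert_eq_of_mem hu).symm
  | @cons a b c h p ih =>
    rw [feasible_cons] at hp
    rw [SimpleGraph.Walk.cons_append, feasible_cons]
    refine ⟨hp.1, hp.2.1, ih _ (Finset.mem_insert_self _ _) hp.2.2 ?_⟩
    convert hq using 1
    have hb : b ∈ p.support := p.start_mem_support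
    ext z
    simp only [Finset.mem_union, Finset.mem_insert, SimpleGraph.Walk.support_cons,
      List.toFinset_cons, List.mem_toFinset]
    constructor
    · rintro ((rfl | h) | h) <;> tauto
    · rintro (h | rfl | h) <;> tauto

/-- Each first visit checks that enough agents are left, so the bound on the settled agents is
carried along the walk. -/
theorem weight_le_of_feasible {k : ℝ} {V : Finset (Fin n)} {u v : Fin n} {p : T.graph.Walk u v}
    (hu : u ∈ V) (hp : T.Feasible k V p) (hV : T.weight V ≤ k) :
    T.weight (V ∪ p.support.toFinset) ≤ k := by
  induction p generalizing V with
  | nil =>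
    convert hV using 2
    simpa using hu
  | @cons a b c h p ih =>
    rw [feasible_cons] at hp
    have := ih (Finset.mem_insert_self _ _) hp.2.2 (by
      by_cases hb : b ∈ V
      · rwa [Finset.insert_eq_of_mem hb]
      · exact hp.2.1 hb)
    refine (weight_mono ?_).trans this
    intro z
    simp only [Finset.mem_union, Finset.mem_insert, SimpleGraph.Walk.support_cons,
      List.toFinset_cons, List.mem_toFinset]
    rintro (h | rfl | h) <;> tauto

theorem isStrategy_iff {k : ℝ} {v : Fin n} (p : T.graph.Walk T.root v) :
    T.IsStrategy k p ↔
      T.weight {T.root} ≤ k ∧ T.Feasible k {T.root} p ∧ ∀ x, x ∈ p.support := by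
  simp [IsStrategy, Feasible, weight]

end WeightedTree

/-! ### Lower bounds from last crossings. -/

namespace Describes

open WeightedTree

variable {n : ℕ} {T : WeightedTree n} {par rk dep A B Tm : ℕ → ℕ} {c w : ℕ → ℝ}

/-- A set of vertices that contains the parents of its members. -/
def IsClosed (T : WeightedTree n) (par : ℕ → ℕ) (V : Finset (Fin n)) : Prop :=
  ∀ x ∈ V, x ≠ T.root → ∀ y : Fin n, par x = y → y ∈ V

/-- Of two neighbours one is the parent of the other: either `b` is the parent of `a`, hence already
present, or `a` is the parent of `b`. -/
theorem isClosed_insert (D : Describes T par rk dep A B Tm c w) {V : Finset (Fin n)}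
    (hV : IsClosed T par V) {a b : Fin n} (ha : a ∈ V) (h : T.graph.Adj a b) :
    IsClosed T par (insert b V) := by
  intro x hx hxr y hy
  rw [Finset.mem_insert] at hx ⊢
  rcases hx with rfl | hx
  · rcases (D.adj _ _).1 h with ⟨h₁, h₂⟩ | ⟨h₁, h₂⟩
    · exact .inr (hV x (hV a ha h₁ x h₂) hxr y hy)
    · right
      have : y = a := Fin.ext (hy.symm.trans h₂)
      rwa [this]
  · exact .inr (hV x hx hxr y hy)

theorem demand_eq (D : Describes T par rk dep A B Tm c w) (t f : ℕ) :
    ∃ V : Finset (Fin n), (∀ v : Fin n, v ∈ V ↔ Blocked T.root par rk dep Tm t f v) ∧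
      demand n T.root par rk dep Tm c w t f = c t + T.weight V := by
  classical
  refine ⟨Finset.univ.filter fun v : Fin n => Blocked T.root par rk dep Tm t f v, by simp, ?_⟩
  rw [demand, weight, Finset.sum_filter, Finset.sum_filter, ← Fin.sum_univ_eq_sum_range
    (fun v => if Blocked T.root par rk dep Tm t f v then w v else 0)]
  simp only [D.vertexWeight]

/-- An edge between different level-`t` components has rank at least `t`, and `c` is monotone. -/
theorem edgeWeight_ge (D : Describes T par rk dep A B Tm c w) {a b : Fin n}
    (h : T.graph.Adj a b) {t : ℕ}
    (hne : top T.root par rk dep t a ≠ top T.root par rk dep t b) :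
    c t ≤ T.edgeWeight s(a, b) := by
  rcases (D.adj _ _).1 h with ⟨h₁, h₂⟩ | ⟨h₁, h₂⟩
  · have hv : (a : ℕ) ≠ T.root := fun h => h₁ (Fin.ext h)
    rw [D.edgeWeight a b h₁ h₂]
    refine D.mono _ _ ?_ (D.ranked.rk_lt a a.2 hv)
    rw [← h₂] at hne
    exact not_lt.1 fun hlt => hne (D.ranked.top_of_lt a.2 hv hlt)
  · have hv : (b : ℕ) ≠ T.root := fun h => h₁ (Fin.ext h)
    rw [Sym2.eq_swap, D.edgeWeight b a h₁ h₂]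
    refine D.mono _ _ ?_ (D.ranked.rk_lt b b.2 hv)
    rw [← h₂] at hne
    exact not_lt.1 fun hlt => hne (D.ranked.top_of_lt b.2 hv hlt).symm

/-- Either a walk to `f` stays in the component of `f`, or there is a last crossing of an edge of
rank at least `t`, before which everything outside of the component has been visited. -/
theorem exists_last_crossing (D : Describes T par rk dep A B Tm c w) {k : ℝ} {t : ℕ}
    {V : Finset (Fin n)} {u f : Fin n} (p : T.graph.Walk u f) (hu : u ∈ V)
    (hV : IsClosed T par V) (hp : T.Feasible k V p) :
    (∀ z ∈ p.support, top T.root par rk dep t z = top T.root par rk dep t f) ∨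
      ∃ V', IsClosed T par V' ∧ V ⊆ V' ∧ c t + T.weight V' ≤ k ∧
        ∀ z ∈ p.support, z ∈ V' ∨ top T.root par rk dep t z = top T.root par rk dep t f := by
  induction p generalizing V with
  | nil => simp
  | @cons a b f h p ih =>
    rw [feasible_cons] at hp
    rcases ih (Finset.mem_insert_self _ _) (D.isClosed_insert hV hu h) hp.2.2 with
      ih | ⟨V', hV', hsub, hk, hz⟩
    -- The rest of the walk stays in the component of `f`. The present edge is therefore either
    -- internal to it or the last crossing itself, and in the latter case the current visited set
    -- `V` is the witness.
    · by_cases hab : top T.root par rk dep t a = top T.root par rk dep t b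
      · left
        simp only [SimpleGraph.Walk.support_cons, List.mem_cons, forall_eq_or_imp]
        exact ⟨hab.trans (ih b p.start_mem_support), ih⟩
      · refine .inr ⟨V, hV, subset_rfl, ?_, ?_⟩
        · linarith [D.edgeWeight_ge h hab, hp.1]
        · simp only [SimpleGraph.Walk.support_cons, List.mem_cons, forall_eq_or_imp]
          exact ⟨.inl hu, fun z hz => .inr (ih z hz)⟩
    · refine .inr ⟨V', hV', (Finset.subset_insert _ _).trans hsub, hk, ?_⟩
      simp only [SimpleGraph.Walk.support_cons, List.mem_cons, forall_eq_or_imp]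
      exact ⟨.inl (hsub (Finset.mem_insert_of_mem hu)), hz⟩

theorem isClosed_root : IsClosed T par {T.root} := by
  intro x hx hxr
  exact absurd (Finset.mem_singleton.1 hx) hxr

/-- The total weight is a lower bound for the number of agents. -/
theorem weight_univ_le {k : ℝ} {f : Fin n} {p : T.graph.Walk T.root f} (hp : T.IsStrategy k p) :
    T.weight Finset.univ ≤ k := by
  rw [isStrategy_iff] at hp
  refine (weight_mono fun x _ => ?_).trans
    (weight_le_of_feasible (Finset.mem_singleton_self _) hp.2.1 hp.1)
  simp [hp.2.2 x]

/-- The demand at `f` is a lower bound for the number of agents of a strategy that ends in `f`. -/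
theorem demand_le (D : Describes T par rk dep A B Tm c w) {k : ℝ} {f : Fin n}
    {p : T.graph.Walk T.root f} (hp : T.IsStrategy k p) {t : ℕ}
    (ht : ∃ y < n, top T.root par rk dep t y ≠ top T.root par rk dep t f) :
    demand n T.root par rk dep Tm c w t f ≤ k := by
  rw [isStrategy_iff] at hp
  obtain ⟨V, hV, hd⟩ := D.demand_eq t f
  rcases D.exists_last_crossing (t := t) p (Finset.mem_singleton_self _) isClosed_root hp.2.1 with
    h | ⟨V', hcl, hsub, hk, hz⟩
  · obtain ⟨y, hy, hne⟩ := ht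
    exact absurd (h ⟨y, hy⟩ (hp.2.2 _)) hne
  · rw [hd]
    refine le_trans (add_le_add_right (weight_mono fun v hv => ?_) _) hk
    rw [hV, Blocked, not_and_or, not_le] at hv
    have hz' : ∀ z : Fin n, top T.root par rk dep t z ≠ top T.root par rk dep t f → z ∈ V' :=
      fun z hne => (hz z (hp.2.2 z)).resolve_right hne
    rcases hv with hv | hv
    · exact hz' v hv
    -- An edge of rank at least `t` lies below `v`. Its ends are not both in the component of `f`,
    -- so one of them is in `V'`, and closedness under parents carries membership up to `v`.
    · suffices H : ∃ h : (v : ℕ) < n, (⟨v, h⟩ : Fin n) ∈ V' from H.2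
      refine D.ranked.of_lt_readyTime D.ready (t := t)
        (C := fun v => ∃ h : v < n, (⟨v, h⟩ : Fin n) ∈ V') ?_ ?_ v v.2 hv
      · rintro x hx hxr ⟨hxn, hm⟩
        exact ⟨D.ranked.par_lt x hx hxr, hcl ⟨x, hx⟩ hm (fun h => hxr (congrArg Fin.val h)) _ rfl⟩
      · intro x hx hxr hge
        have hpx := D.ranked.par_lt x hx hxr
        by_cases hxf : top T.root par rk dep t x = top T.root par rk dep t f
        · refine .inr ⟨hpx, hz' _ fun h => ?_⟩
          have := (D.ranked.top_par_eq_iff hx hxr).1 (hxf.trans h.symm)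
          omega
        · exact .inl ⟨hx, hz' _ hxf⟩

/-! #### Construction of a strategy -/

/-- `Above T par x v`: the vertex `v` lies on the path from `x` to the root. -/
def Above (T : WeightedTree n) (par : ℕ → ℕ) : Fin n → Fin n → Prop :=
  Relation.ReflTransGen fun x y => x ≠ T.root ∧ par x = y

theorem above_root (D : Describes T par rk dep A B Tm c w) (x : Fin n) :
    Above T par x T.root := by
  refine D.ranked.induction (p := fun x => ∀ h : x < n, Above T par ⟨x, h⟩ T.root) ?_ ?_ x x.2 x.2
  · exact fun _ => .refl
  · intro x hx hxr ih hx'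
    exact .head ⟨fun h => hxr (congrArg Fin.val h), rfl⟩ (ih (D.ranked.par_lt x hx hxr))

/-- The vertices above a vertex outside of the component of `f` are blocked. -/
theorem blocked_of_above (D : Describes T par rk dep A B Tm c w) {t f : ℕ} {x v : Fin n}
    (h : Above T par x v) (hx : top T.root par rk dep t x ≠ top T.root par rk dep t f) :
    Blocked T.root par rk dep Tm t f v := by
  rintro ⟨hv, hTm⟩
  -- All edges below an unblocked vertex have rank less than `t`, so its component extends down to
  -- `x`.
  suffices H : Tm x ≤ t ∧ top T.root par rk dep t x = top T.root par rk dep t v from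
    hx (H.2.trans hv)
  clear hx hv
  induction h using Relation.ReflTransGen.head_induction_on with
  | refl => exact ⟨hTm, rfl⟩
  | @head x y h _ ih =>
    have hxr : (x : ℕ) ≠ T.root := fun h' => h.1 (Fin.ext h')
    have h₁ := D.ready.le_par x x.2 hxr
    have h₂ := D.ready.rk_lt x x.2 hxr
    rw [h.2] at h₁ h₂
    refine ⟨h₁.trans ih.1, Eq.trans ?_ ih.2⟩
    rw [← h.2]
    exact D.ranked.top_of_lt x.2 hxr (by omega)

/-- A vertex other than the root with something strictly below it has two neighbours, a child and
its parent. -/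
theorem eq_of_above_of_isLeaf (D : Describes T par rk dep A B Tm c w) {x v : Fin n}
    (h : Above T par x v) (hv : T.IsLeaf v) : v = x := by
  rcases Relation.ReflTransGen.cases_tail h with h | ⟨y, -, hy⟩
  · exact h
  · exfalso
    obtain ⟨hvr, u, hu, huniq⟩ := hv
    have hvr' : (v : ℕ) ≠ T.root := fun h' => hvr (Fin.ext h')
    have hyr' : (y : ℕ) ≠ T.root := fun h' => hy.1 (Fin.ext h')
    have h₁ := huniq y ((D.adj _ _).2 (.inr hy))
    have h₂ := huniq ⟨par v, D.ranked.par_lt v v.2 hvr'⟩ ((D.adj _ _).2 (.inl ⟨hvr, rfl⟩))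
    have h₃ := D.ranked.dep_par v v.2 hvr'
    have h₄ := D.ranked.dep_par y y.2 hyr'
    have h₅ : par v = y := congrArg Fin.val (h₂.trans h₁.symm)
    rw [hy.2] at h₄
    rw [h₅] at h₃
    omega

/-- `k` agents suffice for all demands at `f`. -/
structure Suffices (T : WeightedTree n) (par rk dep Tm : ℕ → ℕ) (c w : ℕ → ℝ) (k : ℝ)
    (f : ℕ) : Prop where
  weight_le : T.weight Finset.univ ≤ k
  demand_le : ∀ t < n - 1, (∃ y < n, top T.root par rk dep t y ≠ top T.root par rk dep t f) →
    demand n T.root par rk dep Tm c w t f ≤ k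

/-- The group can move from `u` to `x` if for each edge on the way all visited vertices are
blocked. -/
theorem exists_feasible_walk (D : Describes T par rk dep A B Tm c w) {k : ℝ} {f : ℕ}
    (hk : Suffices T par rk dep Tm c w k f) {V : Finset (Fin n)} (hV : IsClosed T par V) :
    ∀ (d : ℕ) (u x : Fin n), dep u + dep x = d → u ∈ V →
      (∀ t, top T.root par rk dep t u ≠ top T.root par rk dep t x →
        ∀ v ∈ V, Blocked T.root par rk dep Tm t f v) →
      ∃ p : T.graph.Walk u x, T.Feasible k V p ∧ ∀ z ∈ p.support, z ∈ V ∨ Above T par x z := by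
  -- The demand at level `rk y` pays for the edge above `y`. This demand is among those assumed,
  -- because the two ends of the edge are in different components at that level and cannot both be
  -- in that of `f`.
  have hedge : ∀ (U : Finset (Fin n)) (y : Fin n) (hy : (y : ℕ) ≠ T.root),
      (∀ v ∈ U, Blocked T.root par rk dep Tm (rk y) f v) → c (rk y) + T.weight U ≤ k := by
    intro U y hy hU
    obtain ⟨V', hV', hd⟩ := D.demand_eq (rk y) f
    refine le_trans ?_ (hk.demand_le (rk y) (D.ranked.rk_lt y y.2 hy) ?_)
    · rw [hd]
      exact add_le_add_right (weight_mono fun v hv => (hV' v).2 (hU v hv)) _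
    · by_contra! hcon
      have := (D.ranked.top_par_eq_iff y.2 hy).1
        ((hcon y y.2).trans (hcon _ (D.ranked.par_lt y y.2 hy)).symm)
      omega
  -- Being connected to a vertex that is not deeper requires the edge above `y`: without it `y`
  -- would be the top of the common component, hence shallower than `z`.
  have hne : ∀ (t : ℕ) (y z : Fin n), (y : ℕ) ≠ T.root → y ≠ z → dep z ≤ dep y →
      top T.root par rk dep t y = top T.root par rk dep t z → rk y < t := by
    intro t y z hy hyz hd htop
    by_contra hge
    rw [D.ranked.top_of_le (.inr (not_lt.1 hge))] at htop
    by_cases hzt : (z : ℕ) = T.root ∨ t ≤ rk z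
    · rw [D.ranked.top_of_le hzt] at htop
      exact hyz (Fin.ext htop)
    · push Not at hzt
      have h₁ := D.ranked.dep_top_le (t := t) (D.ranked.par_lt z z.2 hzt.1)
      rw [← D.ranked.top_of_lt z.2 hzt.1 hzt.2, ← htop] at h₁
      have h₂ := D.ranked.dep_par z z.2 hzt.1
      omega
  have hroot : ∀ y z : Fin n, y ≠ z → dep z ≤ dep y → (y : ℕ) ≠ T.root := by
    intro y z hyz hd hy
    have hz : (z : ℕ) ≠ T.root := fun h => hyz (Fin.ext (hy.trans h.symm))
    have h₁ := D.ranked.dep_top_le (t := n - 1) (D.ranked.par_lt z z.2 hz)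
    rw [D.ranked.top_last le_rfl _ (D.ranked.par_lt z z.2 hz), ← hy] at h₁
    have h₂ := D.ranked.dep_par z z.2 hz
    omega
  intro d
  induction d using Nat.strong_induction_on with
  | _ d ih =>
    intro u x hd hu hbl
    by_cases hux : u = x
    · subst hux
      exact ⟨.nil, trivial, by simp [hu]⟩
    -- The path is shortened at its deeper end: either its first step goes up from `u`, or its last
    -- step comes down to `x`.
    · rcases le_or_gt (dep x) (dep u) with hle | hlt
      · have hur := hroot u x hux hle
        have hur' : u ≠ T.root := fun h => hur (congrArg Fin.val h)
        obtain ⟨y, hy⟩ : ∃ y : Fin n, par u = y := ⟨⟨_, D.ranked.par_lt u u.2 hur⟩, rfl⟩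
        have hyV := hV u hu hur' y hy
        obtain ⟨p, hp, hps⟩ := ih (dep y + dep x)
          (by have := D.ranked.dep_par u u.2 hur; rw [hy] at this; omega) y x rfl hyV
          (fun t ht => hbl t fun h => ht <| by
            rw [← h, D.ranked.top_of_lt u.2 hur (hne t u x hur hux hle h), hy])
        have hadj := (D.adj u y).2 (.inl ⟨hur', hy⟩)
        refine ⟨.cons hadj p, ?_, ?_⟩
        · rw [feasible_cons, D.edgeWeight u y hur' hy, Finset.insert_eq_of_mem hyV]
          exact ⟨hedge V u hur (hbl _ fun h => lt_irrefl _ (hne _ u x hur hux hle h)),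
            fun h => absurd hyV h, hp⟩
        · simp only [SimpleGraph.Walk.support_cons, List.mem_cons, forall_eq_or_imp]
          exact ⟨.inl hu, hps⟩
      · have hxr := hroot x u (Ne.symm hux) hlt.le
        have hxr' : x ≠ T.root := fun h => hxr (congrArg Fin.val h)
        obtain ⟨y, hy⟩ : ∃ y : Fin n, par x = y := ⟨⟨_, D.ranked.par_lt x x.2 hxr⟩, rfl⟩
        have hnt : ∀ t, top T.root par rk dep t u = top T.root par rk dep t x → rk x < t :=
          fun t h => hne t x u hxr (Ne.symm hux) hlt.le h.symm
        obtain ⟨p, hp, hps⟩ := ih (dep u + dep y)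
          (by have := D.ranked.dep_par x x.2 hxr; rw [hy] at this; omega) u y rfl hu
          (fun t ht => hbl t fun h => ht <| by
            rw [h, D.ranked.top_of_lt x.2 hxr (hnt t h), hy])
        have hadj := (D.adj y x).2 (.inr ⟨hxr', hy⟩)
        refine ⟨p.append (.cons hadj .nil), feasible_append p _ hu hp ?_, ?_⟩
        · rw [feasible_cons, Sym2.eq_swap, D.edgeWeight x y hxr' hy]
          refine ⟨hedge _ x hxr fun v hv => ?_, fun _ => ?_, trivial⟩
          · have hvV : v ∈ V → Blocked T.root par rk dep Tm (rk x) f v :=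
              hbl _ (fun h => lt_irrefl _ (hnt _ h)) v
            rcases Finset.mem_union.1 hv with hv | hv
            · exact hvV hv
            · rcases hps v (List.mem_toFinset.1 hv) with hv | hv
              · exact hvV hv
              -- Vertices met on the way are above `y`, hence also above `x`. At level `rk x` the
              -- two ends of the edge are separated, so at least one of `x` and `y` is outside the
              -- component of `f`, and everything above that one is blocked.
              · by_cases hyf : top T.root par rk dep (rk x) y = top T.root par rk dep (rk x) f
                · refine D.blocked_of_above (.head ⟨hxr', hy⟩ hv) fun h => ?_
                  rw [← hyf, ← hy, D.ranked.top_par_eq_iff x.2 hxr] at h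
                  omega
                · exact D.blocked_of_above hv hyf
          · exact (weight_mono (Finset.subset_univ _)).trans hk.weight_le
        · intro z hz
          rw [SimpleGraph.Walk.mem_support_append_iff] at hz
          simp only [SimpleGraph.Walk.support_cons, SimpleGraph.Walk.support_nil, List.mem_cons,
            List.not_mem_nil, or_false] at hz
          have hyz : z = y → z ∈ V ∨ Above T par x z := by
            rintro rfl
            exact .inr (.single ⟨hxr', hy⟩)
          rcases hz with hz | hz | rfl
          · exact (hps z hz).imp_right (.head ⟨hxr', hy⟩)
          · exact hyz hz
          · exact .inr .refl

end Describes

namespace Describes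

open WeightedTree

variable {n : ℕ} {T : WeightedTree n} {par rk dep A B Tm : ℕ → ℕ} {c w : ℕ → ℝ}

theorem isClosed_union_support (D : Describes T par rk dep A B Tm c w) {V : Finset (Fin n)}
    (hV : IsClosed T par V) {u v : Fin n} (p : T.graph.Walk u v) (hu : u ∈ V) :
    IsClosed T par (V ∪ p.support.toFinset) := by
  induction p generalizing V with
  | nil =>
    convert hV using 1
    simpa using hu
  | @cons a b c h p ih =>
    convert ih (D.isClosed_insert hV hu h) (Finset.mem_insert_self _ _) using 1
    have hb : b ∈ p.support := p.start_mem_support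
    ext z
    simp only [Finset.mem_union, Finset.mem_insert, SimpleGraph.Walk.support_cons,
      List.toFinset_cons, List.mem_toFinset]
    constructor
    · rintro (h | rfl | h) <;> tauto
    · rintro ((rfl | h) | h) <;> tauto

/-- The group can visit the vertices of a list one after the other if vertices farther from `f`
come first. -/
theorem exists_feasible_tour (D : Describes T par rk dep A B Tm c w) {k : ℝ} {f : ℕ}
    (hk : Suffices T par rk dep Tm c w k f) {leaf : Fin n → Bool}
    (hlf : ∀ x, leaf x ↔ T.IsLeaf x) (l : List (Fin n)) :
    ∀ (u : Fin n) (V : Finset (Fin n)), IsClosed T par V → u ∈ V → l.Nodup →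
      (l.Pairwise fun x y : Fin n => ∀ t, top T.root par rk dep t x = top T.root par rk dep t f →
        top T.root par rk dep t y = top T.root par rk dep t f) →
      (∀ z ∈ u :: l, ∀ t, top T.root par rk dep t z ≠ top T.root par rk dep t f →
        ∀ v ∈ V, Blocked T.root par rk dep Tm t f v) →
      (∀ z ∈ l, T.IsLeaf z → z ∉ V) →
      ∃ (x : Fin n) (p : T.graph.Walk u x), T.Feasible k V p ∧
        (∀ z ∈ l, z ∈ p.support) ∧
        ((l.filter leaf).Pairwise fun y z =>
          p.support.idxOf y < p.support.idxOf z) := by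
  classical
  induction l with
  | nil => exact fun u V _ _ _ _ _ _ => ⟨u, .nil, trivial, by simp, by simp⟩
  | cons x l ih =>
    intro u V hV hu hnd hord hbl hleaf
    rw [List.nodup_cons] at hnd
    rw [List.pairwise_cons] at hord
    -- At a level that separates `u` from `x`, at least one of them is separated from `f`, and the
    -- hypothesis for that one shows that `V` is blocked.
    obtain ⟨p, hp, hps⟩ := D.exists_feasible_walk hk hV _ u x rfl hu (fun t ht => by
      by_cases hxf : top T.root par rk dep t x = top T.root par rk dep t f
      · exact hbl u (by simp) t fun h => ht (h.trans hxf.symm)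
      · exact hbl x (by simp) t hxf)
    have hxp : x ∈ p.support := p.end_mem_support
    -- The walk meets only old vertices and vertices above `x`; a leaf above `x` is `x` itself. So
    -- no later leaf is visited too early.
    have hlp : ∀ z ∈ l, T.IsLeaf z → z ∉ p.support := by
      intro z hz hzl hzp
      rcases hps z hzp with h | h
      · exact hleaf z (by simp [hz]) hzl h
      · rw [D.eq_of_above_of_isLeaf h hzl] at hz
        exact hnd.1 hz
    have hbl' : ∀ t, top T.root par rk dep t x ≠ top T.root par rk dep t f →
        ∀ v ∈ V ∪ p.support.toFinset, Blocked T.root par rk dep Tm t f v := by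
      intro t ht v hv
      have hvV := hbl x (by simp) t ht v
      rcases Finset.mem_union.1 hv with hv | hv
      · exact hvV hv
      · rcases hps v (List.mem_toFinset.1 hv) with hv | hv
        · exact hvV hv
        · exact D.blocked_of_above hv ht
    obtain ⟨y, q, hq, hqs, hqo⟩ := ih x (V ∪ p.support.toFinset)
      (D.isClosed_union_support hV p hu) (by simp) hnd.2 hord.2
      (by
        intro z hz t ht
        rcases List.mem_cons.1 hz with rfl | hz
        · exact hbl' t ht
        · exact hbl' t fun h => ht (hord.1 z hz t h))
      (by
        intro z hz hzl
        simp only [Finset.mem_union, List.mem_toFinset, not_or]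
        exact ⟨hleaf z (by simp [hz]) hzl, hlp z hz hzl⟩)
    refine ⟨y, p.append q, feasible_append p q hu hp hq, ?_, ?_⟩
    · intro z hz
      rw [SimpleGraph.Walk.mem_support_append_iff]
      rcases List.mem_cons.1 hz with rfl | hz
      · exact .inl hxp
      · exact .inr (hqs z hz)
    -- Later leaves do not occur in `p`, so their first occurrences in `q` are merely shifted. The
    -- `1` accounts for `x`, which ends `p` and starts `q`.
    · have hidx : ∀ z ∈ l, T.IsLeaf z → (p.append q).support.idxOf z + 1 =
          p.support.length + q.support.idxOf z := by
        intro z hz hzl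
        rw [SimpleGraph.Walk.support_append, List.idxOf_append_of_notMem (hlp z hz hzl)]
        have hzx : x ≠ z := by
          rintro rfl
          exact hnd.1 hz
        rw [← q.cons_tail_support, List.idxOf_cons_ne _ hzx, List.tail_cons]
        omega
      have htail : (l.filter leaf).Pairwise fun y z =>
          (p.append q).support.idxOf y < (p.append q).support.idxOf z := by
        refine hqo.imp_of_mem fun {y z} hy hz hyz => ?_
        simp only [List.mem_filter, hlf] at hy hz
        have h₁ := hidx y hy.1 hy.2
        have h₂ := hidx z hz.1 hz.2
        omega
      rw [List.filter_cons]
      split_ifs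
      · rw [List.pairwise_cons]
        refine ⟨fun z hz => ?_, htail⟩
        simp only [List.mem_filter, hlf] at hz
        rw [SimpleGraph.Walk.support_append, List.idxOf_append_of_notMem (hlp z hz.1 hz.2),
          List.idxOf_append_of_mem hxp]
        have := List.idxOf_lt_length_iff.2 hxp
        omega
      · exact htail

/-- A strategy that visits all vertices, vertices farther from `f` first. -/
theorem exists_isStrategy (D : Describes T par rk dep A B Tm c w) {k : ℝ} {f : ℕ}
    (hk : Suffices T par rk dep Tm c w k f) {l : List (Fin n)} (hl : l.Nodup) (hall : ∀ x, x ∈ l)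
    (hord : l.Pairwise fun x y : Fin n => ∀ t, top T.root par rk dep t x = top T.root par rk dep t f →
        top T.root par rk dep t y = top T.root par rk dep t f)
    {leaf : Fin n → Bool} (hlf : ∀ x, leaf x ↔ T.IsLeaf x) :
    ∃ (v : Fin n) (p : T.graph.Walk T.root v), T.IsStrategy k p ∧ T.IsLeafOrder (l.filter leaf) p := by
  classical
  obtain ⟨v, p, hp, hps, hpo⟩ := D.exists_feasible_tour hk hlf l T.root {T.root} isClosed_root (by simp)
    hl hord (by
      intro z _ t ht v hv
      rw [Finset.mem_singleton.1 hv]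
      exact D.blocked_of_above (D.above_root z) ht)
    (by
      intro z _ hz
      simpa using hz.1)
  refine ⟨v, p, (isStrategy_iff p).2 ⟨?_, hp, fun x => hps x (hall x)⟩, fun x => by simp [hall, hlf], hpo⟩
  exact (weight_mono (Finset.subset_univ _)).trans hk.weight_le

end Describes

/-! ### Rooting the tree and recognising its leaves. -/

/-- The vertices other than the root correspond to the edges of the tree. -/
theorem WeightedTree.exists_rankedTree {n : ℕ} (T : WeightedTree n) (A B : ℕ → ℕ)
    (hAB : ∀ x y : Fin n, T.graph.Adj x y ↔
      ∃ t < n - 1, A t = x ∧ B t = y ∨ A t = y ∧ B t = x) :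
    ∃ par rk dep : ℕ → ℕ, RankedTree n T.root par rk dep A B ∧
      ∀ x y : Fin n, T.graph.Adj x y ↔ x ≠ T.root ∧ par x = y ∨ y ≠ T.root ∧ par y = x := by
  -- The parent is the second vertex of a shortest walk to the root, and the distance to the root
  -- will serve as `dep`.
  have hpar : ∀ x : Fin n, ∃ y : Fin n, x ≠ T.root →
      T.graph.Adj x y ∧ T.graph.dist y T.root < T.graph.dist x T.root := by
    intro x
    obtain ⟨p, hp⟩ := T.isTree.connected.exists_walk_length_eq_dist x T.root
    cases p with
    | nil => exact ⟨T.root, fun h => absurd rfl h⟩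
    | @cons _ y _ h p =>
      refine ⟨y, fun _ => ⟨h, ?_⟩⟩
      have := T.graph.dist_le p
      rw [SimpleGraph.Walk.length_cons] at hp
      omega
  choose par hpar using hpar
  have hrk : ∀ x : Fin n, ∃ t, x ≠ T.root →
      t < n - 1 ∧ (A t = x ∧ B t = par x ∨ A t = par x ∧ B t = x) := by
    intro x
    by_cases hx : x = T.root
    · exact ⟨0, fun h => absurd hx h⟩
    · obtain ⟨t, h⟩ := (hAB x (par x)).1 (hpar x hx).1
      exact ⟨t, fun _ => h⟩
  choose rk hrk using hrk
  have hinj : Set.InjOn rk ((Finset.univ.erase T.root : Finset (Fin n)) : Set (Fin n)) := by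
    intro x hx y hy hxy
    simp only [Finset.coe_erase, Finset.coe_univ, Set.mem_sdiff, Set.mem_univ, true_and,
      Set.mem_singleton_iff] at hx hy
    by_contra hne
    have h₁ := (hrk x hx).2
    have h₂ := (hrk y hy).2
    have h₃ := (hpar x hx).2
    have h₄ := (hpar y hy).2
    rw [hxy] at h₁
    have hne' : (x : ℕ) ≠ y := fun h => hne (Fin.ext h)
    have h₅ : par x = y := Fin.ext (by omega)
    have h₆ : par y = x := Fin.ext (by omega)
    rw [h₅] at h₃
    rw [h₆] at h₄
    omega
  -- An injection from `n - 1` vertices into `n - 1` edge numbers is onto.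
  have himg : (Finset.univ.erase T.root).image rk = Finset.range (n - 1) := by
    refine Finset.eq_of_subset_of_card_le ?_ ?_
    · intro t ht
      obtain ⟨x, hx, rfl⟩ := Finset.mem_image.1 ht
      exact Finset.mem_range.2 (hrk x (Finset.ne_of_mem_erase hx)).1
    · rw [Finset.card_image_of_injOn hinj, Finset.card_erase_of_mem (Finset.mem_univ _)]
      simp
  have hex : ∀ t < n - 1, ∃ x : Fin n, x ≠ T.root ∧ rk x = t := by
    intro t ht
    rw [← Finset.mem_range, ← himg, Finset.mem_image] at ht
    obtain ⟨x, hx, h⟩ := ht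
    exact ⟨x, Finset.ne_of_mem_erase hx, h⟩
  refine ⟨fun x => if h : x < n then par ⟨x, h⟩ else 0, fun x => if h : x < n then rk ⟨x, h⟩ else 0,
    fun x => if h : x < n then T.graph.dist ⟨x, h⟩ T.root else 0, ?_, ?_⟩
  · have hr : ∀ (x : ℕ) (hx : x < n), x ≠ T.root → (⟨x, hx⟩ : Fin n) ≠ T.root :=
      fun x hx h h' => h (congrArg Fin.val h')
    refine ⟨T.root.2, ?_, ?_, ?_, ?_, ?_⟩
    · intro x hx hxr
      simp [hx]
    · intro x hx hxr
      simpa [hx] using (hpar _ (hr x hx hxr)).2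
    · intro x hx hxr
      simpa [hx] using (hrk _ (hr x hx hxr)).1
    · intro x hx hxr
      simpa [hx] using (hrk _ (hr x hx hxr)).2
    · intro t ht
      obtain ⟨x, hx, rfl⟩ := hex t ht
      exact ⟨x, x.2, fun h => hx (Fin.ext h), by simp⟩
  · intro x y
    simp only [x.2, y.2, dite_true, Fin.eta, ← Fin.ext_iff]
    constructor
    · intro h
      obtain ⟨t, ht, h⟩ := (hAB x y).1 h
      obtain ⟨z, hz, rfl⟩ := hex t ht
      have h' := (hrk z hz).2
      by_cases hzx : z = x
      · subst hzx
        exact .inl ⟨hz, Fin.ext (by omega)⟩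
      · have : (z : ℕ) ≠ x := fun h => hzx (Fin.ext h)
        have hzy : z = y := Fin.ext (by omega)
        subst hzy
        exact .inr ⟨hz, Fin.ext (by omega)⟩
    · rintro (⟨h, rfl⟩ | ⟨h, rfl⟩)
      · exact (hpar x h).1
      · exact (hpar y h).1.symm

/-- A vertex is a leaf if and only if it is no parent and not the root. -/
theorem Describes.isLeaf_iff {n : ℕ} {T : WeightedTree n} {par rk dep A B Tm : ℕ → ℕ}
    {c w : ℕ → ℝ} (D : Describes T par rk dep A B Tm c w) (x : Fin n) :
    T.IsLeaf x ↔ Tm x = 0 ∧ x ≠ T.root := by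
  constructor
  · intro h
    refine ⟨(D.ready.attained x x.2).resolve_right ?_, h.1⟩
    rintro ⟨y, hy, hyr, hyx, -⟩
    have := D.eq_of_above_of_isLeaf (x := ⟨y, hy⟩) (v := x)
      (.single ⟨fun h => hyr (congrArg Fin.val h), hyx⟩) h
    subst this
    have := D.ranked.dep_par y hy hyr
    change par y = y at hyx
    rw [hyx] at this
    exact lt_irrefl _ this
  · rintro ⟨h, hxr⟩
    have hxr' : (x : ℕ) ≠ T.root := fun h => hxr (Fin.ext h)
    refine ⟨hxr, ⟨par x, D.ranked.par_lt x x.2 hxr'⟩, (D.adj _ _).2 (.inl ⟨hxr, rfl⟩), ?_⟩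
    intro y hy
    rcases (D.adj _ _).1 hy with hy | hy
    · exact Fin.ext hy.2.symm
    · have hyr' : (y : ℕ) ≠ T.root := fun h => hy.1 (Fin.ext h)
      have := D.ready.rk_lt y y.2 hyr'
      rw [hy.2] at this
      omega

/-! ### Sorting with a tournament tree -/

namespace RealRAM

/-- The time scale of the algorithm. -/
def budget (n : ℕ) : ℕ := n * (Nat.log 2 n + 1)

theorem le_budget (n : ℕ) : n ≤ budget n := Nat.le_mul_of_pos_right _ (Nat.succ_pos _)

theorem log_le_budget {n : ℕ} (hn : 0 < n) : Nat.log 2 n + 1 ≤ budget n :=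
  Nat.le_mul_of_pos_left _ hn

/-- Compute `m = n - 1` and a power of two `N ≥ n`. -/
def sizeProgram : Program :=
  .setNat 2 (.sub (.var 0) (.lit 1)) ;;
  .setNat 3 (.lit 1) ;;
  .loop (.natLt (.var 3) (.var 0)) (.setNat 3 (.add (.var 3) (.var 3)))

/-- Tabulate `q / 2` for `q < 2 * N`. -/
def halfProgram : Program :=
  .setNat 4 (.lit 0) ;;
  .loop (.natLt (.var 4) (.var 3))
    (.putNat 2 (.add (.var 4) (.var 4)) (.var 4) ;;
     .putNat 2 (.add (.add (.var 4) (.var 4)) (.lit 1)) (.var 4) ;;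
     .setNat 4 (.add (.var 4) (.lit 1)))

/-- The index `i` of the invariant counts doublings that are enough to reach `n`. Doubling happens
only below `n`, so the result stays at most `2 * n`. Later only these two bounds and positivity are
used, not that the number is a power of two. -/
theorem sizeProgram_spec {s : Store} (hn : 0 < s.natVar 0) :
    HaltsWithin sizeProgram s (20 * budget (s.natVar 0)) fun s' =>
      s'.natVar 2 = s.natVar 0 - 1 ∧ s.natVar 0 ≤ s'.natVar 3 ∧
        s'.natVar 3 ≤ 2 * s.natVar 0 ∧ 0 < s'.natVar 3 := by
  set n := s.natVar 0 with hn'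
  have hb := log_le_budget hn
  unfold sizeProgram
  refine ((HaltsWithin.of_run (Q := fun s' => s'.natVar 0 = n ∧ s'.natVar 2 = n - 1)
    (by simp [Program.LoopFree]) le_rfl ?_).seq fun s₁ hs₁ =>
    (HaltsWithin.of_run (Q := fun s' => s'.natVar 0 = n ∧ s'.natVar 2 = n - 1 ∧ s'.natVar 3 = 1)
    (by simp [Program.LoopFree]) le_rfl ?_).seq fun s₂ hs₂ =>
    (HaltsWithin.loop (B := 4) (fun i s => 0 < s.natVar 3 ∧ s.natVar 3 ≤ 2 * n ∧
      n ≤ s.natVar 3 * 2 ^ i) (i := Nat.log 2 n + 1) ?_ ?_).mono le_rfl ?_).mono ?_ fun _ h => h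
  · simp [Program.run, Store.setNat, NatExpr.eval, ← hn']
  · simpa [Program.run, Store.setNat, NatExpr.eval, ← hn'] using hs₁
  · refine ⟨by omega, by omega, ?_⟩
    rw [hs₂.2.2, one_mul]
    exact (Nat.lt_pow_succ_log_self (by norm_num) n).le
  · rintro i s hF ⟨h₁, h₂, h₃⟩ hb
    simp only [Test.Holds, NatExpr.eval, hF.natVar 0 rfl, hs₂.1] at hb
    obtain _ | i := i
    · simp at h₃
      omega
    refine ⟨i, Nat.lt_succ_self i, .of_run (by simp [Program.LoopFree])
      (by simp [Program.bound, NatExpr.cost]) ?_⟩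
    simp only [Program.run, Store.setNat, NatExpr.eval, Function.update_self]
    refine ⟨by omega, by omega, ?_⟩
    rw [pow_succ] at h₃
    linarith
  · rintro s' ⟨⟨hb, j, h₁, h₂, -⟩, hF⟩
    simp only [Test.Holds, NatExpr.eval, hF.natVar 0 rfl, hs₂.1] at hb
    exact ⟨(hF.natVar 2 rfl).trans hs₂.2.1, by omega, h₂, h₁⟩
  · simp only [Program.bound, NatExpr.cost, Test.cost]
    omega

/-- The machine cannot divide, so the way from a tournament node up to its parent is looked up. One
round fills the entries `2 * j` and `2 * j + 1`. -/
theorem halfProgram_spec {s : Store} {n : ℕ} (hN : s.natVar 3 ≤ 2 * n) (hn : 0 < n) :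
    HaltsWithin halfProgram s (100 * budget n) fun s' =>
      ∀ q < 2 * s.natVar 3, s'.natArr 2 q = q / 2 := by
  set N := s.natVar 3 with hN'
  have hb := le_budget n
  unfold halfProgram
  refine ((HaltsWithin.of_run (Q := fun s' => s'.natVar 3 = N ∧ s'.natVar 4 = 0)
    (by simp [Program.LoopFree]) le_rfl ?_).seq fun s₁ hs₁ =>
    (HaltsWithin.loop (B := 20) (fun i s => i = N - s.natVar 4 ∧
      ∀ q < 2 * s.natVar 4, s.natArr 2 q = q / 2) (i := N) ?_ ?_).mono le_rfl ?_).mono ?_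
      fun _ h => h
  · simp [Program.run, Store.setNat, NatExpr.eval, ← hN']
  · rw [hs₁.2]
    simp
  · rintro i s hF ⟨h₁, h₂⟩ hb
    simp only [Test.Holds, NatExpr.eval, hF.natVar 3 rfl, hs₁.1] at hb
    refine ⟨N - (s.natVar 4 + 1), by omega, .of_run (by simp [Program.LoopFree])
      (by simp [Program.bound, NatExpr.cost]) ?_⟩
    simp only [Program.run, Store.setNat, Store.putNat, NatExpr.eval, Function.update_self,
      true_and]
    intro q hq
    simp only [Function.update_apply]
    split_ifs with h h'
    · omega
    · omega
    · exact h₂ q (by omega)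
  · rintro s' ⟨⟨hb, j, h₁, h₂⟩, hF⟩
    simp only [Test.Holds, NatExpr.eval, hF.natVar 3 rfl, hs₁.1] at hb
    exact fun q hq => h₂ q (by omega)
  · simp only [Program.bound, NatExpr.cost, Test.cost]
    omega

/-- The winner of a match between two players. Player `i` is represented by `i + 1`, and `0` means
that there is no player. -/
noncomputable def winner (key : ℕ → ℝ) (l r : ℕ) : ℕ :=
  if l = 0 then r else if ¬ r = 0 ∧ key (r - 1) < key (l - 1) then r else l

/-- Replay the match above the node `q`. -/
def replayStep : Program :=
  .setNat 6 (.get 2 (.var 5)) ;;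
  .setNat 7 (.get 3 (.add (.var 6) (.var 6))) ;;
  .setNat 8 (.get 3 (.add (.add (.var 6) (.var 6)) (.lit 1))) ;;
  .ite (.natEq (.var 7) (.lit 0)) (.putNat 3 (.var 6) (.var 8))
    (.ite (.and (.not (.natEq (.var 8) (.lit 0)))
        (.realLt (.get 1 (.sub (.var 8) (.lit 1))) (.get 1 (.sub (.var 7) (.lit 1)))))
      (.putNat 3 (.var 6) (.var 8)) (.putNat 3 (.var 6) (.var 7))) ;;
  .setNat 5 (.var 6)

theorem replayStep_run (s : Store) :
    (replayStep.run s).natVar 5 = s.natArr 2 (s.natVar 5) ∧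
    (replayStep.run s).natArr 3 = Function.update (s.natArr 3) (s.natArr 2 (s.natVar 5))
      (winner (s.realArr 1) (s.natArr 3 (2 * s.natArr 2 (s.natVar 5)))
        (s.natArr 3 (2 * s.natArr 2 (s.natVar 5) + 1))) := by
  simp only [replayStep, winner, two_mul, Program.run, Store.setNat, NatExpr.eval, Test.Holds,
    RealExpr.eval, Function.update_self]
  simp only [Function.update_apply]
  simp
  split_ifs <;> simp_all [Store.putNat]

/-- Replay the matches on the path from the leaf `q` to the root. -/
def replayProgram : Program := .loop (.natLt (.lit 1) (.var 5)) replayStep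

/-- All matches have been played. -/
def IsTournament (key : ℕ → ℝ) (N : ℕ) (tree : ℕ → ℕ) : Prop :=
  ∀ v, 1 ≤ v → v < N → tree v = winner key (tree (2 * v)) (tree (2 * v + 1))

/-- The invariant is that all matches are correct except possibly the one directly above the current
node. Replaying that match moves the possible defect one level up. At node `1` the exceptional index
is `0`, which is no match. Each round halves the node number, which bounds the number of rounds by
`p`. -/
theorem replayProgram_spec {s : Store} {N p : ℕ} (hhalf : ∀ q < 2 * N, s.natArr 2 q = q / 2)
    (hq₁ : 1 ≤ s.natVar 5) (hq₂ : s.natVar 5 < 2 * N) (hp : s.natVar 5 < 2 ^ p)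
    (htree : ∀ v, 1 ≤ v → v < N → v ≠ s.natVar 5 / 2 →
      s.natArr 3 v = winner (s.realArr 1) (s.natArr 3 (2 * v)) (s.natArr 3 (2 * v + 1))) :
    HaltsWithin replayProgram s (70 * (p + 1)) fun s' =>
      IsTournament (s.realArr 1) N (s'.natArr 3) ∧ ∀ v ≥ N, s'.natArr 3 v = s.natArr 3 v := by
  refine (HaltsWithin.loop (B := 60) (fun p s' => (∀ v ≥ N, s'.natArr 3 v = s.natArr 3 v) ∧
    1 ≤ s'.natVar 5 ∧ s'.natVar 5 < 2 * N ∧ s'.natVar 5 < 2 ^ p ∧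
    ∀ v, 1 ≤ v → v < N → v ≠ s'.natVar 5 / 2 →
      s'.natArr 3 v = winner (s.realArr 1) (s'.natArr 3 (2 * v)) (s'.natArr 3 (2 * v + 1)))
    (i := p) ⟨fun _ _ => rfl, hq₁, hq₂, hp, htree⟩ ?_).mono ?_ ?_
  · rintro p s' hF ⟨h₁, h₂, h₃, h₄, h₅⟩ hb
    simp only [Test.Holds, NatExpr.eval] at hb
    obtain _ | p := p
    · simp at h₄
      omega
    refine ⟨p, Nat.lt_succ_self p, .of_run (by simp [replayStep, Program.LoopFree])
      (by simp [replayStep, Program.bound, NatExpr.cost, RealExpr.cost, Test.cost]) ?_⟩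
    obtain ⟨e₁, e₂⟩ := replayStep_run s'
    have hh : s'.natArr 2 (s'.natVar 5) = s'.natVar 5 / 2 := by
      rw [hF.natArr 2 rfl, hhalf _ h₃]
    rw [hh] at e₁ e₂
    rw [hF.realArr 1 rfl] at e₂
    rw [pow_succ] at h₄
    rw [e₁, e₂]
    refine ⟨fun v hv => ?_, by omega, by omega, by omega, fun v hv hv' hne => ?_⟩
    · rw [Function.update_of_ne (by omega), h₁ v hv]
    · rw [Function.update_of_ne (a := 2 * v) (by omega),
        Function.update_of_ne (a := 2 * v + 1) (by omega)]
      by_cases h : v = s'.natVar 5 / 2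
      · rw [h, Function.update_self]
      · rw [Function.update_of_ne h, h₅ v hv hv' h]
  · simp only [Test.cost, NatExpr.cost]
    omega
  · rintro s' ⟨⟨hb, j, h₁, h₂, h₃, -, h₅⟩, hF⟩
    simp only [Test.Holds, NatExpr.eval] at hb
    exact ⟨fun v hv hv' => h₅ v hv hv' (by omega), h₁⟩

end RealRAM

namespace RealRAM

theorem mul_le_budget {n i b c : ℕ} (hi : i ≤ n) (hb : b ≤ c * (Nat.log 2 n + 1)) :
    i * b ≤ c * budget n := by
  calc i * b ≤ n * (c * (Nat.log 2 n + 1)) := Nat.mul_le_mul hi hb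
    _ = c * budget n := by rw [budget]; ring

theorem winner_left {key : ℕ → ℝ} {l : ℕ} (r : ℕ) (hl : l ≠ 0) :
    winner key l r ≠ 0 ∧ key (winner key l r - 1) ≤ key (l - 1) := by
  unfold winner
  rw [if_neg hl]
  split_ifs with h
  · exact ⟨h.1, h.2.le⟩
  · exact ⟨hl, le_rfl⟩

theorem winner_right {key : ℕ → ℝ} (l : ℕ) {r : ℕ} (hr : r ≠ 0) :
    winner key l r ≠ 0 ∧ key (winner key l r - 1) ≤ key (r - 1) := by
  unfold winner
  split_ifs with hl h
  · exact ⟨hr, le_rfl⟩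
  · exact ⟨hr, le_rfl⟩
  · exact ⟨hl, not_lt.1 fun hlt => h ⟨hr, hlt⟩⟩

theorem winner_eq_or (key : ℕ → ℝ) (l r : ℕ) : winner key l r = l ∨ winner key l r = r := by
  unfold winner
  split_ifs <;> simp

/-- On the way up from a nonempty node, nodes stay nonempty and keys of winners do not increase. -/
theorem IsTournament.root_le {key : ℕ → ℝ} {N : ℕ} {tree : ℕ → ℕ} (h : IsTournament key N tree) :
    ∀ q, 1 ≤ q → q < 2 * N → tree q ≠ 0 →
      tree 1 ≠ 0 ∧ key (tree 1 - 1) ≤ key (tree q - 1) := by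
  intro q
  induction q using Nat.strong_induction_on with
  | _ q ih =>
    intro hq₁ hq₂ hq
    by_cases hq' : q = 1
    · subst hq'
      exact ⟨hq, le_rfl⟩
    · have hw : tree (q / 2) ≠ 0 ∧ key (tree (q / 2) - 1) ≤ key (tree q - 1) := by
        rw [h (q / 2) (by omega) (by omega)]
        rcases Nat.even_or_odd' q with ⟨k, rfl | rfl⟩
        · rw [show 2 * k / 2 = k by omega]
          exact winner_left _ hq
        · rw [show (2 * k + 1) / 2 = k by omega]
          exact winner_right _ hq
      obtain ⟨h₁, h₂⟩ := ih (q / 2) (by omega) (by omega) (by omega) hw.1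
      exact ⟨h₁, h₂.trans hw.2⟩

theorem IsTournament.exists_leaf {key : ℕ → ℝ} {N : ℕ} {tree : ℕ → ℕ}
    (h : IsTournament key N tree) :
    ∀ q, 1 ≤ q → q < 2 * N → ∃ v < N, tree (N + v) = tree q := by
  intro q
  induction hd : 2 * N - q using Nat.strong_induction_on generalizing q with
  | _ d ih =>
    intro hq₁ hq₂
    by_cases hq : N ≤ q
    · exact ⟨q - N, by omega, by rw [Nat.add_sub_cancel' hq]⟩
    · rw [h q hq₁ (by omega)]
      rcases winner_eq_or key (tree (2 * q)) (tree (2 * q + 1)) with hw | hw <;> rw [hw]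
      · exact ih _ (by omega) (2 * q) rfl (by omega) (by omega)
      · exact ih _ (by omega) (2 * q + 1) rfl (by omega) (by omega)

/-- Replaying after a leaf has been changed. -/
theorem replayProgram_leaf {s : Store} {n N v k : ℕ} {tree : ℕ → ℕ}
    (hhalf : ∀ q < 2 * N, s.natArr 2 q = q / 2) (hN : N ≤ 2 * n) (hv : v < N)
    (htree : IsTournament (s.realArr 1) N tree) (hq : s.natVar 5 = N + v)
    (h : s.natArr 3 = Function.update tree (N + v) k) :
    HaltsWithin replayProgram s (280 * (Nat.log 2 n + 1)) fun s' =>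
      IsTournament (s.realArr 1) N (s'.natArr 3) ∧
        ∀ u < N, s'.natArr 3 (N + u) = if u = v then k else tree (N + u) := by
  have hlog : n < 2 ^ (Nat.log 2 n + 1) := Nat.lt_pow_succ_log_self (by norm_num) n
  -- Node numbers are below `2 * N ≤ 4 * n`, hence the two extra levels.
  refine (replayProgram_spec (s := s) (N := N) (p := Nat.log 2 n + 1 + 2) hhalf (by omega)
    (by omega) (by rw [pow_add]; omega) ?_).mono (by omega) ?_
  · intro u hu₁ hu₂ hne
    rw [h, Function.update_of_ne (by omega), Function.update_of_ne (by omega),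
      Function.update_of_ne (by omega), htree u hu₁ hu₂]
  · rintro s' ⟨h₁, h₂⟩
    refine ⟨h₁, fun u hu => ?_⟩
    rw [h₂ _ (by omega), h, Function.update_apply]
    simp

/-- Enter all players into the tournament. -/
def enterProgram : Program :=
  .setNat 4 (.lit 0) ;;
  .loop (.natLt (.var 4) (.var 2))
    ((.setNat 5 (.add (.var 3) (.var 4)) ;;
      .putNat 3 (.var 5) (.add (.var 4) (.lit 1))) ;;
     replayProgram ;;
     .setNat 4 (.add (.var 4) (.lit 1)))

theorem enterProgram_spec {s : Store} {n : ℕ} (hm : s.natVar 2 < s.natVar 3) (hmn : s.natVar 2 ≤ n)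
    (hN : s.natVar 3 ≤ 2 * n) (hn : 0 < n)
    (hhalf : ∀ q < 2 * s.natVar 3, s.natArr 2 q = q / 2) (hzero : ∀ q, s.natArr 3 q = 0) :
    HaltsWithin enterProgram s (500 * budget n) fun s' =>
      IsTournament (s.realArr 1) (s.natVar 3) (s'.natArr 3) ∧
        ∀ u < s.natVar 3, s'.natArr 3 (s.natVar 3 + u) = if u < s.natVar 2 then u + 1 else 0 := by
  set N := s.natVar 3 with hN'
  set m := s.natVar 2 with hm'
  have hb := log_le_budget hn
  unfold enterProgram
  refine ((HaltsWithin.of_run (Q := fun s' => s'.natVar 4 = 0)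
    (by simp [Program.LoopFree]) le_rfl ?_).frame.seq fun s₁ hs₁ =>
    (HaltsWithin.loop (B := 300 * (Nat.log 2 n + 1)) (fun i s' => i = m - s'.natVar 4 ∧
      s'.natVar 4 ≤ m ∧ IsTournament (s.realArr 1) N (s'.natArr 3) ∧
      ∀ u < N, s'.natArr 3 (N + u) = if u < s'.natVar 4 then u + 1 else 0)
      (i := m) ?_ ?_).mono le_rfl ?_).mono ?_ fun _ h => h
  · simp [Program.run, Store.setNat, NatExpr.eval]
  · rw [hs₁.1, hs₁.2.natArr 3 rfl]
    refine ⟨rfl, Nat.zero_le _, fun v _ _ => ?_, fun u _ => ?_⟩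
    · simp [hzero, winner]
    · simp [hzero]
  · rintro i s₂ hF ⟨h₁, -, h₂, h₃⟩ hb
    have hm₂ : s₂.natVar 2 = m := (hF.natVar 2 rfl).trans (hs₁.2.natVar 2 rfl)
    have hN₂ : s₂.natVar 3 = N := (hF.natVar 3 rfl).trans (hs₁.2.natVar 3 rfl)
    have hk₂ : s₂.realArr 1 = s.realArr 1 := (hF.realArr 1 rfl).trans (hs₁.2.realArr 1 rfl)
    have hh₂ : s₂.natArr 2 = s.natArr 2 := (hF.natArr 2 rfl).trans (hs₁.2.natArr 2 rfl)
    simp only [Test.Holds, NatExpr.eval, hm₂] at hb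
    refine ⟨m - (s₂.natVar 4 + 1), by omega, ?_⟩
    refine ((HaltsWithin.of_run (Q := fun s' => s'.natVar 5 = N + s₂.natVar 4 ∧
      s'.natArr 3 = Function.update (s₂.natArr 3) (N + s₂.natVar 4) (s₂.natVar 4 + 1))
      (by simp [Program.LoopFree]) le_rfl ?_).frame.seq fun s₃ hs₃ =>
      (replayProgram_leaf (n := n) (N := N) (v := s₂.natVar 4) ?_ hN (by omega) ?_ hs₃.1.1
        hs₃.1.2).frame.seq fun s₄ hs₄ => HaltsWithin.of_run
      (by simp [Program.LoopFree]) le_rfl ?_).mono ?_ fun _ h => h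
    · simp [Program.run, Store.setNat, Store.putNat, NatExpr.eval, hN₂]
    · rw [hs₃.2.natArr 2 rfl, hh₂]
      exact hhalf
    · rw [hs₃.2.realArr 1 rfl, hk₂]
      exact h₂
    · obtain ⟨⟨ht, hl⟩, hF₄⟩ := hs₄
      have h4 : s₄.natVar 4 = s₂.natVar 4 := (hF₄.natVar 4 rfl).trans (hs₃.2.natVar 4 rfl)
      rw [hs₃.2.realArr 1 rfl, hk₂] at ht
      simp only [Program.run, Store.setNat, NatExpr.eval, Function.update_self, h4, true_and]
      refine ⟨hb, ht, fun u hu => ?_⟩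
      rw [hl u hu, h₃ u hu]
      split_ifs <;> omega
    · simp only [Program.bound, NatExpr.cost]
      omega
  · rintro s' ⟨⟨hb, j, h₁, h₂, h₃, h₄⟩, hF⟩
    simp only [Test.Holds, NatExpr.eval, hF.natVar 2 rfl, hs₁.2.natVar 2 rfl] at hb
    have : s'.natVar 4 = m := by omega
    rw [this] at h₄
    exact ⟨h₃, h₄⟩
  · have := mul_le_budget (n := n) (i := m) (b := 300 * (Nat.log 2 n + 1) + (1 + 1 + 1) + 1) (c := 304) hmn
      (by omega)
    simp only [Program.bound, NatExpr.cost, Test.cost]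
    omega

/-- Repeatedly remove the winner of the tournament. -/
def extractProgram : Program :=
  .setNat 4 (.lit 0) ;;
  .loop (.natLt (.var 4) (.var 2))
    ((.setNat 9 (.sub (.get 3 (.lit 1)) (.lit 1)) ;;
      .putNat 15 (.var 4) (.var 9) ;;
      .setNat 5 (.add (.var 3) (.var 9)) ;;
      .putNat 3 (.var 5) (.lit 0)) ;;
     replayProgram ;;
     .setNat 4 (.add (.var 4) (.lit 1)))

/-- Each leaf either still holds its own player, whose key is at least that of every player removed
so far, or is empty because its player has been listed. The next winner has the least key among
those left, which keeps the list sorted and the invariant true. -/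
theorem extractProgram_spec {s : Store} {n : ℕ} (hm : s.natVar 2 < s.natVar 3)
    (hmn : s.natVar 2 ≤ n) (hN : s.natVar 3 ≤ 2 * n) (hn : 0 < n)
    (hhalf : ∀ q < 2 * s.natVar 3, s.natArr 2 q = q / 2)
    (htree : IsTournament (s.realArr 1) (s.natVar 3) (s.natArr 3))
    (hleaf : ∀ u < s.natVar 3,
      s.natArr 3 (s.natVar 3 + u) = if u < s.natVar 2 then u + 1 else 0) :
    HaltsWithin extractProgram s (500 * budget n) fun s' =>
      (∀ t < s.natVar 2, s'.natArr 15 t < s.natVar 2) ∧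
      (∀ t t', t < t' → t' < s.natVar 2 → s'.natArr 15 t ≠ s'.natArr 15 t' ∧
        s.realArr 1 (s'.natArr 15 t) ≤ s.realArr 1 (s'.natArr 15 t')) := by
  set N := s.natVar 3 with hN'
  set m := s.natVar 2 with hm'
  have hb := log_le_budget hn
  unfold extractProgram
  refine ((HaltsWithin.of_run (Q := fun s' => s'.natVar 4 = 0)
    (by simp [Program.LoopFree]) le_rfl ?_).frame.seq fun s₁ hs₁ =>
    (HaltsWithin.loop (B := 320 * (Nat.log 2 n + 1)) (fun i s' => i = m - s'.natVar 4 ∧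
      s'.natVar 4 ≤ m ∧ IsTournament (s.realArr 1) N (s'.natArr 3) ∧
      (∀ t < s'.natVar 4, s'.natArr 15 t < m) ∧
      (∀ t t', t < t' → t' < s'.natVar 4 → s'.natArr 15 t ≠ s'.natArr 15 t' ∧
        s.realArr 1 (s'.natArr 15 t) ≤ s.realArr 1 (s'.natArr 15 t')) ∧
      (∀ u < N, s'.natArr 3 (N + u) = u + 1 ∧ u < m ∧
          (∀ t < s'.natVar 4, s'.natArr 15 t ≠ u ∧ s.realArr 1 (s'.natArr 15 t) ≤ s.realArr 1 u) ∨
        s'.natArr 3 (N + u) = 0 ∧ (u < m → ∃ t < s'.natVar 4, s'.natArr 15 t = u)))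
      (i := m) ?_ ?_).mono le_rfl ?_).mono ?_ fun _ h => h
  · simp [Program.run, Store.setNat, NatExpr.eval]
  · rw [hs₁.1, hs₁.2.natArr 3 rfl]
    refine ⟨rfl, Nat.zero_le _, htree, by simp, by simp, fun u hu => ?_⟩
    rw [hleaf u hu]
    by_cases h : u < m <;> simp [h]
  · rintro i s₂ hF ⟨h₁, -, h₂, h₃, h₄, h₅⟩ hb
    have hm₂ : s₂.natVar 2 = m := (hF.natVar 2 rfl).trans (hs₁.2.natVar 2 rfl)
    have hN₂ : s₂.natVar 3 = N := (hF.natVar 3 rfl).trans (hs₁.2.natVar 3 rfl)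
    have hk₂ : s₂.realArr 1 = s.realArr 1 := (hF.realArr 1 rfl).trans (hs₁.2.realArr 1 rfl)
    have hh₂ : s₂.natArr 2 = s.natArr 2 := (hF.natArr 2 rfl).trans (hs₁.2.natArr 2 rfl)
    simp only [Test.Holds, NatExpr.eval, hm₂] at hb
    -- By counting, some player has not been listed yet. It still sits at its leaf, so the root of
    -- the tournament is nonempty.
    obtain ⟨u₀, hu₀m, hu₀⟩ : ∃ u < m, ∀ t < s₂.natVar 4, s₂.natArr 15 t ≠ u := by
      by_contra! hcon
      have : Finset.range m ⊆ (Finset.range (s₂.natVar 4)).image (s₂.natArr 15) := by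
        intro u hu
        obtain ⟨t, ht, h⟩ := hcon u (Finset.mem_range.1 hu)
        exact Finset.mem_image.2 ⟨t, Finset.mem_range.2 ht, h⟩
      have := (Finset.card_le_card this).trans Finset.card_image_le
      simp only [Finset.card_range] at this
      omega
    have hroot : ∀ u < N, s₂.natArr 3 (N + u) ≠ 0 → s₂.natArr 3 1 ≠ 0 ∧
        s.realArr 1 (s₂.natArr 3 1 - 1) ≤ s.realArr 1 u := by
      intro u hu hne
      have := h₂.root_le (N + u) (by omega) (by omega) hne
      rcases h₅ u hu with h | h
      · rwa [h.1, Nat.add_sub_cancel] at this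
      · exact absurd h.1 hne
    have hroot₀ : s₂.natArr 3 1 ≠ 0 := by
      refine (hroot u₀ (by omega) ?_).1
      rcases h₅ u₀ (by omega) with h | h
      · omega
      · obtain ⟨t, ht, h'⟩ := h.2 hu₀m
        exact absurd h' (hu₀ t ht)
    obtain ⟨v, hvN, hv⟩ := h₂.exists_leaf 1 le_rfl (by omega)
    obtain ⟨hv₁, hvm, hvt⟩ := (h₅ v hvN).resolve_right fun h => hroot₀ (hv ▸ h.1)
    have hv1 : s₂.natArr 3 1 - 1 = v := by omega
    rw [hv1] at hroot
    refine ⟨m - (s₂.natVar 4 + 1), by omega, ?_⟩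
    refine ((HaltsWithin.of_run (Q := fun s' => s'.natVar 5 = N + v ∧
      s'.natArr 3 = Function.update (s₂.natArr 3) (N + v) 0 ∧
      s'.natArr 15 = Function.update (s₂.natArr 15) (s₂.natVar 4) v)
      (by simp [Program.LoopFree]) le_rfl ?_).frame.seq fun s₃ hs₃ =>
      (replayProgram_leaf (n := n) (N := N) (v := v) ?_ hN (by omega) ?_ hs₃.1.1
        hs₃.1.2.1).frame.seq fun s₄ hs₄ => HaltsWithin.of_run
      (by simp [Program.LoopFree]) le_rfl ?_).mono ?_ fun _ h => h
    · simp [Program.run, Store.setNat, Store.putNat, NatExpr.eval, hN₂, hv1]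
    · rw [hs₃.2.natArr 2 rfl, hh₂]
      exact hhalf
    · rw [hs₃.2.realArr 1 rfl, hk₂]
      exact h₂
    · obtain ⟨⟨ht, hl⟩, hF₄⟩ := hs₄
      have h4 : s₄.natVar 4 = s₂.natVar 4 := (hF₄.natVar 4 rfl).trans (hs₃.2.natVar 4 rfl)
      have h15 : s₄.natArr 15 = Function.update (s₂.natArr 15) (s₂.natVar 4) v :=
        (hF₄.natArr 15 rfl).trans hs₃.1.2.2
      rw [hs₃.2.realArr 1 rfl, hk₂] at ht
      simp only [Program.run, Store.setNat, NatExpr.eval, Function.update_self, h4, true_and, h15]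
      have hold : ∀ t < s₂.natVar 4, Function.update (s₂.natArr 15) (s₂.natVar 4) v t =
          s₂.natArr 15 t := fun t ht => Function.update_of_ne (by omega) _ _
      have hnew : Function.update (s₂.natArr 15) (s₂.natVar 4) v (s₂.natVar 4) = v :=
        Function.update_self _ _ _
      generalize Function.update (s₂.natArr 15) (s₂.natVar 4) v = ord at hold hnew ⊢
      refine ⟨hb, ht, fun t ht' => ?_, fun t t' htt ht' => ?_, fun u hu => ?_⟩
      · rcases Nat.lt_succ_iff_lt_or_eq.1 ht' with h | rfl
        · rw [hold t h]
          exact h₃ t h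
        · rwa [hnew]
      · rcases Nat.lt_succ_iff_lt_or_eq.1 ht' with h | rfl
        · rw [hold t (by omega), hold t' h]
          exact h₄ t t' htt h
        · rw [hold t htt, hnew]
          exact hvt t htt
      · rw [hl u hu]
        split_ifs with huv
        · exact .inr ⟨rfl, fun _ => ⟨_, Nat.lt_succ_self _, hnew.trans huv.symm⟩⟩
        · rcases h₅ u hu with ⟨h, hum, h'⟩ | ⟨h, h'⟩
          · refine .inl ⟨h, hum, fun t ht' => ?_⟩
            rcases Nat.lt_succ_iff_lt_or_eq.1 ht' with ht' | rfl
            · rw [hold t ht']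
              exact h' t ht'
            · rw [hnew]
              exact ⟨Ne.symm huv, (hroot u hu (by omega)).2⟩
          · refine .inr ⟨h, fun hum => ?_⟩
            obtain ⟨t, ht', h''⟩ := h' hum
            exact ⟨t, by omega, (hold t ht').trans h''⟩
    · simp only [Program.bound, NatExpr.cost]
      omega
  · rintro s' ⟨⟨hb, j, h₁, h₂, h₃, h₄, h₅, -⟩, hF⟩
    simp only [Test.Holds, NatExpr.eval, hF.natVar 2 rfl, hs₁.2.natVar 2 rfl] at hb
    have : s'.natVar 4 = m := by omega
    rw [this] at h₄ h₅
    exact ⟨h₄, h₅⟩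
  · have := mul_le_budget (n := n) (i := m) (b := 320 * (Nat.log 2 n + 1) + (1 + 1 + 1) + 1) (c := 324) hmn
      (by omega)
    simp only [Program.bound, NatExpr.cost, Test.cost]
    omega

end RealRAM

namespace RealRAM

/-- Sort the edges by weight: array `15` receives the sorted list of edge numbers. -/
def sortProgram : Program :=
  sizeProgram ;; halfProgram ;; enterProgram ;; extractProgram

theorem sortProgram_spec {s : Store} (hn : 0 < s.natVar 0) (hzero : ∀ q, s.natArr 3 q = 0) :
    HaltsWithin sortProgram s (1120 * budget (s.natVar 0)) fun s' =>
      s'.natVar 2 = s.natVar 0 - 1 ∧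
      (∀ t < s.natVar 0 - 1, s'.natArr 15 t < s.natVar 0 - 1) ∧
      (∀ t t', t < t' → t' < s.natVar 0 - 1 → s'.natArr 15 t ≠ s'.natArr 15 t' ∧
        s.realArr 1 (s'.natArr 15 t) ≤ s.realArr 1 (s'.natArr 15 t')) := by
  set n := s.natVar 0 with hn'
  refine ((sizeProgram_spec hn).frame.seq fun s₁ hs₁ =>
    (halfProgram_spec (n := n) (by omega) hn).frame.seq fun s₂ hs₂ =>
    (enterProgram_spec (n := n) ?_ ?_ ?_ hn ?_ ?_).frame.seq fun s₃ hs₃ =>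
    (extractProgram_spec (n := n) ?_ ?_ ?_ hn ?_ ?_ ?_).frame.mono le_rfl ?_).mono
    (by simp only [← hn']; omega) fun _ h => h
  all_goals
    have e₂ : s₂.natVar 2 = n - 1 := (hs₂.2.natVar 2 rfl).trans hs₁.1.1
    have e₃ : s₂.natVar 3 = s₁.natVar 3 := hs₂.2.natVar 3 rfl
  · omega
  · omega
  · omega
  · rw [e₃]
    exact hs₂.1
  · intro q
    rw [hs₂.2.natArr 3 rfl, hs₁.2.natArr 3 rfl, hzero]
  all_goals
    have e₄ : s₃.natVar 2 = n - 1 := (hs₃.2.natVar 2 rfl).trans e₂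
    have e₅ : s₃.natVar 3 = s₁.natVar 3 := (hs₃.2.natVar 3 rfl).trans e₃
    have e₆ : s₃.realArr 1 = s.realArr 1 :=
      (hs₃.2.realArr 1 rfl).trans ((hs₂.2.realArr 1 rfl).trans (hs₁.2.realArr 1 rfl))
  · omega
  · omega
  · omega
  · rw [e₅, hs₃.2.natArr 2 rfl]
    exact hs₂.1
  · rw [hs₃.2.realArr 1 rfl, hs₃.2.natVar 3 rfl]
    exact hs₃.1.1
  · rw [hs₃.2.natVar 3 rfl, hs₃.2.natVar 2 rfl]
    exact hs₃.1.2
  · rintro s₄ ⟨⟨h₁, h₂⟩, hF⟩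
    rw [e₄] at h₁ h₂
    rw [e₆] at h₂
    exact ⟨(hF.natVar 2 rfl).trans e₄, h₁, h₂⟩

/-! ### Orienting the edges -/

/-- The sum over the first `m` edges at `v` of a function of the other end and the rank. -/
def incidenceSum (A B : ℕ → ℕ) (φ : ℕ → ℕ → ℕ) (m v : ℕ) : ℕ :=
  ∑ t ∈ Finset.range m, ((if A t = v then φ (B t) t else 0) + if B t = v then φ (A t) t else 0)

/-- The nested updates mirror the two successive writes in the body of the loop, the second of which
reads the array left by the first. -/
theorem incidenceSum_succ (A B : ℕ → ℕ) (φ : ℕ → ℕ → ℕ) (m : ℕ) :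
    incidenceSum A B φ (m + 1) =
      Function.update (Function.update (incidenceSum A B φ m) (A m)
        (incidenceSum A B φ m (A m) + φ (B m) m)) (B m)
        (Function.update (incidenceSum A B φ m) (A m)
          (incidenceSum A B φ m (A m) + φ (B m) m) (B m) + φ (A m) m) := by
  funext v
  rw [incidenceSum, Finset.sum_range_succ, ← incidenceSum]
  simp only [Function.update_apply]
  split_ifs <;> grind

/-- Compute for each vertex its degree, the sum of its neighbours, and the sum of the ranks of
its edges. -/
def degreeProgram : Program :=
  .setNat 4 (.lit 0) ;;
  .loop (.natLt (.var 4) (.var 2))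
    (.setNat 9 (.get 0 (.get 15 (.var 4))) ;;
     .setNat 10 (.get 1 (.get 15 (.var 4))) ;;
     .putNat 6 (.var 9) (.add (.get 6 (.var 9)) (.lit 1)) ;;
     .putNat 6 (.var 10) (.add (.get 6 (.var 10)) (.lit 1)) ;;
     .putNat 7 (.var 9) (.add (.get 7 (.var 9)) (.var 10)) ;;
     .putNat 7 (.var 10) (.add (.get 7 (.var 10)) (.var 9)) ;;
     .putNat 8 (.var 9) (.add (.get 8 (.var 9)) (.var 4)) ;;
     .putNat 8 (.var 10) (.add (.get 8 (.var 10)) (.var 4)) ;;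
     .setNat 4 (.add (.var 4) (.lit 1)))

theorem degreeProgram_spec {s : Store} {n : ℕ} {A B : ℕ → ℕ} (hm : s.natVar 2 ≤ n) (hn : 0 < n)
    (hA : ∀ t, s.natArr 0 (s.natArr 15 t) = A t) (hB : ∀ t, s.natArr 1 (s.natArr 15 t) = B t)
    (h6 : s.natArr 6 = 0) (h7 : s.natArr 7 = 0) (h8 : s.natArr 8 = 0) :
    HaltsWithin degreeProgram s (200 * budget n) fun s' =>
      s'.natArr 6 = incidenceSum A B (fun _ _ => 1) (s.natVar 2) ∧
      s'.natArr 7 = incidenceSum A B (fun x _ => x) (s.natVar 2) ∧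
      s'.natArr 8 = incidenceSum A B (fun _ t => t) (s.natVar 2) := by
  set m := s.natVar 2 with hm'
  have hb := le_budget n
  unfold degreeProgram
  refine ((HaltsWithin.of_run (Q := fun s' => s'.natVar 4 = 0)
    (by simp [Program.LoopFree]) le_rfl ?_).frame.seq fun s₁ hs₁ =>
    (HaltsWithin.loop (B := 100) (fun i s' => i = m - s'.natVar 4 ∧ s'.natVar 4 ≤ m ∧
      s'.natArr 6 = incidenceSum A B (fun _ _ => 1) (s'.natVar 4) ∧
      s'.natArr 7 = incidenceSum A B (fun x _ => x) (s'.natVar 4) ∧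
      s'.natArr 8 = incidenceSum A B (fun _ t => t) (s'.natVar 4))
      (i := m) ?_ ?_).mono le_rfl ?_).mono ?_ fun _ h => h
  · simp [Program.run, Store.setNat, NatExpr.eval]
  · rw [hs₁.1, hs₁.2.natArr 6 rfl, hs₁.2.natArr 7 rfl, hs₁.2.natArr 8 rfl, h6, h7, h8]
    exact ⟨rfl, Nat.zero_le _, rfl, rfl, rfl⟩
  · rintro i s₂ hF ⟨h₁, -, e6, e7, e8⟩ hb
    have hm₂ : s₂.natVar 2 = m := (hF.natVar 2 rfl).trans (hs₁.2.natVar 2 rfl)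
    have hA₂ : s₂.natArr 0 (s₂.natArr 15 (s₂.natVar 4)) = A (s₂.natVar 4) := by
      rw [hF.natArr 0 rfl, hF.natArr 15 rfl, hs₁.2.natArr 0 rfl, hs₁.2.natArr 15 rfl, hA]
    have hB₂ : s₂.natArr 1 (s₂.natArr 15 (s₂.natVar 4)) = B (s₂.natVar 4) := by
      rw [hF.natArr 1 rfl, hF.natArr 15 rfl, hs₁.2.natArr 1 rfl, hs₁.2.natArr 15 rfl, hB]
    simp only [Test.Holds, NatExpr.eval, hm₂] at hb
    refine ⟨m - (s₂.natVar 4 + 1), by omega, .of_run (by simp [Program.LoopFree])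
      (by simp [Program.bound, NatExpr.cost]) ?_⟩
    simp [Program.run, Store.setNat, Store.putNat, NatExpr.eval, hA₂, hB₂, incidenceSum_succ,
      e6, e7, e8]
    omega
  · rintro s' ⟨⟨hb, j, h₁, h₂, h₃⟩, hF⟩
    simp only [Test.Holds, NatExpr.eval, hF.natVar 2 rfl, hs₁.2.natVar 2 rfl] at hb
    have : s'.natVar 4 = m := by omega
    rwa [this] at h₃
  · simp only [Program.bound, NatExpr.cost, Test.cost]
    omega

end RealRAM

/-! ### Stripping leaves. -/

/-- The sum over the edges at `v` within the set `U` of a function of the other end and the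
rank. -/
def liveSum (root : ℕ) (par rk : ℕ → ℕ) (U : Finset ℕ) (φ : ℕ → ℕ → ℕ) (v : ℕ) : ℕ :=
  ∑ x ∈ U.erase root, ((if x = v then φ (par x) (rk x) else 0) + if par x = v then φ x (rk x) else 0)

/-- `rk` is a bijection from the vertices other than the root to the edge numbers, so a sum over
edges can be indexed by their lower ends. -/
theorem RankedTree.incidenceSum_eq {n root : ℕ} {par rk dep A B : ℕ → ℕ}
    (H : RankedTree n root par rk dep A B) (φ : ℕ → ℕ → ℕ) (v : ℕ) :
    RealRAM.incidenceSum A B φ (n - 1) v = liveSum root par rk (Finset.range n) φ v := by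
  symm
  refine Finset.sum_bij (fun x _ => rk x) ?_ ?_ ?_ ?_
  · intro x hx
    simp only [Finset.mem_erase, Finset.mem_range] at hx ⊢
    exact H.rk_lt x hx.2 hx.1
  · intro x hx y hy h
    simp only [Finset.mem_erase, Finset.mem_range] at hx hy
    exact H.rk_inj hx.2 hy.2 hx.1 hy.1 h
  · intro t ht
    obtain ⟨x, hx, hxr, h⟩ := H.exists_rk_eq t (Finset.mem_range.1 ht)
    exact ⟨x, by simp [hx, hxr], h⟩
  · intro x hx
    simp only [Finset.mem_erase, Finset.mem_range] at hx
    rcases H.edge x hx.2 hx.1 with ⟨h₁, h₂⟩ | ⟨h₁, h₂⟩ <;> rw [h₁, h₂]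
    rw [add_comm]

/-- Only the edge above `z` disappears, and apart from `z` it is seen only by the parent. The
additive form avoids truncated subtraction. -/
theorem liveSum_erase {root : ℕ} {par rk : ℕ → ℕ} {U : Finset ℕ} {z : ℕ} (hz : z ∈ U)
    (hzr : z ≠ root) (φ : ℕ → ℕ → ℕ) {v : ℕ} (hv : v ≠ z) :
    liveSum root par rk (U.erase z) φ v + (if par z = v then φ z (rk z) else 0) =
      liveSum root par rk U φ v := by
  unfold liveSum
  rw [Finset.erase_right_comm, ← Finset.sum_erase_add (a := z) (U.erase root) _ (by simp [hz, hzr]),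
    if_neg (Ne.symm hv), zero_add]

/-- The edge to the parent already accounts for the degree, so no child is left and every sum over
the edges at `z` has a single term. This is how the sums of neighbours and ranks reveal the parent
and the edge. -/
theorem liveSum_of_degree_eq_one {root : ℕ} {par rk : ℕ → ℕ} {U : Finset ℕ} {z : ℕ} (hz : z ∈ U)
    (hzr : z ≠ root) (h : liveSum root par rk U (fun _ _ => 1) z = 1) :
    (∀ x ∈ U, x ≠ root → par x ≠ z) ∧
      ∀ φ, liveSum root par rk U φ z = φ (par z) (rk z) := by
  have hzU : z ∈ U.erase root := by simp [hz, hzr]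
  unfold liveSum at h ⊢
  rw [← Finset.sum_erase_add _ _ hzU, if_pos rfl] at h
  have h₀ : par z ≠ z := by
    intro h'
    rw [if_pos h'] at h
    dsimp only at h
    omega
  rw [if_neg h₀, add_zero, Nat.add_eq_right, Finset.sum_eq_zero_iff] at h
  have hx : ∀ x ∈ (U.erase root).erase z, par x ≠ z := by
    intro x hx hxz
    have := h x hx
    rw [if_pos hxz] at this
    dsimp only at this
    omega
  constructor
  · intro x hxU hxr
    by_cases hxz : x = z
    · rwa [hxz]
    · exact hx x (by simp [hxU, hxr, hxz])
  · intro φ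
    rw [← Finset.sum_erase_add _ _ hzU, if_pos rfl, if_neg h₀, Finset.sum_eq_zero, zero_add,
      add_zero]
    intro x hx'
    rw [if_neg (Finset.ne_of_mem_erase hx'), if_neg (hx x hx'), add_zero]

namespace RealRAM

/-- Remove the vertex `q` of degree one, and update the data of its only neighbour. -/
def stripStep : Program :=
  .setNat 6 (.get 7 (.var 5)) ;;
  .setNat 7 (.get 8 (.var 5)) ;;
  .putNat 6 (.var 5) (.lit 0) ;;
  .putNat 6 (.var 6) (.sub (.get 6 (.var 6)) (.lit 1)) ;;
  .putNat 7 (.var 6) (.sub (.get 7 (.var 6)) (.var 5)) ;;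
  .putNat 8 (.var 6) (.sub (.get 8 (.var 6)) (.var 7)) ;;
  .ite (.natLt (.get 9 (.var 6)) (.get 9 (.var 5))) (.putNat 9 (.var 6) (.get 9 (.var 5))) .skip ;;
  .ite (.natLt (.get 9 (.var 6)) (.add (.var 7) (.lit 1)))
    (.putNat 9 (.var 6) (.add (.var 7) (.lit 1))) .skip ;;
  .setNat 5 (.var 6)

theorem stripStep_run (s : Store) {q p l : ℕ} (hq : s.natVar 5 = q) (hp : s.natArr 7 q = p)
    (hl : s.natArr 8 q = l) (hqp : p ≠ q) :
    (stripStep.run s).natVar 4 = s.natVar 4 ∧ (stripStep.run s).natVar 5 = p ∧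
    (stripStep.run s).natArr 6 = Function.update (Function.update (s.natArr 6) q 0) p
      (s.natArr 6 p - 1) ∧
    (stripStep.run s).natArr 7 = Function.update (s.natArr 7) p (s.natArr 7 p - q) ∧
    (stripStep.run s).natArr 8 = Function.update (s.natArr 8) p (s.natArr 8 p - l) ∧
    (stripStep.run s).natArr 9 = Function.update (s.natArr 9) p
      (max (max (s.natArr 9 p) (s.natArr 9 q)) (l + 1)) := by
  have hqp' : q ≠ p := hqp.symm
  simp only [stripStep, Program.run, Store.setNat, Store.putNat, NatExpr.eval, Test.Holds]
  simp only [Function.update_apply, hq, hp]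
  simp [hqp]
  split_ifs with h₁ h₂ h₂ <;> simp_all
  all_goals
    congr 1
    omega

/-- Remove vertices of degree one other than the root until none is left, and compute the
ready times. -/
def stripProgram : Program :=
  (.setNat 4 (.lit 0) ;; .setNat 5 (.lit 0)) ;;
  .loop (.natLt (.var 4) (.var 0))
    (.ite (.and (.natEq (.get 6 (.var 5)) (.lit 1)) (.not (.natEq (.var 5) (.var 1)))) stripStep
      (.setNat 4 (.add (.var 4) (.lit 1)) ;; .setNat 5 (.var 4)))

end RealRAM

/-- The state of the removal of leaves: the vertices in `U` are left. -/
structure StripState (n root : ℕ) (par rk : ℕ → ℕ) (U : Finset ℕ) (deg nsum esum Tm : ℕ → ℕ) :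
    Prop where
  subset : U ⊆ Finset.range n
  root_mem : root ∈ U
  par_mem : ∀ x ∈ U, x ≠ root → par x ∈ U
  deg_eq_zero : ∀ v < n, v ∉ U → deg v = 0
  deg_eq : ∀ v ∈ U, deg v = liveSum root par rk U (fun _ _ => 1) v
  nsum_eq : ∀ v ∈ U, nsum v = liveSum root par rk U (fun x _ => x) v
  esum_eq : ∀ v ∈ U, esum v = liveSum root par rk U (fun _ t => t) v
  ready_le : ∀ x < n, x ∉ U → Tm x ≤ Tm (par x) ∧ rk x < Tm (par x)
  attained : ∀ v < n, Tm v = 0 ∨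
    ∃ x < n, x ∉ U ∧ x ≠ root ∧ par x = v ∧ (Tm v = Tm x ∨ Tm v = rk x + 1)

namespace StripState

variable {n root : ℕ} {par rk dep A B : ℕ → ℕ} {U : Finset ℕ} {deg nsum esum Tm : ℕ → ℕ}

theorem mem_of_deg_eq_one (S : StripState n root par rk U deg nsum esum Tm) {z : ℕ} (hz : z < n)
    (h : deg z = 1) : z ∈ U := by
  by_contra hU
  rw [S.deg_eq_zero z hz hU] at h
  omega

/-- When `z` has degree one, all its children are gone and have reported to it, so its ready time is
final and can be passed to the parent together with the edge above `z`. -/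
theorem strip (H : RankedTree n root par rk dep A B)
    (S : StripState n root par rk U deg nsum esum Tm) {z : ℕ} (hz : z < n)
    (hzr : z ≠ root) (h : deg z = 1) :
    nsum z = par z ∧ esum z = rk z ∧ StripState n root par rk (U.erase z)
      (Function.update (Function.update deg z 0) (par z) (deg (par z) - 1))
      (Function.update nsum (par z) (nsum (par z) - z))
      (Function.update esum (par z) (esum (par z) - rk z))
      (Function.update Tm (par z) (max (max (Tm (par z)) (Tm z)) (rk z + 1))) := by
  have hzU := S.mem_of_deg_eq_one hz h
  rw [S.deg_eq z hzU] at h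
  obtain ⟨hchild, hφ⟩ := liveSum_of_degree_eq_one hzU hzr h
  refine ⟨by rw [S.nsum_eq z hzU, hφ], by rw [S.esum_eq z hzU, hφ], ?_⟩
  have hpU : par z ∈ U := S.par_mem z hzU hzr
  have hpn : par z < n := Finset.mem_range.1 (S.subset hpU)
  have hpz : par z ≠ z := fun h => by
    have := H.dep_par z hz hzr
    rw [h] at this
    omega
  -- One computation for degrees, neighbour sums and rank sums, which differ only in `φ`.
  have hupd : ∀ (φ : ℕ → ℕ → ℕ) (a : ℕ → ℕ), (∀ v ∈ U, a v = liveSum root par rk U φ v) →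
      ∀ v ∈ U.erase z, Function.update a (par z) (a (par z) - φ z (rk z)) v =
        liveSum root par rk (U.erase z) φ v := by
    intro φ a ha v hv
    rw [Finset.mem_erase] at hv
    have := liveSum_erase (par := par) (rk := rk) hzU hzr φ hv.1
    rw [← ha v hv.2] at this
    by_cases hvp : par z = v
    · subst hvp
      rw [if_pos rfl] at this
      rw [Function.update_self]
      omega
    · rw [if_neg hvp] at this
      rw [Function.update_of_ne (Ne.symm hvp)]
      omega
  refine ⟨(Finset.erase_subset _ _).trans S.subset, ?_, ?_, ?_, ?_, ?_, ?_, ?_, ?_⟩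
  · simp [S.root_mem, Ne.symm hzr]
  · intro x hx hxr
    rw [Finset.mem_erase] at hx ⊢
    exact ⟨hchild x hx.2 hxr, S.par_mem x hx.2 hxr⟩
  · intro v hv hvU
    rw [Finset.mem_erase, not_and_or, not_not] at hvU
    by_cases hvz : v = z
    · rw [hvz, Function.update_of_ne hpz.symm, Function.update_self]
    · have hvU' := hvU.resolve_left hvz
      rw [Function.update_of_ne (by rintro rfl; exact hvU' hpU), Function.update_of_ne hvz,
        S.deg_eq_zero v hv hvU']
  · intro v hv
    rw [← hupd (fun _ _ => 1) deg S.deg_eq v hv]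
    rw [Finset.mem_erase] at hv
    simp only [Function.update_apply, hv.1, if_false]
  · exact hupd (fun x _ => x) nsum S.nsum_eq
  · exact hupd (fun _ t => t) esum S.esum_eq
  · intro x hx hxU
    rw [Finset.mem_erase, not_and_or, not_not] at hxU
    by_cases hxz : x = z
    · subst hxz
      rw [Function.update_self, Function.update_of_ne hpz.symm]
      omega
    · have hxU' := hxU.resolve_left hxz
      have h₁ := S.ready_le x hx hxU'
      rw [Function.update_of_ne (a := x) (by rintro rfl; exact hxU' hpU)]
      by_cases hpx : par x = par z
      · rw [hpx] at h₁ ⊢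
        rw [Function.update_self]
        omega
      · rwa [Function.update_of_ne hpx]
  · intro v hv
    by_cases hvp : v = par z
    · subst hvp
      rw [Function.update_self]
      -- Either the old value survives with its old witness, or `z` becomes the witness.
      by_cases hmax : max (max (Tm (par z)) (Tm z)) (rk z + 1) = Tm (par z)
      · rw [hmax]
        refine (S.attained _ hv).imp_right ?_
        rintro ⟨x, hx, hxU, hxr, hxp, h⟩
        refine ⟨x, hx, fun h' => hxU (Finset.mem_of_mem_erase h'), hxr, hxp, ?_⟩
        rwa [Function.update_of_ne (by rintro rfl; exact hxU hpU)]
      · refine .inr ⟨z, hz, by simp, hzr, rfl, ?_⟩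
        rw [Function.update_of_ne hpz.symm]
        omega
    · rw [Function.update_of_ne hvp]
      refine (S.attained _ hv).imp_right ?_
      rintro ⟨x, hx, hxU, hxr, hxp, h⟩
      refine ⟨x, hx, fun h' => hxU (Finset.mem_of_mem_erase h'), hxr, hxp, ?_⟩
      rwa [Function.update_of_ne (by rintro rfl; exact hxU hpU)]

/-- If no vertex except possibly the root has degree one, only the root can be left: by induction
from the leaves, another remaining vertex would have lost all its children and so have degree one.
-/
theorem isReadyTime (H : RankedTree n root par rk dep A B)
    (S : StripState n root par rk U deg nsum esum Tm)
    (hdeg : ∀ v < n, v ≠ root → deg v ≠ 1) : IsReadyTime n root par rk Tm := by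
  have hU : ∀ x < n, x ≠ root → x ∉ U := by
    refine H.induction_up fun v hv ih hvr hvU => hdeg v hv hvr ?_
    rw [S.deg_eq v hvU, liveSum, ← Finset.sum_erase_add (a := v) _ _ (by simp [hvU, hvr]),
      if_pos rfl, if_neg, Finset.sum_eq_zero]
    · intro x hx
      simp only [Finset.mem_erase] at hx
      rw [if_neg hx.1, if_neg fun hxv =>
        ih x (Finset.mem_range.1 (S.subset hx.2.2)) hx.2.1 hxv hx.2.1 hx.2.2, add_zero]
    · exact fun hvv => ih v hv hvr hvv hvr hvU
  refine ⟨fun x hx hxr => (S.ready_le x hx (hU x hx hxr)).1,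
    fun x hx hxr => (S.ready_le x hx (hU x hx hxr)).2, fun v hv => ?_⟩
  refine (S.attained v hv).imp_right ?_
  rintro ⟨x, hx, -, hxr, hxp, h⟩
  exact ⟨x, hx, hxr, hxp, h⟩

end StripState

namespace RealRAM

/-- After a removal the parent is examined at once, even if the scan has passed it. Hence, among the
vertices up to the scanning position, only the current one and the root can have degree one. The
remaining scan length plus the number of remaining vertices decreases in every round and starts at
`2 * n`. -/
theorem stripProgram_spec {s : Store} {n root : ℕ} {par rk dep A B : ℕ → ℕ}
    (H : RankedTree n root par rk dep A B) (h0 : s.natVar 0 = n) (h1 : s.natVar 1 = root)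
    (S₀ : StripState n root par rk (Finset.range n) (s.natArr 6) (s.natArr 7) (s.natArr 8)
      (s.natArr 9)) :
    HaltsWithin stripProgram s (200 * budget n) fun s' =>
      IsReadyTime n root par rk (s'.natArr 9) := by
  have hn : 0 < n := H.root_lt.pos
  have hb := le_budget n
  unfold stripProgram
  refine ((HaltsWithin.of_run (Q := fun s' => s'.natVar 4 = 0 ∧ s'.natVar 5 = 0)
    (by simp [Program.LoopFree]) le_rfl ?_).frame.seq fun s₁ hs₁ =>
    (HaltsWithin.loop (B := 80) (fun i s' => ∃ U : Finset ℕ, i = (n - s'.natVar 4) + U.card ∧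
      StripState n root par rk U (s'.natArr 6) (s'.natArr 7) (s'.natArr 8) (s'.natArr 9) ∧
      (s'.natVar 4 < n ∧ s'.natVar 5 < n ∨ s'.natVar 4 = n ∧ s'.natVar 5 = n) ∧
      ∀ u ≤ s'.natVar 4, u < n → u ≠ s'.natVar 5 → u ≠ root → s'.natArr 6 u ≠ 1)
      (i := 2 * n) ?_ ?_).mono le_rfl ?_).mono ?_ fun _ h => h
  · simp [Program.run, Store.setNat, NatExpr.eval]
  · rw [hs₁.1.1, hs₁.1.2, hs₁.2.natArr 6 rfl, hs₁.2.natArr 7 rfl, hs₁.2.natArr 8 rfl,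
      hs₁.2.natArr 9 rfl]
    refine ⟨Finset.range n, ?_, S₀, .inl ⟨hn, hn⟩, fun u hu _ hu' => absurd (by omega) hu'⟩
    rw [Finset.card_range]
    omega
  · rintro i s₃ hF ⟨U, hi, S, hjq, hscan⟩ hb
    have h0₃ : s₃.natVar 0 = n :=
      (hF.natVar 0 rfl).trans ((hs₁.2.natVar 0 rfl).trans h0)
    have h1₃ : s₃.natVar 1 = root :=
      (hF.natVar 1 rfl).trans ((hs₁.2.natVar 1 rfl).trans h1)
    simp only [Test.Holds, NatExpr.eval, h0₃] at hb
    have hq : s₃.natVar 5 < n := by omega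
    have hbound : ∀ Q : Store → Prop, Q (Program.run _ s₃) → HaltsWithin _ s₃ 80 Q :=
      fun Q hQ => .of_run (P := .ite (.and (.natEq (.get 6 (.var 5)) (.lit 1))
        (.not (.natEq (.var 5) (.var 1)))) stripStep
        (.setNat 4 (.add (.var 4) (.lit 1)) ;; .setNat 5 (.var 4)))
        (by simp [Program.LoopFree, stripStep])
        (by simp [Program.bound, NatExpr.cost, Test.cost, stripStep]) hQ
    by_cases hc : s₃.natArr 6 (s₃.natVar 5) = 1 ∧ s₃.natVar 5 ≠ root
    · have hzU := S.mem_of_deg_eq_one hq hc.1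
      obtain ⟨hp, hl, S'⟩ := S.strip H hq hc.2 hc.1
      have hpn : par (s₃.natVar 5) < n := H.par_lt _ hq hc.2
      have hpz : par (s₃.natVar 5) ≠ s₃.natVar 5 := fun h => by
        have := H.dep_par _ hq hc.2
        rw [h] at this
        omega
      obtain ⟨e4, e5, e6, e7, e8, e9⟩ := stripStep_run s₃ rfl hp hl hpz
      have hcard := Finset.card_erase_add_one hzU
      refine ⟨n - s₃.natVar 4 + (U.erase (s₃.natVar 5)).card, by omega, hbound _ ?_⟩
      rw [Program.run, if_pos (by simpa [Test.Holds, NatExpr.eval, h1₃] using hc), e4, e5, e6, e7,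
        e8, e9]
      refine ⟨_, rfl, S', by omega, fun u hu hun hup hur => ?_⟩
      rw [Function.update_of_ne hup, Function.update_apply]
      split_ifs with huz
      · omega
      · exact hscan u hu hun huz hur
    · refine ⟨n - (s₃.natVar 4 + 1) + U.card, by omega, hbound _ ?_⟩
      rw [Program.run, if_neg (by simpa [Test.Holds, NatExpr.eval, h1₃] using hc)]
      simp only [Program.run, Store.setNat, NatExpr.eval, Function.update_self,
        Function.update_of_ne (show (4 : ℕ) ≠ 5 by decide)]
      refine ⟨U, rfl, S, by omega, fun u hu hun hup hur => ?_⟩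
      by_cases huz : u = s₃.natVar 5
      · subst huz
        exact fun h => hc ⟨h, hur⟩
      · exact hscan u (by omega) hun huz hur
  · rintro s' ⟨⟨hb, j, U, hi, S, hjq, hscan⟩, hF⟩
    simp only [Test.Holds, NatExpr.eval, hF.natVar 0 rfl, hs₁.2.natVar 0 rfl,
      h0] at hb
    exact S.isReadyTime H fun v hv hvr => hscan v (by omega) hv (by omega) hvr
  · simp only [Program.bound, NatExpr.cost, Test.cost]
    omega

end RealRAM

/-! ### Merging components -/

open Classical in
/-- The total weight of the vertices `v` in the component of `f` all of whose descendants lie in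
that component as well. -/
noncomputable def readyWeight (n root : ℕ) (par rk dep Tm : ℕ → ℕ) (w : ℕ → ℝ) (t f : ℕ) : ℝ :=
  ∑ v ∈ Finset.range n with top root par rk dep t v = top root par rk dep t f ∧ Tm v ≤ t, w v

/-- Data about the component of the vertex `r` in the forest of edges of rank less than `t`: the
weight `X` of its ready vertices, a list of its vertices from `hd` to `tl` along `next` in which
vertices farther from `tl` come first, and the least possible maximal demand `cost`, attained at
`tl`, caused by its edges. -/
structure IsComponent (n root : ℕ) (par rk dep Tm : ℕ → ℕ) (c w : ℕ → ℝ) (t r : ℕ) (X cost : ℝ)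
    (hd tl : ℕ) (next : ℕ → ℕ) : Prop where
  weight_eq : X = readyWeight n root par rk dep Tm w t r
  route : ∃ l : List ℕ, l.head? = some hd ∧ l.getLast? = some tl ∧
    l.IsChain (fun x y => next x = y) ∧ l.Nodup ∧
    (∀ x, x ∈ l ↔ x < n ∧ top root par rk dep t x = top root par rk dep t r) ∧
    l.Pairwise fun x y => ∀ t', top root par rk dep t' x = top root par rk dep t' tl →
      top root par rk dep t' y = top root par rk dep t' tl
  cost_ge : ∀ t' < t, (∃ y < n, top root par rk dep t y = top root par rk dep t tl ∧
      top root par rk dep t' y ≠ top root par rk dep t' tl) →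
    demand n root par rk dep Tm c w t' tl ≤ cost
  cost_le : ∀ f < n, top root par rk dep t f = top root par rk dep t r → ∀ k, 0 ≤ k →
    (∀ t' < t, (∃ y < n, top root par rk dep t y = top root par rk dep t f ∧
      top root par rk dep t' y ≠ top root par rk dep t' f) →
        demand n root par rk dep Tm c w t' f ≤ k) → cost ≤ k

/-- The redirected pointer belongs to the last entry of `l`, which occurs nowhere else in `l` and
not in `l'`, so all other links are intact. -/
theorem List.IsChain.append_update {next : ℕ → ℕ} {l l' : List ℕ} {z h : ℕ}
    (hl : l.IsChain fun x y => next x = y) (hl' : l'.IsChain fun x y => next x = y)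
    (hnd : l.Nodup) (hz : l.getLast? = some z) (hh : l'.head? = some h) (hzl' : z ∉ l') :
    (l ++ l').IsChain fun x y => Function.update next z h x = y := by
  induction l with
  | nil => simp at hz
  | cons x l ih =>
    cases l with
    | nil =>
      simp only [List.getLast?_singleton, Option.some.injEq] at hz
      subst hz
      rw [List.singleton_append, List.isChain_cons]
      refine ⟨fun y hy => ?_, hl'.imp_of_mem_imp fun a b ha _ hab => ?_⟩
      · rw [hh] at hy
        simpa using hy
      · rwa [Function.update_of_ne (by rintro rfl; exact hzl' ha)]
    | cons y l =>
      rw [List.isChain_cons_cons] at hl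
      rw [List.nodup_cons] at hnd
      rw [List.getLast?_cons_cons] at hz
      have hzx : x ≠ z := by
        rintro rfl
        exact hnd.1 (List.mem_of_getLast? hz)
      rw [List.cons_append, List.cons_append, List.isChain_cons_cons, Function.update_of_ne hzx]
      exact ⟨hl.1, ih hl.2 hnd.2 hz⟩

namespace RankedTree

variable {n root : ℕ} {par rk dep A B Tm : ℕ → ℕ} {c w : ℕ → ℝ}

/-- Blocked and ready vertices are complementary, so the total weight and the ready weight of a
component are all that the program needs. -/
theorem demand_eq_sub (n root : ℕ) (par rk dep Tm : ℕ → ℕ) (c w : ℕ → ℝ) (t f : ℕ) :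
    demand n root par rk dep Tm c w t f =
      c t + (∑ v ∈ Finset.range n, w v - readyWeight n root par rk dep Tm w t f) := by
  classical
  rw [demand, readyWeight, ← Finset.sum_filter_add_sum_filter_not (Finset.range n)
    (fun v => top root par rk dep t v = top root par rk dep t f ∧ Tm v ≤ t) w,
    add_sub_cancel_left]
  congr 1
  exact Finset.sum_congr (Finset.filter_congr fun _ _ => Iff.rfl) fun _ _ => rfl

/-- All end vertices in one component pay the same at this level, so a merge compares two components
and not individual vertices. -/
theorem demand_congr {t f g : ℕ} (h : top root par rk dep t f = top root par rk dep t g) :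
    demand n root par rk dep Tm c w t f = demand n root par rk dep Tm c w t g := by
  unfold demand Blocked
  rw [h]

/-- As long as the component of `f` does not change, its demand increases. -/
theorem demand_mono (H : RankedTree n root par rk dep A B) (hT : IsReadyTime n root par rk Tm)
    (hc : ∀ t t', t ≤ t' → t' < n - 1 → c t ≤ c t') (hw : ∀ v < n, 0 ≤ w v) {t' t f : ℕ}
    (htt : t' ≤ t) (ht : t < n - 1)
    (h : ∀ y < n, top root par rk dep t y = top root par rk dep t f →
      top root par rk dep t' y = top root par rk dep t' f) :
    demand n root par rk dep Tm c w t' f ≤ demand n root par rk dep Tm c w t f := by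
  classical
  refine add_le_add (hc t' t htt ht) (Finset.sum_le_sum_of_subset_of_nonneg ?_ ?_)
  · intro v hv
    rw [Finset.mem_filter, Finset.mem_range] at hv ⊢
    refine ⟨hv.1, fun hvt => hv.2 ⟨h v hv.1 hvt.1, not_lt.1 fun hlt => ?_⟩⟩
    -- The inherited property is being blocked at level `t`. An edge of rank at least `t'` with two
    -- unblocked ends would join vertices of the level-`t` component of `f`, which by `h` is
    -- connected already at level `t'`; such an edge has rank below `t'`.
    refine H.of_lt_readyTime hT (t := t') (C := fun u => ¬ (top root par rk dep t u =
      top root par rk dep t f ∧ Tm u ≤ t)) ?_ ?_ v hv.1 hlt hvt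
    · rintro x hx hxr hC ⟨h₁, h₂⟩
      have h₃ := hT.rk_lt x hx hxr
      refine hC ⟨?_, (hT.le_par x hx hxr).trans h₂⟩
      rwa [H.top_of_lt hx hxr (by omega)]
    · intro x hx hxr hge
      by_contra! hC
      have h₁ := h x hx hC.1.1
      have h₂ := h _ (H.par_lt x hx hxr) hC.2.1
      have := (H.top_par_eq_iff hx hxr).1 (h₁.trans h₂.symm)
      omega
  · intro v hv _
    exact hw v (Finset.mem_range.1 (Finset.mem_filter.1 hv).1)

/-- The components other than the two merged ones do not change. -/
theorem isComponent_succ (H : RankedTree n root par rk dep A B)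
    (hT : IsReadyTime n root par rk Tm) {t r z h : ℕ} {X cost : ℝ} {hd tl : ℕ} {next : ℕ → ℕ}
    (ht : t < n - 1) (hrA : top root par rk dep (t + 1) (A t) ≠
      top root par rk dep (t + 1) r)
    (hE : ∀ x < n, top root par rk dep (t + 1) x = top root par rk dep (t + 1) r ↔
      top root par rk dep t x = top root par rk dep t r)
    (hz : top root par rk dep t z ≠ top root par rk dep t r)
    (C : IsComponent n root par rk dep Tm c w t r X cost hd tl next) :
    IsComponent n root par rk dep Tm c w (t + 1) r X cost hd tl (Function.update next z h) := by
  obtain ⟨l, hh, hlast, hch, hnd, hmem, hpw⟩ := C.route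
  have htl := (hmem tl).1 (List.mem_of_getLast? hlast)
  have htl' := (hE tl htl.1).2 htl.2
  refine ⟨?_, ⟨l, hh, hlast, ?_, hnd, ?_, hpw⟩, ?_, ?_⟩
  · rw [C.weight_eq, readyWeight, readyWeight]
    refine Finset.sum_congr (Finset.filter_congr fun v hv => ?_) fun _ _ => rfl
    rw [Finset.mem_range] at hv
    rw [hE v hv]
    refine and_congr_right fun h => ⟨fun h => by omega, fun h' => ?_⟩
    -- A vertex with ready time `t + 1` lies in the component of the new edge, which is not the
    -- present one.
    by_contra hlt
    have := H.top_eq_of_readyTime_eq hT ht v hv (by omega)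
    exact hrA (this.symm.trans ((hE v hv).2 h))
  · refine hch.imp_of_mem_imp fun x y hx _ hxy => ?_
    rwa [Function.update_of_ne]
    rintro rfl
    exact hz ((hmem _).1 hx).2
  · intro x
    rw [hmem]
    exact and_congr_right fun hx => (hE x hx).symm
  · rintro t' ht' ⟨y, hy, hyt, hyt'⟩
    rw [htl', hE y hy, ← htl.2] at hyt
    rcases Nat.lt_succ_iff_lt_or_eq.1 ht' with h | rfl
    · exact C.cost_ge t' h ⟨y, hy, hyt, hyt'⟩
    · exact absurd hyt hyt'
  · intro f hf hfr k hk hdem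
    refine C.cost_le f hf ((hE f hf).1 hfr) k hk ?_
    rintro t' ht' ⟨y, hy, hyt, hyt'⟩
    refine hdem t' (by omega) ⟨y, hy, ?_, hyt'⟩
    rw [hfr, hE y hy, hyt]
    exact (hE f hf).1 hfr

/-- Merging the components of `a` and `b` along the edge of rank `t`. -/
theorem isComponent_merge (H : RankedTree n root par rk dep A B)
    (hT : IsReadyTime n root par rk Tm)
    (hc : ∀ t t', t ≤ t' → t' < n - 1 → c t ≤ c t') (hw : ∀ v < n, 0 ≤ w v)
    {t a b r : ℕ} {Xa Xb costa costb new : ℝ} {hda tla hdb tlb : ℕ} {next : ℕ → ℕ}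
    (ht : t < n - 1) (ha : a < n) (hb : b < n)
    (hab : top root par rk dep t a ≠ top root par rk dep t b)
    (hE : ∀ x < n, top root par rk dep (t + 1) x = top root par rk dep (t + 1) r ↔
      top root par rk dep t x = top root par rk dep t a ∨
      top root par rk dep t x = top root par rk dep t b)
    (hA : top root par rk dep (t + 1) (A t) = top root par rk dep (t + 1) r)
    (Ca : IsComponent n root par rk dep Tm c w t a Xa costa hda tla next)
    (Cb : IsComponent n root par rk dep Tm c w t b Xb costb hdb tlb next)
    (hnew : new = max costa (c t + (∑ v ∈ Finset.range n, w v - Xa)))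
    (hnewb : new ≤ max costb (c t + (∑ v ∈ Finset.range n, w v - Xb))) :
    IsComponent n root par rk dep Tm c w (t + 1) r
      (Xa + Xb + ∑ v ∈ Finset.range n with Tm v = t + 1, w v) new hdb tla
      (Function.update next tlb hda) := by
  classical
  obtain ⟨la, hha, hlasta, hcha, hnda, hmema, hpwa⟩ := Ca.route
  obtain ⟨lb, hhb, hlastb, hchb, hndb, hmemb, hpwb⟩ := Cb.route
  have htla := (hmema tla).1 (List.mem_of_getLast? hlasta)
  have htlb := (hmemb tlb).1 (List.mem_of_getLast? hlastb)
  have htlr := (hE tla htla.1).2 (.inl htla.2)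
  have hdisj : ∀ x ∈ lb, x ∉ la := fun x hxb hxa =>
    hab (((hmema x).1 hxa).2.symm.trans ((hmemb x).1 hxb).2)
  rw [Ca.weight_eq, ← demand_eq_sub] at hnew
  rw [Cb.weight_eq, ← demand_eq_sub] at hnewb
  refine ⟨?_, ⟨lb ++ la, ?_, ?_, ?_, ?_, ?_, ?_⟩, ?_, ?_⟩
  · rw [Ca.weight_eq, Cb.weight_eq, readyWeight, readyWeight, readyWeight]
    simp only [Finset.sum_filter]
    rw [← Finset.sum_add_distrib, ← Finset.sum_add_distrib]
    refine Finset.sum_congr rfl fun v hv => ?_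
    rw [Finset.mem_range] at hv
    -- The newly ready vertices all lie in the merged component, which is why their weight can be
    -- summed over the whole tree.
    have h₁ := H.top_eq_of_readyTime_eq hT ht v hv
    rw [hA, hE v hv] at h₁
    simp only [hE v hv]
    by_cases hva : top root par rk dep t v = top root par rk dep t a
    · have hvb : top root par rk dep t v ≠ top root par rk dep t b := fun h => hab (hva.symm.trans h)
      simp only [hva, hab, true_and, false_and, if_false, or_false]
      split_ifs <;> first | omega | simp
    · simp only [hva, false_and, if_false, false_or]
      by_cases hvb : top root par rk dep t v = top root par rk dep t b
      · simp only [hvb, true_and]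
        split_ifs <;> first | omega | simp
      · simp only [hvb, false_and, if_false]
        rw [if_neg fun h => (h₁ h).elim hva hvb]
        simp
  · rw [List.head?_append, hhb]
    rfl
  · rw [List.getLast?_append, hlasta]
    rfl
  · exact hchb.append_update hcha hndb hlastb hha (hdisj tlb (List.mem_of_getLast? hlastb))
  · rw [List.nodup_append]
    refine ⟨hndb, hnda, fun x hx y hy hxy => hdisj x hx (hxy ▸ hy)⟩
  · intro x
    rw [List.mem_append, hmema, hmemb]
    constructor
    · rintro (⟨h₁, h₂⟩ | ⟨h₁, h₂⟩)
      · exact ⟨h₁, (hE x h₁).2 (.inr h₂)⟩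
      · exact ⟨h₁, (hE x h₁).2 (.inl h₂)⟩
    · rintro ⟨h₁, h₂⟩
      exact ((hE x h₁).1 h₂).symm.imp (⟨h₁, ·⟩) (⟨h₁, ·⟩)
  -- A vertex of the discarded side meets `tla` only after level `t`, and by then the whole merged
  -- component has done so. The order within `lb` therefore does not matter, and `lb` may precede
  -- `la`.
  · have hfar : ∀ x ∈ lb, ∀ y < n, (top root par rk dep t y = top root par rk dep t a ∨
        top root par rk dep t y = top root par rk dep t b) → ∀ t',
        top root par rk dep t' x = top root par rk dep t' tla →
        top root par rk dep t' y = top root par rk dep t' tla := by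
      intro x hx y hy hyab t' hxt
      have hxb := (hmemb x).1 hx
      have htt : t < t' := by
        by_contra hle
        have := H.top_mono hxb.1 htla.1 hxt (not_lt.1 hle)
        exact hab (htla.2.symm.trans (this.symm.trans hxb.2))
      exact H.top_mono hy htla.1 (((hE y hy).2 hyab).trans htlr.symm) htt
    rw [List.pairwise_append]
    refine ⟨List.Pairwise.imp_of_mem (R := fun _ _ => True) (fun {x y} hx hy _ => ?_)
      (List.pairwise_of_forall (by simp)), hpwa, fun x hx y hy => ?_⟩
    · have := (hmemb y).1 hy
      exact hfar x hx y this.1 (.inr this.2)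
    · have := (hmema y).1 hy
      exact hfar x hx y this.1 (.inl this.2)
  · rintro t' ht' ⟨y, hy, hyt, hyt'⟩
    have hd : demand n root par rk dep Tm c w t tla ≤ new := by
      rw [hnew, demand_congr htla.2]
      exact le_max_right _ _
    rcases Nat.lt_succ_iff_lt_or_eq.1 ht' with h | rfl
    -- If the component of `tla` does not change between `t'` and `t`, the old cost says nothing
    -- about `t'`, but the demand at `t'` is at most that at `t`.
    · by_cases hex : ∃ y < n, top root par rk dep t y = top root par rk dep t tla ∧
        top root par rk dep t' y ≠ top root par rk dep t' tla
      · rw [hnew]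
        exact (Ca.cost_ge t' h hex).trans (le_max_left _ _)
      · push Not at hex
        exact (H.demand_mono hT hc hw h.le ht hex).trans hd
    · exact hd
  · intro f hf hfr k hk hdem
    -- An end vertex on the side of `a'` is charged the old cost of that side and also its demand at
    -- level `t`, where `b'` is still separated from it. The form is symmetric so that it serves
    -- both sides.
    have hcost : ∀ a' b' : ℕ, ∀ cost X hd tl, b' < n →
        top root par rk dep t a' ≠ top root par rk dep t b' →
        top root par rk dep (t + 1) b' = top root par rk dep (t + 1) r →
        IsComponent n root par rk dep Tm c w t a' X cost hd tl next →
        top root par rk dep t f = top root par rk dep t a' →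
        max cost (demand n root par rk dep Tm c w t a') ≤ k := by
      intro a' b' cost X hd tl hb' hab' hbr C hfa
      refine max_le (C.cost_le f hf hfa k hk ?_) ?_
      · rintro t' ht' ⟨y, hy, hyt, hyt'⟩
        exact hdem t' (by omega) ⟨y, hy, H.top_mono hy hf hyt (Nat.le_succ t), hyt'⟩
      · rw [← demand_congr hfa]
        refine hdem t (Nat.lt_succ_self t) ⟨b', hb', hbr.trans hfr.symm, ?_⟩
        rw [hfa]
        exact hab'.symm
    rcases (hE f hf).1 hfr with hfa | hfb
    · rw [hnew]
      exact hcost a b _ _ _ _ hb hab ((hE b hb).2 (.inr rfl)) Ca hfa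
    · exact hnewb.trans (hcost b a _ _ _ _ ha hab.symm ((hE a ha).2 (.inl rfl)) Cb hfb)

end RankedTree

/-! ### Union-find and the invariant of the merging loop. -/

/-- A union-find structure, with union by size, for the components of the forest of edges of rank
less than `t`. -/
structure IsUnionFind (n root : ℕ) (par rk dep : ℕ → ℕ) (t : ℕ) (uf sz : ℕ → ℕ) : Prop where
  lt : ∀ x < n, uf x < n
  top_eq : ∀ x < n, top root par rk dep t (uf x) = top root par rk dep t x
  eq_of_top_eq : ∀ x < n, ∀ y < n, uf x = x → uf y = y →
    top root par rk dep t x = top root par rk dep t y → x = y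
  size_pos : ∀ x < n, 1 ≤ sz x
  size_double : ∀ x < n, uf x ≠ x → 2 * sz x ≤ sz (uf x)
  size_eq : ∀ x < n, uf x = x → sz x =
    ((Finset.range n).filter fun y => top root par rk dep t y = top root par rk dep t x).card
  size_le : ∀ x < n, sz x ≤ n

/-- The components of the forest of edges of rank less than `t` are described by the arrays. -/
structure IsForest (n root : ℕ) (par rk dep Tm : ℕ → ℕ) (c w : ℕ → ℝ) (t : ℕ)
    (uf sz head tail next : ℕ → ℕ) (X cost : ℕ → ℝ) : Prop where
  unionFind : IsUnionFind n root par rk dep t uf sz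
  component : ∀ r < n, uf r = r →
    IsComponent n root par rk dep Tm c w t r (X r) (cost r) (head r) (tail r) next

namespace RankedTree

variable {n root : ℕ} {par rk dep A B Tm : ℕ → ℕ} {c w : ℕ → ℝ}

/-- Since `sz q ≤ sz p`, the size doubles along the new link. The entry of a vertex is frozen once
it stops being a representative, and sizes of representatives only grow, so earlier doubling
inequalities persist. -/
theorem isUnionFind_merge (H : RankedTree n root par rk dep A B) {t p q : ℕ} {uf sz : ℕ → ℕ}
    (U : IsUnionFind n root par rk dep t uf sz) (hp : p < n) (hq : q < n) (hpr : uf p = p)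
    (hqr : uf q = q) (hpq : top root par rk dep t p ≠ top root par rk dep t q)
    (hE : ∀ x < n, ∀ y < n, top root par rk dep (t + 1) x = top root par rk dep (t + 1) y ↔
      top root par rk dep t x = top root par rk dep t y ∨
      top root par rk dep t x = top root par rk dep t p ∧
        top root par rk dep t y = top root par rk dep t q ∨
      top root par rk dep t x = top root par rk dep t q ∧
        top root par rk dep t y = top root par rk dep t p)
    (hsz : sz q ≤ sz p) :
    IsUnionFind n root par rk dep (t + 1) (Function.update uf q p)
      (Function.update sz p (sz p + sz q)) := by
  have hne : q ≠ p := fun h => hpq (h ▸ rfl)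
  have hroot : ∀ x < n, Function.update uf q p x = x → x ≠ q ∧ uf x = x := by
    intro x hx h
    rw [Function.update_apply] at h
    split_ifs at h with hxq
    · exact absurd (hxq.symm.trans h.symm) hne
    · exact ⟨hxq, h⟩
  have hcard : sz p + sz q = ((Finset.range n).filter fun y =>
      top root par rk dep (t + 1) y = top root par rk dep (t + 1) p).card := by
    rw [U.size_eq p hp hpr, U.size_eq q hq hqr, ← Finset.card_union_of_disjoint]
    · congr 1
      ext y
      simp only [Finset.mem_union, Finset.mem_filter, Finset.mem_range]
      rw [← and_or_left]
      refine and_congr_right fun hy => ?_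
      rw [hE y hy p hp]
      tauto
    · rw [Finset.disjoint_filter]
      exact fun y _ h h' => hpq (h.symm.trans h')
  have hle : sz p + sz q ≤ n := by
    rw [hcard]
    exact (Finset.card_filter_le _ _).trans (Finset.card_range n).le
  refine ⟨?_, ?_, ?_, ?_, ?_, ?_, ?_⟩
  · intro x hx
    rw [Function.update_apply]
    split_ifs
    · exact hp
    · exact U.lt x hx
  · intro x hx
    rw [Function.update_apply]
    split_ifs with h
    · rw [h, hE p hp q hq]
      exact .inr (.inl ⟨rfl, rfl⟩)
    · exact H.top_mono (U.lt x hx) hx (U.top_eq x hx) (Nat.le_succ t)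
  · intro x hx y hy hxr hyr h
    obtain ⟨hxq, hxr⟩ := hroot x hx hxr
    obtain ⟨hyq, hyr⟩ := hroot y hy hyr
    rcases (hE x hx y hy).1 h with h | ⟨-, h⟩ | ⟨h, -⟩
    · exact U.eq_of_top_eq x hx y hy hxr hyr h
    · exact absurd (U.eq_of_top_eq y hy q hq hyr hqr h) hyq
    · exact absurd (U.eq_of_top_eq x hx q hq hxr hqr h) hxq
  · intro x hx
    rw [Function.update_apply]
    split_ifs
    · have := U.size_pos p hp
      omega
    · exact U.size_pos x hx
  · intro x hx
    simp only [Function.update_apply]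
    by_cases hxq : x = q
    · subst hxq
      simp only [if_true, hne, if_false]
      omega
    · simp only [hxq, if_false]
      intro hxr
      have hxp : x ≠ p := by
        rintro rfl
        exact hxr hpr
      have := U.size_double x hx hxr
      simp only [hxp, if_false]
      split_ifs with h
      · rw [h] at this
        omega
      · exact this
  · intro x hx hxr
    obtain ⟨hxq, hxr⟩ := hroot x hx hxr
    rw [Function.update_apply]
    split_ifs with hxp
    · rw [hxp, hcard]
    · rw [U.size_eq x hx hxr]
      congr 1
      refine Finset.filter_congr fun y hy => ?_
      rw [hE y (Finset.mem_range.1 hy) x hx]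
      refine ⟨.inl, ?_⟩
      rintro (h | ⟨-, h⟩ | ⟨-, h⟩)
      · exact h
      · exact absurd (U.eq_of_top_eq x hx q hq hxr hqr h) hxq
      · exact absurd (U.eq_of_top_eq x hx p hp hxr hpr h) hxp
  · intro x hx
    rw [Function.update_apply]
    split_ifs
    · exact hle
    · exact U.size_le x hx

/-- Two independent choices meet here: the walk ends on the side of `a`, while `p` is the side that
is not smaller and provides the representative. Hence both ways of matching `p, q` with `a, b`. -/
theorem isForest_merge (H : RankedTree n root par rk dep A B)
    (hT : IsReadyTime n root par rk Tm)
    (hc : ∀ t t', t ≤ t' → t' < n - 1 → c t ≤ c t') (hw : ∀ v < n, 0 ≤ w v)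
    {t a b p q : ℕ} {uf sz head tail next : ℕ → ℕ} {X cost : ℕ → ℝ} {new : ℝ}
    (F : IsForest n root par rk dep Tm c w t uf sz head tail next X cost)
    (ht : t < n - 1) (ha : a < n) (hb : b < n) (har : uf a = a) (hbr : uf b = b)
    (hab : top root par rk dep t a = top root par rk dep t (A t) ∧
        top root par rk dep t b = top root par rk dep t (B t) ∨
      top root par rk dep t b = top root par rk dep t (A t) ∧
        top root par rk dep t a = top root par rk dep t (B t))
    (hpq : p = a ∧ q = b ∨ p = b ∧ q = a) (hsz : sz q ≤ sz p)
    (hnew : new = max (cost a) (c t + (∑ v ∈ Finset.range n, w v - X a)))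
    (hnewb : new ≤ max (cost b) (c t + (∑ v ∈ Finset.range n, w v - X b))) :
    IsForest n root par rk dep Tm c w (t + 1) (Function.update uf q p)
      (Function.update sz p (sz a + sz b)) (Function.update head p (head b))
      (Function.update tail p (tail a)) (Function.update next (tail b) (head a))
      (Function.update X p (X a + X b + ∑ v ∈ Finset.range n with Tm v = t + 1, w v))
      (Function.update cost p new) := by
  have hE : ∀ x < n, ∀ y < n, top root par rk dep (t + 1) x = top root par rk dep (t + 1) y ↔
      top root par rk dep t x = top root par rk dep t y ∨
      top root par rk dep t x = top root par rk dep t a ∧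
        top root par rk dep t y = top root par rk dep t b ∨
      top root par rk dep t x = top root par rk dep t b ∧
        top root par rk dep t y = top root par rk dep t a := by
    intro x hx y hy
    rcases hab with ⟨h₁, h₂⟩ | ⟨h₁, h₂⟩
    · exact H.top_succ_eq_iff ht h₁ h₂ hx hy
    · rw [H.top_succ_eq_iff ht h₁ h₂ hx hy]
      tauto
  have hne : top root par rk dep t a ≠ top root par rk dep t b := by
    have := H.top_ends_ne ht
    rcases hab with ⟨h₁, h₂⟩ | ⟨h₁, h₂⟩ <;> rw [h₁, h₂]
    · exact this
    · exact this.symm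
  have hA : ∀ x < n, top root par rk dep (t + 1) (A t) = top root par rk dep (t + 1) x ↔
      top root par rk dep t x = top root par rk dep t a ∨
      top root par rk dep t x = top root par rk dep t b := by
    intro x hx
    rw [hE _ (H.ends_lt ht).1 x hx]
    rcases hab with ⟨h₁, h₂⟩ | ⟨h₁, h₂⟩ <;> rw [← h₁] <;> grind
  constructor
  · rcases hpq with ⟨rfl, rfl⟩ | ⟨rfl, rfl⟩
    · exact H.isUnionFind_merge F.unionFind ha hb har hbr hne hE hsz
    · rw [add_comm (sz q)]
      refine H.isUnionFind_merge F.unionFind hb ha hbr har hne.symm (fun x hx y hy => ?_) hsz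
      rw [hE x hx y hy]
      tauto
  · intro r hr hrr
    by_cases hrp : r = p
    · subst hrp
      simp only [Function.update_self]
      have hrab : r = a ∨ r = b := hpq.imp And.left And.left
      refine H.isComponent_merge hT hc hw ht ha hb hne ?_ ?_ (F.component a ha har)
        (F.component b hb hbr) hnew hnewb
      · intro x hx
        rw [hE x hx r hr]
        rcases hrab with rfl | rfl <;> grind
      · rw [hA r hr]
        exact hrab.imp (congrArg _) (congrArg _)
    · have hrq : r ≠ q := by
        rintro rfl
        rw [Function.update_self] at hrr
        exact hrp hrr.symm
      rw [Function.update_of_ne hrq] at hrr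
      simp only [Function.update_of_ne hrp]
      have hra : r ≠ a := by omega
      have hrb : r ≠ b := by omega
      have hra' : top root par rk dep t r ≠ top root par rk dep t a :=
        fun h => hra (F.unionFind.eq_of_top_eq r hr a ha hrr har h)
      have hrb' : top root par rk dep t r ≠ top root par rk dep t b :=
        fun h => hrb (F.unionFind.eq_of_top_eq r hr b hb hrr hbr h)
      obtain ⟨l, -, hlast, -, -, hmem, -⟩ := (F.component b hb hbr).route
      have htl := ((hmem _).1 (List.mem_of_getLast? hlast)).2
      refine H.isComponent_succ hT ht ?_ ?_ ?_ (F.component r hr hrr)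
      · rw [Ne, hA r hr]
        tauto
      · intro x hx
        rw [hE x hx r hr]
        tauto
      · rw [htl]
        exact hrb'.symm

/-- The forest without edges. -/
theorem isForest_zero (H : RankedTree n root par rk dep A B) {uf sz head tail next : ℕ → ℕ}
    {X cost : ℕ → ℝ} (huf : ∀ x < n, uf x = x) (hsz : ∀ x < n, sz x = 1)
    (hhead : ∀ x < n, head x = x) (htail : ∀ x < n, tail x = x)
    (hX : ∀ x < n, X x = if Tm x = 0 then w x else 0) (hcost : ∀ x < n, cost x = 0) :
    IsForest n root par rk dep Tm c w 0 uf sz head tail next X cost := by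
  classical
  have hfilter : ∀ x < n, (Finset.range n).filter (fun y => y = x) = {x} := by
    intro x hx
    ext y
    simp only [Finset.mem_filter, Finset.mem_range, Finset.mem_singleton]
    exact ⟨And.right, fun h => ⟨h ▸ hx, h⟩⟩
  constructor
  · constructor
    · intro x hx
      rwa [huf x hx]
    · intro x hx
      rw [huf x hx]
    · intro x _ y _ _ _ h
      rwa [H.top_zero, H.top_zero] at h
    · intro x hx
      rw [hsz x hx]
    · exact fun x hx h => absurd (huf x hx) h
    · intro x hx _
      simp only [H.top_zero]
      rw [hfilter x hx, hsz x hx, Finset.card_singleton]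
    · intro x hx
      rw [hsz x hx]
      omega
  · intro r hr _
    refine ⟨?_, ⟨[r], by simp [hhead r hr], by simp [htail r hr], by simp, by simp, ?_, by simp⟩,
      by simp, ?_⟩
    · unfold readyWeight
      simp only [H.top_zero, Nat.le_zero]
      rw [← Finset.filter_filter, hfilter r hr, Finset.filter_singleton, hX r hr]
      split_ifs <;> simp
    · intro x
      simp only [H.top_zero, List.mem_singleton]
      exact ⟨fun h => ⟨h ▸ hr, h⟩, And.right⟩
    -- A single vertex causes no demand. Cost `0` is minimal because `cost_le` speaks of nonnegative
    -- `k` only.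
    · intro f _ _ k hk _
      rwa [hcost r hr]

end RankedTree

/-! ### The merging phase as a program. -/

namespace RealRAM

/-- Find the representative of the component of the vertex `q`. -/
def findProgram : Program :=
  .loop (.not (.natEq (.get 10 (.var 5)) (.var 5))) (.setNat 5 (.get 10 (.var 5)))

/-- Sizes at least double with each step and never exceed `n`; at index `0` the invariant would give
a size above `n`. -/
theorem findProgram_spec {s : Store} {n root t x : ℕ} {par rk dep : ℕ → ℕ} {sz : ℕ → ℕ}
    (U : IsUnionFind n root par rk dep t (s.natArr 10) sz) (hx : x < n) (hq : s.natVar 5 = x) :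
    HaltsWithin findProgram s (20 * (Nat.log 2 n + 1)) fun s' =>
      s'.natVar 5 < n ∧ s.natArr 10 (s'.natVar 5) = s'.natVar 5 ∧
        top root par rk dep t (s'.natVar 5) = top root par rk dep t x := by
  have hlog : n < 2 ^ (Nat.log 2 n + 1) := Nat.lt_pow_succ_log_self (by norm_num) n
  refine (HaltsWithin.loop (B := 3) (fun i s' => s'.natVar 5 < n ∧
    top root par rk dep t (s'.natVar 5) = top root par rk dep t x ∧
    2 ^ (Nat.log 2 n + 1) ≤ 2 ^ i * sz (s'.natVar 5)) (i := Nat.log 2 n + 1) ?_ ?_).mono ?_ ?_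
  · rw [hq]
    exact ⟨hx, rfl, Nat.le_mul_of_pos_right _ (U.size_pos x hx)⟩
  · rintro i s' hF ⟨h₁, h₂, h₃⟩ hb
    simp only [Test.Holds, NatExpr.eval, hF.natArr 10 rfl] at hb
    have hle := U.size_le _ h₁
    obtain _ | i := i
    · omega
    · refine ⟨i, Nat.lt_succ_self i, .of_run (by simp [Program.LoopFree])
        (by simp [Program.bound, NatExpr.cost]) ?_⟩
      simp only [Program.run, Store.setNat, NatExpr.eval, Function.update_self, hF.natArr 10 rfl]
      refine ⟨U.lt _ h₁, (U.top_eq _ h₁).trans h₂, h₃.trans ?_⟩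
      rw [pow_succ, mul_assoc]
      exact Nat.mul_le_mul_left _ (U.size_double _ h₁ hb)
  · simp only [Test.cost, NatExpr.cost]
    omega
  · rintro s' ⟨⟨hb, i, h₁, h₂, -⟩, hF⟩
    simp only [Test.Holds, NatExpr.eval, hF.natArr 10 rfl, not_not] at hb
    exact ⟨h₁, hb, h₂⟩

/-- Compute in the real variable `r` the cost of ending in the component of the vertex in the
integer variable `v`. -/
def candidateProgram (r v : ℕ) : Program :=
  .setReal r (.add (.get 1 (.get 15 (.var 4))) (.sub (.var 1) (.get 4 (.var v)))) ;;
  .ite (.realLt (.var r) (.get 5 (.var v))) (.setReal r (.get 5 (.var v))) .skip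

theorem candidateProgram_run (r v : ℕ) (s : Store) :
    (candidateProgram r v).run s = s.setReal r (max (s.realArr 5 (s.natVar v))
      (s.realArr 1 (s.natArr 15 (s.natVar 4)) + (s.realVar 1 - s.realArr 4 (s.natVar v)))) := by
  simp only [candidateProgram, Program.run, Test.Holds, NatExpr.eval, RealExpr.eval,
    Store.setReal, Function.update_self]
  split_ifs with h
  · rw [max_eq_left h.le, Function.update_idem]
  · rw [max_eq_right (not_lt.1 h)]

/-- Choose the component in which the walk ends: swap `a` and `b` if `b` is better. -/
def chooseProgram : Program :=
  candidateProgram 2 9 ;;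
  candidateProgram 3 10 ;;
  .ite (.realLt (.var 3) (.var 2))
    (.setReal 2 (.var 3) ;; .setNat 6 (.var 9) ;; .setNat 9 (.var 10) ;; .setNat 10 (.var 6))
    .skip

theorem chooseProgram_spec (s : Store) {a b : ℕ} (ha : s.natVar 9 = a) (hb : s.natVar 10 = b)
    {ca cb : ℝ}
    (hca : ca = max (s.realArr 5 a)
      (s.realArr 1 (s.natArr 15 (s.natVar 4)) + (s.realVar 1 - s.realArr 4 a)))
    (hcb : cb = max (s.realArr 5 b)
      (s.realArr 1 (s.natArr 15 (s.natVar 4)) + (s.realVar 1 - s.realArr 4 b))) :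
    HaltsWithin chooseProgram s 60 fun s' =>
      s'.natVar 9 = a ∧ s'.natVar 10 = b ∧ s'.realVar 2 = ca ∧ ca ≤ cb ∨
      s'.natVar 9 = b ∧ s'.natVar 10 = a ∧ s'.realVar 2 = cb ∧ cb ≤ ca := by
  subst ha hb
  refine .of_run (by simp [chooseProgram, candidateProgram, Program.LoopFree])
    (by simp [chooseProgram, candidateProgram, Program.bound, NatExpr.cost, RealExpr.cost,
      Test.cost]) ?_
  simp only [chooseProgram, Program.run, candidateProgram_run, Test.Holds, NatExpr.eval,
    RealExpr.eval, Store.setReal, Store.setNat, Function.update_self,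
    Function.update_of_ne (show (1 : ℕ) ≠ 2 by decide),
    Function.update_of_ne (show (2 : ℕ) ≠ 3 by decide), ← hca, ← hcb]
  by_cases hlt : cb < ca
  · simp [hlt, hlt.le]
  · simp [hlt, not_lt.1 hlt]

/-- Decide which representative becomes the parent of the other one. -/
def orderProgram : Program :=
  .ite (.natLt (.get 11 (.var 9)) (.get 11 (.var 10)))
    (.setNat 11 (.var 10) ;; .setNat 12 (.var 9))
    (.setNat 11 (.var 9) ;; .setNat 12 (.var 10))

theorem orderProgram_spec (s : Store) {a b : ℕ} (ha : s.natVar 9 = a) (hb : s.natVar 10 = b) :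
    HaltsWithin orderProgram s 20 fun s' =>
      (s'.natVar 11 = a ∧ s'.natVar 12 = b ∨ s'.natVar 11 = b ∧ s'.natVar 12 = a) ∧
      s.natArr 11 (s'.natVar 12) ≤ s.natArr 11 (s'.natVar 11) := by
  subst ha hb
  refine .of_run (by simp [orderProgram, Program.LoopFree])
    (by simp [orderProgram, Program.bound, NatExpr.cost, Test.cost]) ?_
  simp only [orderProgram, Program.run, Test.Holds, NatExpr.eval]
  by_cases h : s.natArr 11 (s.natVar 9) < s.natArr 11 (s.natVar 10)
  · simp [h, Store.setNat, h.le]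
  · simp [h, Store.setNat, not_lt.1 h]

/-- Merge the components of `a` and `b`. -/
def linkProgram : Program :=
  .setReal 4 (.add (.add (.get 4 (.var 9)) (.get 4 (.var 10)))
    (.get 3 (.add (.var 4) (.lit 1)))) ;;
  .setNat 6 (.add (.get 11 (.var 9)) (.get 11 (.var 10))) ;;
  .setNat 13 (.get 12 (.var 10)) ;;
  .setNat 14 (.get 13 (.var 9)) ;;
  .putNat 14 (.get 13 (.var 10)) (.get 12 (.var 9)) ;;
  .putNat 12 (.var 11) (.var 13) ;;
  .putNat 13 (.var 11) (.var 14) ;;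
  .putNat 10 (.var 12) (.var 11) ;;
  .putNat 11 (.var 11) (.var 6) ;;
  .putReal 4 (.var 11) (.var 4) ;;
  .putReal 5 (.var 11) (.var 2) ;;
  .setNat 4 (.add (.var 4) (.lit 1))

theorem linkProgram_run (s : Store) {j a b p q : ℕ} {new : ℝ} (hj : s.natVar 4 = j)
    (ha : s.natVar 9 = a) (hb : s.natVar 10 = b) (hp : s.natVar 11 = p) (hq : s.natVar 12 = q)
    (hnew : s.realVar 2 = new) :
    let s' := linkProgram.run s
    s'.natVar 4 = j + 1 ∧ s'.natArr 10 = Function.update (s.natArr 10) q p ∧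
    s'.natArr 11 = Function.update (s.natArr 11) p (s.natArr 11 a + s.natArr 11 b) ∧
    s'.natArr 12 = Function.update (s.natArr 12) p (s.natArr 12 b) ∧
    s'.natArr 13 = Function.update (s.natArr 13) p (s.natArr 13 a) ∧
    s'.natArr 14 = Function.update (s.natArr 14) (s.natArr 13 b) (s.natArr 12 a) ∧
    s'.realArr 4 = Function.update (s.realArr 4) p
      (s.realArr 4 a + s.realArr 4 b + s.realArr 3 (j + 1)) ∧
    s'.realArr 5 = Function.update (s.realArr 5) p new := by
  subst hj ha hb hp hq hnew
  simp [linkProgram, Program.run, Store.setNat, Store.putNat, Store.setReal, Store.putReal,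
    NatExpr.eval, RealExpr.eval]

/-- Find the representatives of the ends of the edge of rank `j`. -/
def locateProgram : Program :=
  .setNat 5 (.get 0 (.get 15 (.var 4))) ;;
  findProgram ;;
  (.setNat 9 (.var 5) ;; .setNat 5 (.get 1 (.get 15 (.var 4)))) ;;
  findProgram ;;
  .setNat 10 (.var 5)

theorem locateProgram_spec {s : Store} {n root t : ℕ} {par rk dep A B : ℕ → ℕ} {sz : ℕ → ℕ}
    (H : RankedTree n root par rk dep A B)
    (U : IsUnionFind n root par rk dep t (s.natArr 10) sz) (ht : t < n - 1)
    (hj : s.natVar 4 = t) (hA : s.natArr 0 (s.natArr 15 t) = A t)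
    (hB : s.natArr 1 (s.natArr 15 t) = B t) :
    HaltsWithin locateProgram s (60 * (Nat.log 2 n + 1)) fun s' =>
      (s'.natVar 9 < n ∧ s.natArr 10 (s'.natVar 9) = s'.natVar 9 ∧
        top root par rk dep t (s'.natVar 9) = top root par rk dep t (A t)) ∧
      s'.natVar 10 < n ∧ s.natArr 10 (s'.natVar 10) = s'.natVar 10 ∧
        top root par rk dep t (s'.natVar 10) = top root par rk dep t (B t) := by
  unfold locateProgram
  refine ((HaltsWithin.of_run (Q := fun s' => s'.natVar 5 = A t)
    (by simp [Program.LoopFree]) le_rfl ?_).frame.seq fun s₁ h₁ =>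
    (findProgram_spec (root := root) (par := par) (rk := rk) (dep := dep)
      (t := t) (sz := sz) ?_ (H.ends_lt ht).1 h₁.1).frame.seq fun s₂ h₂ =>
    (HaltsWithin.of_run (Q := fun s' => s'.natVar 9 = s₂.natVar 5 ∧ s'.natVar 5 = B t)
    (by simp [Program.LoopFree]) le_rfl ?_).frame.seq fun s₃ h₃ =>
    (findProgram_spec (root := root) (par := par) (rk := rk) (dep := dep)
      (t := t) (sz := sz) ?_ (H.ends_lt ht).2 h₃.1.2).frame.seq fun s₄ h₄ =>
    HaltsWithin.of_run (by simp [Program.LoopFree]) le_rfl ?_).mono ?_ fun _ h => h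
  · simp [Program.run, Store.setNat, NatExpr.eval, hj, hA]
  · rw [h₁.2.natArr 10 rfl]
    exact U
  · have e0 : s₂.natArr 0 = s.natArr 0 := (h₂.2.natArr 0 rfl).trans (h₁.2.natArr 0 rfl)
    have e1 : s₂.natArr 1 = s.natArr 1 := (h₂.2.natArr 1 rfl).trans (h₁.2.natArr 1 rfl)
    have e2 : s₂.natArr 15 = s.natArr 15 := (h₂.2.natArr 15 rfl).trans (h₁.2.natArr 15 rfl)
    have e3 : s₂.natVar 4 = t := (h₂.2.natVar 4 rfl).trans ((h₁.2.natVar 4 rfl).trans hj)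
    simp [Program.run, Store.setNat, NatExpr.eval, e1, e2, e3, hB]
  · rw [h₃.2.natArr 10 rfl, h₂.2.natArr 10 rfl, h₁.2.natArr 10 rfl]
    exact U
  · have e9 : s₄.natVar 9 = s₂.natVar 5 := (h₄.2.natVar 9 rfl).trans h₃.1.1
    have g₂ := h₂.1
    have g₄ := h₄.1
    rw [h₁.2.natArr 10 rfl] at g₂
    rw [h₃.2.natArr 10 rfl, h₂.2.natArr 10 rfl, h₁.2.natArr 10 rfl] at g₄
    simpa [Program.run, Store.setNat, NatExpr.eval, e9] using ⟨g₂, g₄⟩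
  · simp only [Program.bound, NatExpr.cost]
    omega

/-- Prepare the merging along the edge of rank `j`. -/
def selectProgram : Program := locateProgram ;; chooseProgram ;; orderProgram

theorem selectProgram_spec {s : Store} {n root t : ℕ} {par rk dep A B : ℕ → ℕ} {sz : ℕ → ℕ}
    (H : RankedTree n root par rk dep A B)
    (U : IsUnionFind n root par rk dep t (s.natArr 10) sz) (ht : t < n - 1)
    (hj : s.natVar 4 = t) (hA : s.natArr 0 (s.natArr 15 t) = A t)
    (hB : s.natArr 1 (s.natArr 15 t) = B t) :
    HaltsWithin selectProgram s (160 * (Nat.log 2 n + 1)) fun s' =>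
      ∃ a b p q new, s'.natVar 9 = a ∧ s'.natVar 10 = b ∧ s'.natVar 11 = p ∧ s'.natVar 12 = q ∧
        s'.realVar 2 = new ∧ a < n ∧ b < n ∧ s.natArr 10 a = a ∧ s.natArr 10 b = b ∧
        (top root par rk dep t a = top root par rk dep t (A t) ∧
          top root par rk dep t b = top root par rk dep t (B t) ∨
        top root par rk dep t b = top root par rk dep t (A t) ∧
          top root par rk dep t a = top root par rk dep t (B t)) ∧
        (p = a ∧ q = b ∨ p = b ∧ q = a) ∧ s.natArr 11 q ≤ s.natArr 11 p ∧
        new = max (s.realArr 5 a)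
          (s.realArr 1 (s.natArr 15 t) + (s.realVar 1 - s.realArr 4 a)) ∧
        new ≤ max (s.realArr 5 b)
          (s.realArr 1 (s.natArr 15 t) + (s.realVar 1 - s.realArr 4 b)) := by
  unfold selectProgram
  refine ((locateProgram_spec H U ht hj hA hB).frame.seq fun s₁ h₁ =>
    (chooseProgram_spec s₁ rfl rfl rfl rfl).frame.seq fun s₂ h₂ =>
    (orderProgram_spec s₂ rfl rfl).frame.mono le_rfl ?_).mono ?_ fun _ h => h
  · rintro s₃ ⟨⟨g₁, g₂⟩, hF⟩
    obtain ⟨⟨⟨ha, har, hat⟩, hb, hbr, hbt⟩, hF₁⟩ := h₁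
    obtain ⟨g₃, hF₂⟩ := h₂
    rw [hF₂.natArr 11 rfl, hF₁.natArr 11 rfl] at g₂
    rw [hF₁.realArr 1 rfl, hF₁.realArr 4 rfl, hF₁.realArr 5 rfl, hF₁.natArr 15 rfl,
      hF₁.natVar 4 rfl, hF₁.realVar 1 rfl, hj] at g₃
    refine ⟨_, _, _, _, _, rfl, rfl, rfl, rfl, rfl, ?_⟩
    rw [hF.natVar 9 rfl, hF.natVar 10 rfl, hF.realVar 2 rfl]
    rcases g₃ with ⟨e₁, e₂, e₃, e₄⟩ | ⟨e₁, e₂, e₃, e₄⟩ <;> rw [e₁, e₂] at g₁ ⊢ <;> rw [e₃]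
    · exact ⟨ha, hb, har, hbr, .inl ⟨hat, hbt⟩, g₁, g₂, rfl, e₄⟩
    · exact ⟨hb, ha, hbr, har, .inr ⟨hat, hbt⟩, g₁, g₂, rfl, e₄⟩
  · omega

/-- Kruskal's algorithm. -/
def kruskalProgram : Program :=
  .setNat 4 (.lit 0) ;; .loop (.natLt (.var 4) (.var 2)) (selectProgram ;; linkProgram)

theorem kruskalProgram_spec {s : Store} {n root : ℕ} {par rk dep A B Tm : ℕ → ℕ} {w : ℕ → ℝ}
    (H : RankedTree n root par rk dep A B) (hT : IsReadyTime n root par rk Tm)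
    (hc : ∀ t t', t ≤ t' → t' < n - 1 →
      s.realArr 1 (s.natArr 15 t) ≤ s.realArr 1 (s.natArr 15 t'))
    (hw : ∀ v < n, 0 ≤ w v) (hm : s.natVar 2 = n - 1)
    (hA : ∀ t, s.natArr 0 (s.natArr 15 t) = A t) (hB : ∀ t, s.natArr 1 (s.natArr 15 t) = B t)
    (hS : s.realVar 1 = ∑ v ∈ Finset.range n, w v)
    (hadd : ∀ i, s.realArr 3 i = ∑ v ∈ Finset.range n with Tm v = i, w v)
    (F₀ : IsForest n root par rk dep Tm (fun t => s.realArr 1 (s.natArr 15 t)) w 0 (s.natArr 10)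
      (s.natArr 11) (s.natArr 12) (s.natArr 13) (s.natArr 14) (s.realArr 4) (s.realArr 5)) :
    HaltsWithin kruskalProgram s (300 * budget n) fun s' =>
      IsForest n root par rk dep Tm (fun t => s.realArr 1 (s.natArr 15 t)) w (n - 1)
        (s'.natArr 10) (s'.natArr 11) (s'.natArr 12) (s'.natArr 13) (s'.natArr 14)
        (s'.realArr 4) (s'.realArr 5) := by
  have hn : 0 < n := H.root_lt.pos
  have hb := le_budget n
  unfold kruskalProgram
  refine ((HaltsWithin.of_run (Q := fun s' => s'.natVar 4 = 0)
    (by simp [Program.LoopFree]) le_rfl ?_).frame.seq fun s₁ hs₁ =>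
    (HaltsWithin.loop (B := 250 * (Nat.log 2 n + 1)) (fun i s' => i = n - 1 - s'.natVar 4 ∧
      s'.natVar 4 ≤ n - 1 ∧
      IsForest n root par rk dep Tm (fun t => s.realArr 1 (s.natArr 15 t)) w (s'.natVar 4)
        (s'.natArr 10) (s'.natArr 11) (s'.natArr 12) (s'.natArr 13) (s'.natArr 14)
        (s'.realArr 4) (s'.realArr 5)) (i := n - 1) ?_ ?_).mono le_rfl ?_).mono ?_ fun _ h => h
  · simp [Program.run, Store.setNat, NatExpr.eval]
  · rw [hs₁.1, hs₁.2.natArr 10 rfl, hs₁.2.natArr 11 rfl, hs₁.2.natArr 12 rfl,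
      hs₁.2.natArr 13 rfl, hs₁.2.natArr 14 rfl, hs₁.2.realArr 4 rfl, hs₁.2.realArr 5 rfl]
    exact ⟨rfl, Nat.zero_le _, F₀⟩
  · rintro i s₂ hF ⟨h₁, -, F⟩ hb
    have e0 : s₂.natArr 0 = s.natArr 0 := (hF.natArr 0 rfl).trans (hs₁.2.natArr 0 rfl)
    have e1 : s₂.natArr 1 = s.natArr 1 := (hF.natArr 1 rfl).trans (hs₁.2.natArr 1 rfl)
    have e15 : s₂.natArr 15 = s.natArr 15 := (hF.natArr 15 rfl).trans (hs₁.2.natArr 15 rfl)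
    have r1 : s₂.realArr 1 = s.realArr 1 := (hF.realArr 1 rfl).trans (hs₁.2.realArr 1 rfl)
    have r3 : s₂.realArr 3 = s.realArr 3 := (hF.realArr 3 rfl).trans (hs₁.2.realArr 3 rfl)
    have v1 : s₂.realVar 1 = s.realVar 1 := (hF.realVar 1 rfl).trans (hs₁.2.realVar 1 rfl)
    have v2 : s₂.natVar 2 = n - 1 := (hF.natVar 2 rfl).trans ((hs₁.2.natVar 2 rfl).trans hm)
    simp only [Test.Holds, NatExpr.eval, v2] at hb
    refine ⟨n - 1 - (s₂.natVar 4 + 1), by omega, ?_⟩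
    refine ((selectProgram_spec H F.unionFind hb rfl (by rw [e0, e15, hA])
      (by rw [e1, e15, hB])).frame.seq fun s₃ h₃ =>
      HaltsWithin.of_run (by simp [linkProgram, Program.LoopFree]) le_rfl ?_).mono ?_ fun _ h => h
    · obtain ⟨⟨a, b, p, q, new, h9, h10, h11, h12, hr2, ha, hb', har, hbr, hab, hpq, hsz, hnew,
        hnewb⟩, hF₃⟩ := h₃
      rw [e15, r1, v1, hS] at hnew hnewb
      obtain ⟨g4, g10, g11, g12, g13, g14, gr4, gr5⟩ :=
        linkProgram_run s₃ (hF₃.natVar 4 rfl) h9 h10 h11 h12 hr2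
      rw [g4, g10, g11, g12, g13, g14, gr4, gr5, hF₃.natArr 10 rfl, hF₃.natArr 11 rfl,
        hF₃.natArr 12 rfl, hF₃.natArr 13 rfl, hF₃.natArr 14 rfl, hF₃.realArr 3 rfl,
        hF₃.realArr 4 rfl, hF₃.realArr 5 rfl, r3, hadd]
      exact ⟨rfl, hb, H.isForest_merge hT hc hw F hb ha hb' har hbr hab hpq hsz hnew hnewb⟩
    · simp only [linkProgram, Program.bound, NatExpr.cost, RealExpr.cost]
      omega
  · rintro s' ⟨⟨hb, j, h₁, h₂, F⟩, hF⟩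
    simp only [Test.Holds, NatExpr.eval, hF.natVar 2 rfl, hs₁.2.natVar 2 rfl, hm] at hb
    rwa [show s'.natVar 4 = n - 1 by omega] at F
  · have := mul_le_budget (n := n) (i := n - 1)
      (b := 250 * (Nat.log 2 n + 1) + (1 + 1 + 1) + 1) (c := 254) (by omega) (by omega)
    simp only [Program.bound, NatExpr.cost, Test.cost]
    omega

end RealRAM

/-! ### Initialisation and output. -/

namespace RealRAM

/-- Enter the vertex `j` as a component of its own. -/
def initStep : Program :=
  .setReal 1 (.add (.var 1) (.get 0 (.var 4))) ;;
  .putReal 3 (.get 9 (.var 4)) (.add (.get 3 (.get 9 (.var 4))) (.get 0 (.var 4))) ;;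
  .putNat 10 (.var 4) (.var 4) ;;
  .putNat 11 (.var 4) (.lit 1) ;;
  .putNat 12 (.var 4) (.var 4) ;;
  .putNat 13 (.var 4) (.var 4) ;;
  .ite (.natEq (.get 9 (.var 4)) (.lit 0)) (.putReal 4 (.var 4) (.get 0 (.var 4)))
    (.putReal 4 (.var 4) (.lit 0)) ;;
  .setNat 4 (.add (.var 4) (.lit 1))

theorem initStep_run (s : Store) {j : ℕ} (hj : s.natVar 4 = j) :
    let s' := initStep.run s
    s'.natVar 4 = j + 1 ∧ s'.realVar 1 = s.realVar 1 + s.realArr 0 j ∧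
    s'.realArr 3 = Function.update (s.realArr 3) (s.natArr 9 j)
      (s.realArr 3 (s.natArr 9 j) + s.realArr 0 j) ∧
    s'.natArr 10 = Function.update (s.natArr 10) j j ∧
    s'.natArr 11 = Function.update (s.natArr 11) j 1 ∧
    s'.natArr 12 = Function.update (s.natArr 12) j j ∧
    s'.natArr 13 = Function.update (s.natArr 13) j j ∧
    s'.realArr 4 = Function.update (s.realArr 4) j
      (if s.natArr 9 j = 0 then s.realArr 0 j else 0) := by
  subst hj
  by_cases h : s.natArr 9 (s.natVar 4) = 0
  all_goals
    simp [initStep, Program.run, Store.setNat, Store.putNat, Store.setReal, Store.putReal,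
      NatExpr.eval, RealExpr.eval, Test.Holds, h]

/-- Set up Kruskal's algorithm. -/
def initProgram : Program :=
  (.setReal 1 (.lit 0) ;; .setNat 4 (.lit 0)) ;; .loop (.natLt (.var 4) (.var 0)) initStep

/-- Real array `3` collects the vertex weights by ready time, so that the merge along the edge of
rank `t` finds the newly ready weight in entry `t + 1`. -/
theorem initProgram_spec {s : Store} {n : ℕ} (hn : s.natVar 0 = n) (h3 : ∀ i, s.realArr 3 i = 0) :
    HaltsWithin initProgram s (100 * budget n + 20) fun s' =>
      s'.realVar 1 = ∑ v ∈ Finset.range n, s.realArr 0 v ∧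
      (∀ i, s'.realArr 3 i = ∑ v ∈ Finset.range n with s.natArr 9 v = i, s.realArr 0 v) ∧
      ∀ x < n, s'.natArr 10 x = x ∧ s'.natArr 11 x = 1 ∧ s'.natArr 12 x = x ∧
        s'.natArr 13 x = x ∧ s'.realArr 4 x = if s.natArr 9 x = 0 then s.realArr 0 x else 0 := by
  have hb := le_budget n
  unfold initProgram
  refine ((HaltsWithin.of_run (Q := fun s' => s'.natVar 4 = 0 ∧ s'.realVar 1 = 0)
    (by simp [Program.LoopFree]) le_rfl ?_).frame.seq fun s₁ hs₁ =>
    (HaltsWithin.loop (B := 60) (fun i s' => i = n - s'.natVar 4 ∧ s'.natVar 4 ≤ n ∧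
      s'.realVar 1 = ∑ v ∈ Finset.range (s'.natVar 4), s.realArr 0 v ∧
      (∀ i, s'.realArr 3 i =
        ∑ v ∈ Finset.range (s'.natVar 4) with s.natArr 9 v = i, s.realArr 0 v) ∧
      ∀ x < s'.natVar 4, s'.natArr 10 x = x ∧ s'.natArr 11 x = 1 ∧ s'.natArr 12 x = x ∧
        s'.natArr 13 x = x ∧ s'.realArr 4 x = if s.natArr 9 x = 0 then s.realArr 0 x else 0)
      (i := n) ?_ ?_).mono le_rfl ?_).mono ?_ fun _ h => h
  · simp [Program.run, Store.setNat, Store.setReal, NatExpr.eval, RealExpr.eval]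
  · rw [hs₁.1.1, hs₁.1.2, hs₁.2.realArr 3 rfl]
    simp [h3]
  · rintro i s₂ hF ⟨h₁, -, g1, g3, gx⟩ hb
    have h0 : s₂.natVar 0 = n := (hF.natVar 0 rfl).trans ((hs₁.2.natVar 0 rfl).trans hn)
    have a9 : s₂.natArr 9 = s.natArr 9 := (hF.natArr 9 rfl).trans (hs₁.2.natArr 9 rfl)
    have r0 : s₂.realArr 0 = s.realArr 0 := (hF.realArr 0 rfl).trans (hs₁.2.realArr 0 rfl)
    simp only [Test.Holds, NatExpr.eval, h0] at hb
    refine ⟨n - (s₂.natVar 4 + 1), by omega, .of_run (by simp [initStep, Program.LoopFree])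
      (by simp [initStep, Program.bound, NatExpr.cost, RealExpr.cost, Test.cost]) ?_⟩
    obtain ⟨e4, e1, e3, e10, e11, e12, e13, e5⟩ := initStep_run s₂ rfl
    rw [e4, e1, e3, e10, e11, e12, e13, e5, g1, a9, r0, Finset.sum_range_succ]
    refine ⟨rfl, hb, rfl, fun i => ?_, fun x hx => ?_⟩
    · rw [Finset.range_add_one, Finset.filter_insert]
      by_cases hi : s.natArr 9 (s₂.natVar 4) = i
      · rw [if_pos hi, Finset.sum_insert (by simp), hi, Function.update_self, g3, add_comm]
      · rw [if_neg hi, Function.update_of_ne (Ne.symm hi), g3]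
    · by_cases hxj : x = s₂.natVar 4
      · subst hxj
        simp
      · simp only [Function.update_of_ne hxj]
        exact gx x (by omega)
  · rintro s' ⟨⟨hb, j, h₁, h₂, g⟩, hF⟩
    simp only [Test.Holds, NatExpr.eval, hF.natVar 0 rfl, hs₁.2.natVar 0 rfl, hn] at hb
    rwa [show s'.natVar 4 = n by omega] at g
  · simp only [Program.bound, NatExpr.cost, RealExpr.cost, Test.cost]
    omega

/-- Append the vertex `q` to the output if it is a leaf, and go to the next vertex. -/
def traceStep : Program :=
  .ite (.and (.natEq (.get 9 (.var 5)) (.lit 0)) (.not (.natEq (.var 5) (.var 1))))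
    (.putNat 0 (.var 13) (.var 5) ;; .setNat 13 (.add (.var 13) (.lit 1))) .skip ;;
  .setNat 5 (.get 14 (.var 5)) ;;
  .setNat 4 (.add (.var 4) (.lit 1))

theorem traceStep_run (s : Store) {q : ℕ} (hq : s.natVar 5 = q) :
    let s' := traceStep.run s
    s'.natVar 4 = s.natVar 4 + 1 ∧ s'.natVar 5 = s.natArr 14 q ∧
    (List.range (s'.natVar 13)).map (s'.natArr 0) = (List.range (s.natVar 13)).map (s.natArr 0) ++
      [q].filter fun x => decide (s.natArr 9 x = 0 ∧ x ≠ s.natVar 1) := by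
  subst hq
  by_cases h : s.natArr 9 (s.natVar 5) = 0 ∧ s.natVar 5 ≠ s.natVar 1
  · simp [traceStep, Program.run, Store.setNat, Store.putNat, NatExpr.eval, Test.Holds, h,
      List.range_succ]
    intro a ha
    exact Function.update_of_ne ha.ne _ _
  · have h' := h
    rw [not_and, not_not] at h'
    simp [traceStep, Program.run, Store.setNat, NatExpr.eval, Test.Holds, h]

/-- Output the leaves in the list of vertices that starts at `q`. -/
def traceProgram : Program :=
  (.setNat 13 (.lit 0) ;; .setNat 4 (.lit 0)) ;;
  .loop (.natLt (.var 4) (.var 0)) traceStep ;;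
  .setNat 0 (.var 13)

/-- The split `l₁ ++ l₂` separates processed from pending vertices. At the end of the list a last
pointer is still read, but the condition on `l₂.head?` is then vacuous. The output overwrites one
end of the edge list, which is no longer needed. -/
theorem traceProgram_spec {s : Store} {n : ℕ} {l : List ℕ} (hn : s.natVar 0 = n)
    (hl : l.length = n) (hh : l.head? = some (s.natVar 5))
    (hch : l.IsChain fun x y => s.natArr 14 x = y) :
    HaltsWithin traceProgram s (100 * budget n + 20) fun s' =>
      s'.outputList = l.filter fun x => decide (s.natArr 9 x = 0 ∧ x ≠ s.natVar 1) := by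
  have hb := le_budget n
  unfold traceProgram
  refine ((HaltsWithin.of_run (Q := fun s' => s'.natVar 4 = 0 ∧ s'.natVar 13 = 0)
    (by simp [Program.LoopFree]) le_rfl ?_).frame.seq fun s₁ hs₁ =>
    (HaltsWithin.loop (B := 60) (fun i s' => ∃ l₁ l₂, l₁ ++ l₂ = l ∧ i = l₂.length ∧
      s'.natVar 4 = l₁.length ∧ (∀ y ∈ l₂.head?, s'.natVar 5 = y) ∧
      (List.range (s'.natVar 13)).map (s'.natArr 0) =
        l₁.filter fun x => decide (s.natArr 9 x = 0 ∧ x ≠ s.natVar 1))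
      (i := n) ?_ ?_).seq fun s₂ hs₂ => HaltsWithin.of_run (by simp [Program.LoopFree]) le_rfl
      ?_).mono ?_ fun _ h => h
  · simp [Program.run, Store.setNat, NatExpr.eval]
  · refine ⟨[], l, rfl, hl.symm, hs₁.1.1, fun y hy => ?_, ?_⟩
    · rw [hh, Option.mem_some_iff] at hy
      rw [hs₁.2.natVar 5 rfl, hy]
    · rw [hs₁.1.2]
      rfl
  · rintro i s₂ hF ⟨l₁, l₂, rfl, hi, g4, g5, gl⟩ hb
    have h0 : s₂.natVar 0 = n := (hF.natVar 0 rfl).trans ((hs₁.2.natVar 0 rfl).trans hn)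
    have h1 : s₂.natVar 1 = s.natVar 1 := (hF.natVar 1 rfl).trans (hs₁.2.natVar 1 rfl)
    have a9 : s₂.natArr 9 = s.natArr 9 := (hF.natArr 9 rfl).trans (hs₁.2.natArr 9 rfl)
    have a14 : s₂.natArr 14 = s.natArr 14 := (hF.natArr 14 rfl).trans (hs₁.2.natArr 14 rfl)
    simp only [Test.Holds, NatExpr.eval, h0, g4] at hb
    cases l₂ with
    | nil =>
      rw [List.append_nil] at hl
      omega
    | cons q l₂ =>
      refine ⟨l₂.length, by simp [hi], .of_run (by simp [traceStep, Program.LoopFree])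
        (by simp [traceStep, Program.bound, NatExpr.cost, Test.cost]) ?_⟩
      obtain ⟨e4, e5, el⟩ := traceStep_run s₂ (g5 q (by simp))
      refine ⟨l₁ ++ [q], l₂, by simp, rfl, by simp [e4, g4], fun y hy => ?_, ?_⟩
      · rw [e5, a14]
        have := (List.isChain_append.1 hch).2.1
        rw [List.isChain_cons] at this
        exact this.1 y hy
      · rw [el, gl, List.filter_append, h1, a9]
  · obtain ⟨⟨hb, j, l₁, l₂, rfl, -, g4, -, gl⟩, hF⟩ := hs₂
    simp only [Test.Holds, NatExpr.eval, hF.natVar 0 rfl, hs₁.2.natVar 0 rfl, hn] at hb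
    rw [List.length_append] at hl
    have : l₂ = [] := List.length_eq_zero_iff.1 (by omega)
    subst this
    simp only [Store.outputList, Program.run, Store.setNat, NatExpr.eval, Function.update_self, gl,
      List.append_nil]
  · simp only [Program.bound, NatExpr.cost, Test.cost]
    omega

/-- Output the results. -/
def finalProgram : Program :=
  .setNat 5 (.var 1) ;;
  findProgram ;;
  (.ite (.realLt (.get 5 (.var 5)) (.var 1)) (.setReal 0 (.var 1)) (.setReal 0 (.get 5 (.var 5))) ;;
  .setNat 5 (.get 12 (.var 5))) ;;
  traceProgram

/-- At level `n - 1` there is a single component, so a search from any vertex, here the root, finds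
its representative, and the route of that component lists all vertices. -/
theorem finalProgram_spec {s : Store} {n root : ℕ} {par rk dep A B Tm : ℕ → ℕ} {c w : ℕ → ℝ}
    (H : RankedTree n root par rk dep A B) (h0 : s.natVar 0 = n) (h1 : s.natVar 1 = root)
    (F : IsForest n root par rk dep Tm c w (n - 1) (s.natArr 10) (s.natArr 11) (s.natArr 12)
      (s.natArr 13) (s.natArr 14) (s.realArr 4) (s.realArr 5)) :
    HaltsWithin finalProgram s (200 * budget n + 50) fun s' => ∃ r < n, s.natArr 10 r = r ∧
      s'.outputReal = max (s.realVar 1) (s.realArr 5 r) ∧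
      ∃ l : List ℕ, l.Nodup ∧ (∀ x, x ∈ l ↔ x < n) ∧ l.getLast? = some (s.natArr 13 r) ∧
        (l.Pairwise fun x y => ∀ t, top root par rk dep t x =
          top root par rk dep t (s.natArr 13 r) → top root par rk dep t y =
          top root par rk dep t (s.natArr 13 r)) ∧
        s'.outputList = l.filter fun x => decide (s.natArr 9 x = 0 ∧ x ≠ root) := by
  have hn : 0 < n := H.root_lt.pos
  have hb := log_le_budget hn
  unfold finalProgram
  refine ((HaltsWithin.of_run (Q := fun s' => s'.natVar 5 = root)
    (by simp [Program.LoopFree]) le_rfl ?_).frame.seq fun s₁ h₁ =>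
    (findProgram_spec (root := root) (par := par) (rk := rk) (dep := dep)
      (t := n - 1) (sz := s.natArr 11) ?_ H.root_lt h₁.1).frame.seq fun s₂ h₂ =>
    (HaltsWithin.of_run (Q := fun s' => s'.natVar 5 = s₂.natArr 12 (s₂.natVar 5) ∧
      s'.realVar 0 = max (s₂.realVar 1) (s₂.realArr 5 (s₂.natVar 5)))
    (by simp [Program.LoopFree]) le_rfl ?_).frame.seq fun s₃ h₃ =>
    HaltsWithin.mono (B := 100 * budget n + 20) ?_ le_rfl fun _ h => h).mono ?_ fun _ h => h
  · simp [Program.run, Store.setNat, NatExpr.eval, h1]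
  · rw [h₁.2.natArr 10 rfl]
    exact F.unionFind
  · by_cases h : s₂.realArr 5 (s₂.natVar 5) < s₂.realVar 1
    · simp [Program.run, Store.setNat, Store.setReal, NatExpr.eval, RealExpr.eval, Test.Holds, h,
        h.le]
    · simp [Program.run, Store.setNat, Store.setReal, NatExpr.eval, RealExpr.eval, Test.Holds, h,
        not_lt.1 h]
  · obtain ⟨⟨hr, hrr, -⟩, hF₂⟩ := h₂
    rw [h₁.2.natArr 10 rfl] at hrr
    obtain ⟨⟨h5, hv⟩, hF₃⟩ := h₃
    have a9 : s₃.natArr 9 = s.natArr 9 :=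
      (hF₃.natArr 9 rfl).trans ((hF₂.natArr 9 rfl).trans (h₁.2.natArr 9 rfl))
    have a14 : s₃.natArr 14 = s.natArr 14 :=
      (hF₃.natArr 14 rfl).trans ((hF₂.natArr 14 rfl).trans (h₁.2.natArr 14 rfl))
    have v0 : s₃.natVar 0 = n :=
      (hF₃.natVar 0 rfl).trans ((hF₂.natVar 0 rfl).trans ((h₁.2.natVar 0 rfl).trans h0))
    have v1 : s₃.natVar 1 = root :=
      (hF₃.natVar 1 rfl).trans ((hF₂.natVar 1 rfl).trans ((h₁.2.natVar 1 rfl).trans h1))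
    rw [hF₂.natArr 12 rfl, h₁.2.natArr 12 rfl] at h5
    rw [hF₂.realVar 1 rfl, h₁.2.realVar 1 rfl, hF₂.realArr 5 rfl, h₁.2.realArr 5 rfl] at hv
    obtain ⟨l, hhd, hlast, hch, hnd, hmem, hpw⟩ := (F.component _ hr hrr).route
    have hmem' : ∀ x, x ∈ l ↔ x < n := fun x => by
      rw [hmem]
      exact and_iff_left_of_imp fun hx => by
        rw [H.top_last le_rfl x hx, H.top_last le_rfl _ hr]
    have hlen : l.length = n := by
      rw [← List.toFinset_card_of_nodup hnd, ← Finset.card_range n]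
      congr 1
      ext x
      simp [hmem']
    refine (traceProgram_spec v0 hlen (by rw [hhd, h5]) (by rwa [a14])).frame.mono le_rfl ?_
    rintro s' ⟨hs', hF⟩
    rw [a9, v1] at hs'
    exact ⟨_, hr, hrr, (hF.realVar 0 rfl).trans hv, l, hnd, hmem', hlast, hpw, hs'⟩
  · simp only [Program.bound, NatExpr.cost, RealExpr.cost, Test.cost]
    omega

end RealRAM

/-! ### Optimality of the result. -/

namespace Describes

variable {n : ℕ} {T : WeightedTree n} {par rk dep A B Tm : ℕ → ℕ} {c w : ℕ → ℝ}

theorem weight_univ_eq (D : Describes T par rk dep A B Tm c w) :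
    T.weight Finset.univ = ∑ v ∈ Finset.range n, w v := by
  rw [WeightedTree.weight, ← Fin.sum_univ_eq_sum_range]
  exact Finset.sum_congr rfl fun x _ => D.vertexWeight x

/-- The cost of the only component after all merges is optimal. -/
theorem suffices_of_isComponent (D : Describes T par rk dep A B Tm c w) {r hd tl : ℕ}
    {X cost : ℝ} {next : ℕ → ℕ} (hr : r < n)
    (C : IsComponent n T.root par rk dep Tm c w (n - 1) r X cost hd tl next) :
    Suffices T par rk dep Tm c w (max (∑ v ∈ Finset.range n, w v) cost) tl ∧
      ∀ k f (p : T.graph.Walk T.root f), T.IsStrategy k p →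
        max (∑ v ∈ Finset.range n, w v) cost ≤ k := by
  have hlast := D.ranked.top_last (t := n - 1) le_rfl
  obtain ⟨l, -, htl, -, -, hmem, -⟩ := C.route
  have htl : tl < n := ((hmem tl).1 (List.mem_of_getLast? htl)).1
  refine ⟨⟨D.weight_univ_eq.le.trans (le_max_left _ _), ?_⟩, fun k f p hp => max_le ?_ ?_⟩
  · rintro t ht ⟨y, hy, hne⟩
    exact (C.cost_ge t ht ⟨y, hy, by rw [hlast y hy, hlast tl htl], hne⟩).trans (le_max_right _ _)
  · rw [← D.weight_univ_eq]
    exact weight_univ_le hp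
  -- The nonnegativity of `k` demanded by `cost_le` comes from covering the root.
  · refine C.cost_le f f.2 (by rw [hlast f f.2, hlast r hr]) k
      ((T.vertexWeight_nonneg _).trans hp.1) ?_
    rintro t ht ⟨y, hy, -, hne⟩
    exact D.demand_le hp ⟨y, hy, hne⟩

/-- The route of the only component after all merges yields an optimal strategy. -/
theorem isMinAgents_and_isOptimalLeafOrder (D : Describes T par rk dep A B Tm c w) {k : ℝ} {tl : ℕ}
    (hk : Suffices T par rk dep Tm c w k tl)
    (hmin : ∀ k' f (p : T.graph.Walk T.root f), T.IsStrategy k' p → k ≤ k')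
    {l : List ℕ} (hnd : l.Nodup) (hmem : ∀ x, x ∈ l ↔ x < n)
    (hpw : l.Pairwise fun x y => ∀ t, top T.root par rk dep t x = top T.root par rk dep t tl →
      top T.root par rk dep t y = top T.root par rk dep t tl) :
    T.IsMinAgents k ∧ ∃ L : List (Fin n),
      l.filter (fun x => decide (Tm x = 0 ∧ x ≠ T.root)) = L.map Fin.val ∧
      T.IsOptimalLeafOrder L := by
  obtain ⟨l, rfl⟩ : ∃ l' : List (Fin n), l'.map Fin.val = l :=
    ⟨l.attach.map fun x => ⟨x.1, (hmem x.1).1 x.2⟩, by simp [List.map_map, Function.comp_def]⟩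
  obtain ⟨f, p, hp, hL⟩ := D.exists_isStrategy hk (l := l) (hnd.of_map _)
    (fun x => by simpa [Fin.val_inj] using (hmem x).2 x.2) (List.pairwise_map.1 hpw)
    (leaf := fun x => decide (Tm x = 0 ∧ (x : ℕ) ≠ T.root))
    (fun x => by rw [decide_eq_true_iff, D.isLeaf_iff, Ne, Ne, Fin.ext_iff])
  have hk' : T.IsMinAgents k := ⟨⟨f, p, hp⟩, fun k' ⟨f', p', hp'⟩ => hmin k' f' p' hp'⟩
  exact ⟨hk', _, List.filter_map, k, f, p, hk', hp, hL⟩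

end Describes

/-! ### Assembling the algorithm. -/

namespace RealRAM

variable {n : ℕ} {T : WeightedTree n} {ends : Fin (n - 1) → Fin n × Fin n}

theorem adj_iff_input (h : T.IsEdgeList ends) (x y : Fin n) : T.graph.Adj x y ↔ ∃ i < n - 1,
    (input T ends).natArr 0 i = x ∧ (input T ends).natArr 1 i = y ∨
    (input T ends).natArr 0 i = y ∧ (input T ends).natArr 1 i = x := by
  rw [← SimpleGraph.mem_edgeSet, ← h, Set.mem_range]
  constructor
  · rintro ⟨i, hi⟩
    refine ⟨i, i.2, ?_⟩
    simpa [input, Fin.val_inj, Prod.ext_iff] using hi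
  · rintro ⟨i, hi, h⟩
    refine ⟨⟨i, hi⟩, ?_⟩
    simpa [input, hi, Fin.val_inj, Prod.ext_iff] using h

theorem input_edgeWeight {i : ℕ} (hi : i < n - 1) {x y : Fin n}
    (h : (input T ends).natArr 0 i = x ∧ (input T ends).natArr 1 i = y ∨
      (input T ends).natArr 0 i = y ∧ (input T ends).natArr 1 i = x) :
    T.edgeWeight s(x, y) = (input T ends).realArr 1 i := by
  simp only [input, hi, dif_pos, if_true, one_ne_zero, if_false, Fin.val_inj] at h ⊢
  congr 1
  rw [eq_comm, Sym2.eq_iff]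
  exact h

/-- Applied to the sorted list of edge numbers, this shows that no edge is missing from it. -/
theorem exists_lt_eq_of_ne {m : ℕ} {f : ℕ → ℕ} (hf : ∀ t < m, f t < m)
    (hne : ∀ t t', t < t' → t' < m → f t ≠ f t') {i : ℕ} (hi : i < m) : ∃ t < m, f t = i := by
  have hinj : Function.Injective fun t : Fin m => (⟨f t, hf t t.2⟩ : Fin m) := by
    intro t t' h
    rw [Fin.mk.injEq] at h
    rcases lt_trichotomy t t' with hlt | heq | hgt
    · exact absurd h (hne t t' hlt t'.2)
    · exact heq
    · exact absurd h.symm (hne t' t hgt t.2)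
  obtain ⟨t, ht⟩ := Finite.injective_iff_surjective.1 hinj ⟨i, hi⟩
  exact ⟨t, t.2, congrArg Fin.val ht⟩

/-- Deployment on a tree. -/
def deployProgram : Program :=
  sortProgram ;; degreeProgram ;; stripProgram ;; initProgram ;; kruskalProgram ;; finalProgram

/-- The ranked tree is chosen after sorting, because ranks are positions in the sorted list. The
functions `par`, `rk` and `dep` serve the specification; no array of the program stores them. -/
theorem deployProgram_spec (hE : T.IsEdgeList ends) :
    HaltsWithin deployProgram (input T ends) (2300 * budget n) fun s' =>
      T.IsMinAgents s'.outputReal ∧ ∃ L : List (Fin n), s'.outputList = L.map Fin.val ∧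
        T.IsOptimalLeafOrder L := by
  have hn : 0 < n := T.root.pos
  have hb := log_le_budget hn
  set s := input T ends with hs
  have v0 : s.natVar 0 = n := rfl
  have v1 : s.natVar 1 = T.root := rfl
  have az : ∀ a, 2 ≤ a → s.natArr a = 0 := by
    intro a ha
    ext i
    simp [hs, input, show a ≠ 0 by omega, show a ≠ 1 by omega]
  have rz : ∀ a, 2 ≤ a → ∀ i, s.realArr a i = 0 := by
    intro a ha i
    simp [hs, input, show a ≠ 0 by omega, show a ≠ 1 by omega]
  have hw : ∀ x : Fin n, T.vertexWeight x = s.realArr 0 x := by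
    intro x
    simp [hs, input]
  have hw0 : ∀ v < n, 0 ≤ s.realArr 0 v := fun v hv => hw ⟨v, hv⟩ ▸ T.vertexWeight_nonneg ⟨v, hv⟩
  unfold deployProgram
  refine HaltsWithin.mono ((sortProgram_spec (s := s) hn
    fun q => congrFun (az 3 (by norm_num)) q).frame.seq (B₂ := 1100 * budget n) ?_) (by rw [v0]; omega)
    fun _ h => h
  rintro s₁ ⟨⟨hm, hlt, hne⟩, hF₁⟩
  rw [v0] at hm hlt hne
  set ord := s₁.natArr 15
  obtain ⟨par, rk, dep, H, hadj⟩ := T.exists_rankedTree (fun t => s.natArr 0 (ord t))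
    (fun t => s.natArr 1 (ord t)) (by
      intro x y
      rw [adj_iff_input hE]
      constructor
      · rintro ⟨i, hi, h⟩
        obtain ⟨t, ht, rfl⟩ := exists_lt_eq_of_ne hlt (fun t t' h h' => (hne t t' h h').1) hi
        exact ⟨t, ht, h⟩
      · rintro ⟨t, ht, h⟩
        exact ⟨ord t, hlt t ht, h⟩)
  refine HaltsWithin.mono ((degreeProgram_spec (n := n) (A := fun t => s.natArr 0 (ord t))
    (B := fun t => s.natArr 1 (ord t)) (by omega) hn
    (fun t => by rw [hF₁.natArr 0 rfl]) (fun t => by rw [hF₁.natArr 1 rfl])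
    ((hF₁.natArr 6 rfl).trans (az 6 (by norm_num))) ((hF₁.natArr 7 rfl).trans (az 7 (by norm_num)))
    ((hF₁.natArr 8 rfl).trans (az 8 (by norm_num)))).frame.seq (B₂ := 900 * budget n) ?_)
    (by omega) fun _ h => h
  rintro s₂ ⟨⟨e6, e7, e8⟩, hF₂⟩
  rw [hm] at e6 e7 e8
  refine HaltsWithin.mono ((stripProgram_spec (n := n) (root := T.root) H
    ((hF₂.natVar 0 rfl).trans (hF₁.natVar 0 rfl)) ((hF₂.natVar 1 rfl).trans (hF₁.natVar 1 rfl))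
    ?_).frame.seq (B₂ := 700 * budget n) ?_) (by omega) fun _ h => h
  · have e9 : s₂.natArr 9 = 0 :=
      (hF₂.natArr 9 rfl).trans ((hF₁.natArr 9 rfl).trans (az 9 (by norm_num)))
    rw [e6, e7, e8, e9]
    exact ⟨subset_rfl, Finset.mem_range.2 H.root_lt,
      fun x hx hxr => Finset.mem_range.2 (H.par_lt x (Finset.mem_range.1 hx) hxr),
      fun v hv h => absurd (Finset.mem_range.2 hv) h, fun v _ => H.incidenceSum_eq _ v,
      fun v _ => H.incidenceSum_eq _ v, fun v _ => H.incidenceSum_eq _ v,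
      fun x hx h => absurd (Finset.mem_range.2 hx) h, fun v _ => .inl rfl⟩
  rintro s₃ ⟨hT, hF₃⟩
  have D : Describes T par rk dep (fun t => s.natArr 0 (ord t)) (fun t => s.natArr 1 (ord t))
      (s₃.natArr 9) (fun t => s.realArr 1 (ord t)) (s.realArr 0) := by
    refine ⟨H, hT, hadj, fun x y hx hxy => ?_, fun t t' htt ht' => ?_, hw⟩
    · have hx' : (x : ℕ) ≠ T.root := fun h => hx (Fin.ext h)
      refine input_edgeWeight (hlt _ (H.rk_lt x x.2 hx')) ?_
      rw [← hxy]
      exact H.edge x x.2 hx'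
    · rcases htt.eq_or_lt with rfl | hlt'
      · exact le_rfl
      · exact (hne t t' hlt' ht').2
  have a15 : s₃.natArr 15 = ord := (hF₃.natArr 15 rfl).trans (hF₂.natArr 15 rfl)
  have a0 : s₃.natArr 0 = s.natArr 0 :=
    (hF₃.natArr 0 rfl).trans ((hF₂.natArr 0 rfl).trans (hF₁.natArr 0 rfl))
  have a1 : s₃.natArr 1 = s.natArr 1 :=
    (hF₃.natArr 1 rfl).trans ((hF₂.natArr 1 rfl).trans (hF₁.natArr 1 rfl))
  have r0 : s₃.realArr 0 = s.realArr 0 :=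
    (hF₃.realArr 0 rfl).trans ((hF₂.realArr 0 rfl).trans (hF₁.realArr 0 rfl))
  have r1 : s₃.realArr 1 = s.realArr 1 :=
    (hF₃.realArr 1 rfl).trans ((hF₂.realArr 1 rfl).trans (hF₁.realArr 1 rfl))
  have r3 : s₃.realArr 3 = s.realArr 3 :=
    (hF₃.realArr 3 rfl).trans ((hF₂.realArr 3 rfl).trans (hF₁.realArr 3 rfl))
  have r5 : s₃.realArr 5 = s.realArr 5 :=
    (hF₃.realArr 5 rfl).trans ((hF₂.realArr 5 rfl).trans (hF₁.realArr 5 rfl))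
  have u0 : s₃.natVar 0 = n :=
    (hF₃.natVar 0 rfl).trans ((hF₂.natVar 0 rfl).trans (hF₁.natVar 0 rfl))
  have u1 : s₃.natVar 1 = T.root :=
    (hF₃.natVar 1 rfl).trans ((hF₂.natVar 1 rfl).trans (hF₁.natVar 1 rfl))
  have u2 : s₃.natVar 2 = n - 1 :=
    (hF₃.natVar 2 rfl).trans ((hF₂.natVar 2 rfl).trans hm)
  refine HaltsWithin.mono ((initProgram_spec u0
    (fun i => by rw [r3, rz 3 (by norm_num)])).frame.seq (B₂ := 500 * budget n + 50) ?_)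
    (by omega) fun _ h => h
  rintro s₄ ⟨⟨hS, hadd, hx⟩, hF₄⟩
  rw [r0] at hS hadd hx
  have F₀ : IsForest n T.root par rk dep (s₃.natArr 9) (fun t => s₄.realArr 1 (s₄.natArr 15 t))
      (s.realArr 0) 0 (s₄.natArr 10) (s₄.natArr 11) (s₄.natArr 12) (s₄.natArr 13) (s₄.natArr 14)
      (s₄.realArr 4) (s₄.realArr 5) :=
    H.isForest_zero (fun x h => (hx x h).1) (fun x h => (hx x h).2.1) (fun x h => (hx x h).2.2.1)
      (fun x h => (hx x h).2.2.2.1) (fun x h => (hx x h).2.2.2.2)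
      (fun x _ => by rw [hF₄.realArr 5 rfl, r5, rz 5 (by norm_num)])
  have ec : (fun t => s₄.realArr 1 (s₄.natArr 15 t)) = fun t => s.realArr 1 (ord t) := by
    rw [hF₄.realArr 1 rfl, hF₄.natArr 15 rfl, r1, a15]
  refine HaltsWithin.mono ((kruskalProgram_spec H hT (fun t t' h h' => by
      rw [hF₄.realArr 1 rfl, hF₄.natArr 15 rfl, r1, a15]
      exact D.mono t t' h h') hw0
    ((hF₄.natVar 2 rfl).trans u2)
    (fun t => by rw [hF₄.natArr 0 rfl, hF₄.natArr 15 rfl, a0, a15])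
    (fun t => by rw [hF₄.natArr 1 rfl, hF₄.natArr 15 rfl, a1, a15]) hS hadd F₀).frame.seq
    (B₂ := 200 * budget n + 50) ?_) (by omega) fun _ h => h
  rintro s₅ ⟨F, hF₅⟩
  rw [ec] at F
  refine (finalProgram_spec H ((hF₅.natVar 0 rfl).trans ((hF₄.natVar 0 rfl).trans u0))
    ((hF₅.natVar 1 rfl).trans ((hF₄.natVar 1 rfl).trans u1)) F).mono le_rfl ?_
  rintro s' ⟨r, hr, hrr, hk, l, hnd, hmem, -, hpw, hl⟩
  obtain ⟨hsuf, hmin⟩ := D.suffices_of_isComponent hr (F.component r hr hrr)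
  rw [hl, hk, hF₅.realVar 1 rfl, hS, hF₅.natArr 9 rfl, hF₄.natArr 9 rfl]
  exact D.isMinAgents_and_isOptimalLeafOrder hsuf hmin hnd hmem hpw

end RealRAM

theorem mainTheorem3 :
    ∃ (P : RealRAM.Program) (C : ℕ),
      ∀ (n : ℕ) (T : WeightedTree n) (ends : Fin (n - 1) → Fin n × Fin n), T.IsEdgeList ends →
        ∃ (s : RealRAM.Store) (t : ℕ) (L : List (Fin n)),
          RealRAM.Exec P (RealRAM.input T ends) s t ∧
          t ≤ C * (n * (Nat.log 2 n + 1)) ∧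
          T.IsMinAgents s.outputReal ∧
          s.outputList = L.map Fin.val ∧
          T.IsOptimalLeafOrder L := by
  refine ⟨RealRAM.deployProgram, 2300, fun n T ends hE => ?_⟩
  obtain ⟨s, t, hexec, ht, hk, L, hL, hopt⟩ := RealRAM.deployProgram_spec hE
  exact ⟨s, t, L, hexec, ht, hk, hL, hopt⟩
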